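/- **Setting.** Let $X$ be a paracompact Hausdorff space and $\mathcal A^0$ a sheaf of (unital, associative) rings on $X$. For a closed set $K\subset X$ put $\mathcal A^0(K)=\varinjlim_{K\subset V}\mathcal A^0(V)$ ($V$ open). $\mathcal A^0$ is *soft* if $\mathcal A^0(X)\to\mathcal A^0(K)$ is surjective for every closed $K$. For an open $U\subset X$ write $R(U)=\varinjlim_{\overline U\subset V}\mathcal A^0(V)$, so that $R(X)=\mathcal A^0(X)$. Modules are modules on one fixed side, and for $V\subset U$ the restriction of an $R(U)$-module $M$ is $M|_V=R(V)\otimes_{R(U)}M$. Let $\mathcal P_{R(U)}$ be the class of bounded complexes of finitely generated projective $R(U)$-modules. An open cover is *good* if every non-empty finite intersection of its members is contractible. Let $\mathcal U=\{U_i\}$ be a locally finite open cover of $X$ and $U_{i_0\ldots i_p}=U_{i_0}\cap\dots\cap U_{i_p}$. *Cochains.* For families $E=\{E_i\}$, $F=\{F_i\}$ of complexes of $R(U_i)$-modules, a cochain $u$ of degree $d$ from $E$ to $F$ is a family $u^{p,q}_{i_0\ldots i_p}$, for $p\ge 0$, $p+q=d$ and all tuples $i_0,\dots,i_p$, of $R(U_{i_0\ldots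 i_p})$-linear maps $E_{i_p}^\bullet|_{U_{i_0\ldots i_p}}\to F_{i_0}^{\bullet+q}|_{U_{i_0\ldots i_p}}$ of graded modules. Put $$(u\cdot v)_{i_0\ldots i_{p+r}}^{p+r,q+s}=\sum (-1)^{qr}\,u^{p,q}_{i_0\ldots i_p}\circ v^{r,s}_{i_p\ldots i_{p+r}},\qquad (\delta u)_{i_0\ldots i_{p+1}}=\sum_{k=1}^{p}(-1)^k u_{i_0\ldots\widehat{i_k}\ldots i_{p+1}}|_{U_{i_0\ldots i_{p+1}}},$$ where the first sum is over all decompositions of the bidegree. *Twisted complexes.* A twisted complex $\mathcal F=(F_i^\bullet,b)$ on $\mathcal U$ consists of complexes $F_i^\bullet$ of $R(U_i)$-modules and a cochain $b=\sum_{k\ge0}b^{k,1-k}$ of degree $1$ from $F$ to $F$ such that $\delta b+b\cdot b=0$, $b^{0,1}_i$ is the differential of $F_i^\bullet$, and $b^{1,0}_{ii}$ is invertible up to homotopy for every $i$. Morphisms $(E,a)\to(F,b)$ of degree $d$ are the cochains $\varphi$ of degree $d$ from $E$ to $F$, with differential $d\varphi=\delta\varphi+b\cdot\varphi-(-1)^{d}\varphi\cdot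 a$ and composition $\cdot$. A *homotopy equivalence* is a closed morphism of degree $0$ that has a closed inverse of degree $0$ up to exact morphisms. $\mathrm{Tw}(X,\mathcal P_{\mathcal A^0},U_i)$ is the dg-category of those twisted complexes with $F_i^\bullet\in\mathcal P_{R(U_i)}$ for all $i$. *The functors.* For a complex $E$ of $\mathcal A^0(X)$-modules, $\mathcal T(E)$ is the twisted complex with $E_i=E|_{U_i}$, $a^{0,1}_i=d_E|_{U_i}$, $a^{1,0}_{ij}=\mathrm{id}$ and $a^{k,1-k}=0$ for $k\ge2$; for a chain map $\phi$, $\mathcal T(\phi)$ has the components $\phi|_{U_i}$ in bidegree $(0,0)$ and no others. For a twisted complex $\mathcal F=(F_i^\bullet,b)$, $\mathcal S(\mathcal F)$ is the complex of $\mathcal A^0(X)$-modules $$\mathcal S^n(\mathcal F)=\prod_{p+q=n}\ \prod_{i_0\ldots i_p}F^q_{i_0}|_{U_{i_0\ldots i_p}}$$ with differential $\delta+b$, where $(\delta c)_{i_0\ldots i_{p+1}}=\sum_{k=1}^{p+1}(-1)^kc_{i_0\ldots\widehat{i_k}\ldots i_{p+1}}|_{U_{i_0\ldots i_{p+1}}}$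 and $b$ acts by the formula for $u\cdot v$. The counit $\eta_{\mathcal F}:\mathcal T(\mathcal S(\mathcal F))\to\mathcal F$ is the morphism of degree $0$ whose component with index $i_0\ldots i_p$ is the $R(U_{i_0\ldots i_p})$-linear extension of the projection $c\mapsto c_{i_0\ldots i_p}$. **Proposition.** Let $X$ be a paracompact Hausdorff space with a soft sheaf of rings $\mathcal A^0$, and suppose that every locally finite open cover of $X$ has a finite good refinement. Let $\{U_i\}$ be a locally finite open cover of $X$. Then for every twisted complex $\mathcal F=(F_i^\bullet,b)\in\mathrm{Tw}(X,\mathcal P_{\mathcal A^0},U_i)$ there are a bounded complex $\mathcal E=(E^\bullet,d)\in\mathcal P_{\mathcal A^0(X)}$ of finitely generated projective $\mathcal A^0(X)$-modules and a quasi-isomorphism $\phi:\mathcal E\to\mathcal S(\mathcal F)$ of complexes of $\mathcal A^0(X)$-modules such that, moreover, the corresponding morphism $\eta_{\mathcal F}\circ\mathcal T(\phi):\mathcal T(\mathcal E)\to\mathcal F$ is a homotopy equivalence in $\mathrm{Tw}(X,\mathcal P_{\mathcal A^0},U_i)$. -/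

import Mathlib

open CategoryTheory CategoryTheory.Limits TopologicalSpace Opposite

universe u

noncomputable section

namespace TwistedDescent

/-! ### Sections of a sheaf near a closed set -/

section Sections

variable {X : TopCat.{u}}

/-- The open neighbourhoods of a subset `K` of `X`, ordered by inclusion. -/
abbrev Nhds (K : Set X) : Type u := {V : Opens X // K ⊆ V}

/-- The values of a presheaf of rings on the open neighbourhoods of `K`. -/
def nhdsDiagram (A : (Opens X)ᵒᵖ ⥤ RingCat.{u}) (K : Set X) :
    (Nhds K)ᵒᵖ ⥤ RingCat.{u} :=
  (Monotone.functor (f := fun V : Nhds K => V.1) (fun _ _ h => h)).op ⋙ A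

/-- `A(K) = colim_{K ⊆ V} A(V)`, the ring of sections of `A` near `K`. -/
def sectionsNear (A : (Opens X)ᵒᵖ ⥤ RingCat.{u}) (K : Set X) : RingCat.{u} :=
  colimit (nhdsDiagram A K)

/-- The germ near `K` of a section over an open neighbourhood of `K`. -/
def germNear (A : (Opens X)ᵒᵖ ⥤ RingCat.{u}) (K : Set X) (V : Nhds K) :
    A.obj (op V.1) ⟶ sectionsNear A K :=
  colimit.ι (nhdsDiagram A K) (op V)

/-- The restriction `A(K) → A(L)` for `L ⊆ K`. -/
def restrictNear (A : (Opens X)ᵒᵖ ⥤ RingCat.{u}) {K L : Set X} (h : L ⊆ K) :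
    sectionsNear A K ⟶ sectionsNear A L :=
  colimit.desc (nhdsDiagram A K)
    { pt := sectionsNear A L
      ι :=
        { app := fun V => germNear A L ⟨V.unop.1, h.trans V.unop.2⟩
          naturality := fun V W f => by
            let V' : Nhds L := ⟨V.unop.1, h.trans V.unop.2⟩
            let W' : Nhds L := ⟨W.unop.1, h.trans W.unop.2⟩
            have hle : W' ≤ V' := leOfHom f.unop
            exact (colimit.w (nhdsDiagram A L) (homOfLE hle).op).trans
              (Category.comp_id _).symm } }

theorem germNear_restrictNear (A : (Opens X)ᵒᵖ ⥤ RingCat.{u}) {K L : Set X} (h : L ⊆ K)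
    (V : Nhds K) :
    germNear A K V ≫ restrictNear A h = germNear A L ⟨V.1, h.trans V.2⟩ :=
  colimit.ι_desc _ _

theorem sectionsNear_hom_ext (A : (Opens X)ᵒᵖ ⥤ RingCat.{u}) {K : Set X} {B : RingCat.{u}}
    {f g : sectionsNear A K ⟶ B} (h : ∀ V, germNear A K V ≫ f = germNear A K V ≫ g) : f = g :=
  colimit.hom_ext fun V => h V.unop

/-- The presheaf of rings `U ↦ colim_{closure U ⊆ V} A(V)`. -/
def closureSections (A : (Opens X)ᵒᵖ ⥤ RingCat.{u}) : (Opens X)ᵒᵖ ⥤ RingCat.{u} where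
  obj U := sectionsNear A (closure (U.unop : Set X))
  map f := restrictNear A (closure_mono (leOfHom f.unop))
  map_id U := sectionsNear_hom_ext A fun V => by
    rw [germNear_restrictNear, Category.comp_id]
  map_comp f g := sectionsNear_hom_ext A fun V => by
    rw [germNear_restrictNear, ← Category.assoc, germNear_restrictNear, germNear_restrictNear]

/-- A sheaf of rings is soft if every section near a closed subset extends to all of `X`. -/
def IsSoft (A : TopCat.Sheaf RingCat.{u} X) : Prop :=
  ∀ K : Set X, IsClosed K →
    Function.Surjective (germNear A.obj K ⟨⊤, fun _ _ => trivial⟩).hom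

end Sections

/-! ### Open covers -/

section Covers

variable {X : TopCat.{u}} {ι : Type*}

/-- The intersection `U_{i₀…i_p}` of the members of `U` indexed by a tuple `l = [i₀, …, i_p]`. -/
def inter (U : ι → Opens X) (l : List ι) : Opens X :=
  ⟨⋂ i ∈ l, (U i : Set X), l.finite_toSet.isOpen_biInter fun i _ => (U i).isOpen⟩

theorem inter_le {U : ι → Opens X} {l : List ι} {i : ι} (h : i ∈ l) : inter U l ≤ U i :=
  fun _ hx => Set.mem_iInter₂.1 hx i h

theorem inter_mono {U : ι → Opens X} {l l' : List ι} (h : l' ⊆ l) : inter U l ≤ inter U l' :=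
  fun _ hx => Set.mem_iInter₂.2 fun i hi => Set.mem_iInter₂.1 hx i (h hi)

/-- `U` is a locally finite open cover of `X`. -/
def IsLocallyFiniteCover (U : ι → Opens X) : Prop :=
  (⨆ i, U i) = ⊤ ∧ LocallyFinite fun i => (U i : Set X)

/-- Every non-empty finite intersection of members of the family is contractible. -/
def IsGood (V : ι → Opens X) : Prop :=
  ∀ l : List ι, l ≠ [] → (inter V l : Set X).Nonempty → ContractibleSpace (inter V l)

/-- The cover `U` has a finite good refinement. -/
def HasFiniteGoodRefinement (U : ι → Opens X) : Prop :=
  ∃ (r : ℕ) (V : Fin r → Opens X),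
    (⨆ j, V j) = ⊤ ∧ (∀ j, ∃ i, V j ≤ U i) ∧ IsGood V

end Covers

/-! ### Restriction of modules along a presheaf of rings -/

section Restriction

variable {X : TopCat.{u}} (R : (Opens X)ᵒᵖ ⥤ RingCat.{u})

/-- The restriction homomorphism `R(U) → R(V)` for `V ≤ U`. -/
def rho {U V : Opens X} (h : V ≤ U) : R.obj (op U) →+* R.obj (op V) :=
  (R.map (homOfLE h).op).hom

theorem rho_rho {U V W : Opens X} (h : V ≤ U) (h' : W ≤ V) (r : R.obj (op U)) :
    rho R h' (rho R h r) = rho R (h'.trans h) r := by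
  have : R.map (homOfLE (h'.trans h)).op = R.map (homOfLE h).op ≫ R.map (homOfLE h').op := by
    rw [← R.map_comp]; rfl
  simp only [rho, this]; rfl

instance {U V W : Opens X} (h : V ≤ U) (h' : W ≤ V) :
    RingHomCompTriple (rho R h) (rho R h') (rho R (h'.trans h)) :=
  ⟨RingHom.ext fun r => rho_rho R h h' r⟩

section

variable {U V W : Opens X} (h : V ≤ U) (M : Type u) [AddCommGroup M] [Module (R.obj (op U)) M]

/-- The relations of the tensor product: in the free `R(V)`-module on the symbols `1 ⊗ m`, with
`m : M`, these are `1 ⊗ (m + m') = 1 ⊗ m + 1 ⊗ m'` and `1 ⊗ (r m) = r|_V (1 ⊗ m)`. -/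
inductive ResRel : (M →₀ R.obj (op V)) → Prop
  | add (m m' : M) :
      ResRel (Finsupp.single (m + m') 1 - (Finsupp.single m 1 + Finsupp.single m' 1))
  | smul (r : R.obj (op U)) (m : M) :
      ResRel (Finsupp.single (r • m) 1 - rho R h r • Finsupp.single m 1)

/-- The restriction `M|_V = R(V) ⊗_{R(U)} M` of a left `R(U)`-module. The rings need not be
commutative, so the tensor product is given by generators `1 ⊗ m` and relations. -/
def Res : Type u :=
  (M →₀ R.obj (op V)) ⧸ Submodule.span (R.obj (op V)) {x | ResRel R h M x}

instance : AddCommGroup (Res R h M) :=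
  Submodule.Quotient.addCommGroup _

instance : Module (R.obj (op V)) (Res R h M) :=
  Submodule.Quotient.module _

variable {M}

/-- The canonical map `M → M|_V`, `m ↦ 1 ⊗ m`. -/
def Res.unit : M →ₛₗ[rho R h] Res R h M where
  toFun m := Submodule.Quotient.mk (Finsupp.single m 1)
  map_add' m m' := (Submodule.Quotient.eq _).2 (Submodule.subset_span (ResRel.add m m'))
  map_smul' r m := (Submodule.Quotient.eq _).2 (Submodule.subset_span (ResRel.smul r m))

variable {h} in
theorem Res.induction {P : Res R h M → Prop} (x : Res R h M) (zero : P 0)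
    (unit : ∀ (r : R.obj (op V)) m, P (r • Res.unit R h m)) (add : ∀ x y, P x → P y → P (x + y)) :
    P x := by
  obtain ⟨y, rfl⟩ := Submodule.Quotient.mk_surjective _ x
  induction y using Finsupp.induction_linear with
  | zero => exact zero
  | add y z hy hz => exact add _ _ hy hz
  | single m r =>
    have e : Finsupp.single m r = r • Finsupp.single m (1 : R.obj (op V)) := by
      rw [Finsupp.smul_single, smul_eq_mul, mul_one]
    rw [e]
    exact unit r m

variable {N : Type u} [AddCommGroup N] [Module (R.obj (op V)) N]

/-- The `R(V)`-linear map `M|_V → N`, `r ⊗ m ↦ r • f m`, induced by a semilinear `f : M → N`. -/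
def Res.lift (f : M →ₛₗ[rho R h] N) : Res R h M →ₗ[R.obj (op V)] N :=
  Submodule.liftQ _ (Finsupp.linearCombination (R.obj (op V)) f) <| by
    rw [Submodule.span_le]
    rintro x (⟨m, m'⟩ | ⟨r, m⟩)
    · simp
    · simp [LinearMap.map_smulₛₗ]

@[simp]
theorem Res.lift_unit (f : M →ₛₗ[rho R h] N) (m : M) :
    Res.lift R h f (Res.unit R h m) = f m := by
  refine (Submodule.liftQ_apply _ _ _).trans ?_
  simp

variable {h} in
theorem Res.hom_ext {f g : Res R h M →ₗ[R.obj (op V)] N}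
    (H : ∀ m, f (Res.unit R h m) = g (Res.unit R h m)) : f = g := by
  ext x
  induction x using Res.induction with
  | zero => simp
  | unit r m => simp [H]
  | add x y hx hy => simp [hx, hy]

/-- The map `M|_V → N|_V` induced by an `R(U)`-linear map `M → N`. -/
def Res.map {N : Type u} [AddCommGroup N] [Module (R.obj (op U)) N]
    (f : M →ₗ[R.obj (op U)] N) : Res R h M →ₗ[R.obj (op V)] Res R h N :=
  Res.lift R h ((Res.unit R h).comp f)

@[simp]
theorem Res.map_unit {N : Type u} [AddCommGroup N] [Module (R.obj (op U)) N]
    (f : M →ₗ[R.obj (op U)] N) (m : M) :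
    Res.map R h f (Res.unit R h m) = Res.unit R h (f m) := by
  simp [Res.map]

/-- The restriction `M|_V → M|_W` of elements, `r ⊗ m ↦ r|_W ⊗ m`, for `W ≤ V ≤ U`. -/
def Res.move (h' : W ≤ V) : Res R h M →ₛₗ[rho R h'] Res R (h'.trans h) M :=
  letI : Module (R.obj (op V)) (Res R (h'.trans h) M) := Module.compHom _ (rho R h')
  let f : Res R h M →ₗ[R.obj (op V)] Res R (h'.trans h) M :=
    Res.lift R h
      { toFun := Res.unit R (h'.trans h)
        map_add' := map_add _
        map_smul' := fun r m => by
          rw [LinearMap.map_smulₛₗ, ← rho_rho R h h']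
          rfl }
  { toFun := f
    map_add' := f.map_add
    map_smul' := f.map_smul }

@[simp]
theorem Res.move_unit (h' : W ≤ V) (m : M) :
    Res.move R h h' (Res.unit R h m) = Res.unit R (h'.trans h) m :=
  letI : Module (R.obj (op V)) (Res R (h'.trans h) M) := Module.compHom _ (rho R h')
  Res.lift_unit R h (N := Res R (h'.trans h) M) _ m

theorem Res.move_move {W' : Opens X} (h' : W ≤ V) (h'' : W' ≤ W) (x : Res R h M) :
    Res.move R (h'.trans h) h'' (Res.move R h h' x) = Res.move R h (h''.trans h') x := by
  induction x using Res.induction with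
  | zero => simp
  | unit r m => simp [LinearMap.map_smulₛₗ]
  | add x y hx hy => simp [hx, hy]

end

section

variable {U U' V W : Opens X} {h : V ≤ U} {g : V ≤ U'}
  {M : Type u} [AddCommGroup M] [Module (R.obj (op U)) M]
  {N : Type u} [AddCommGroup N] [Module (R.obj (op U')) N]

/-- The restriction to `W ≤ V` of a map `M|_V → N|_V`; here `M` and `N` may be modules over
different open sets containing `V`. -/
def Res.moveHom (h' : W ≤ V) (u : Res R h M →ₗ[R.obj (op V)] Res R g N) :
    Res R (h'.trans h) M →ₗ[R.obj (op W)] Res R (h'.trans g) N :=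
  Res.lift R (h'.trans h) ((Res.move R g h').comp (u.comp (Res.unit R h)))

theorem Res.moveHom_unit (h' : W ≤ V) (u : Res R h M →ₗ[R.obj (op V)] Res R g N) (m : M) :
    Res.moveHom R h' u (Res.unit R (h'.trans h) m) = Res.move R g h' (u (Res.unit R h m)) := by
  simp [Res.moveHom]

theorem Res.moveHom_move (h' : W ≤ V) (u : Res R h M →ₗ[R.obj (op V)] Res R g N)
    (x : Res R h M) :
    Res.moveHom R h' u (Res.move R h h' x) = Res.move R g h' (u x) := by
  induction x using Res.induction with
  | zero => simp
  | unit r m => simp [LinearMap.map_smulₛₗ, Res.moveHom_unit]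
  | add x y hx hy => simp [hx, hy]

theorem Res.moveHom_moveHom {W' : Opens X} (h' : W ≤ V) (h'' : W' ≤ W)
    (u : Res R h M →ₗ[R.obj (op V)] Res R g N) :
    Res.moveHom R h'' (Res.moveHom R h' u) = Res.moveHom R (h''.trans h') u := by
  apply Res.hom_ext
  intro m
  rw [Res.moveHom_unit, Res.moveHom_unit, Res.moveHom_unit, Res.move_move]

theorem Res.moveHom_comp {U'' : Opens X} {k : V ≤ U''} {P : Type u} [AddCommGroup P]
    [Module (R.obj (op U'')) P] (h' : W ≤ V) (v : Res R g N →ₗ[R.obj (op V)] Res R k P)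
    (u : Res R h M →ₗ[R.obj (op V)] Res R g N) :
    Res.moveHom R h' (v.comp u) = (Res.moveHom R h' v).comp (Res.moveHom R h' u) := by
  apply Res.hom_ext
  intro m
  rw [Res.moveHom_unit, LinearMap.comp_apply, LinearMap.comp_apply, Res.moveHom_unit,
    Res.moveHom_move]

theorem Res.moveHom_add (h' : W ≤ V) (u v : Res R h M →ₗ[R.obj (op V)] Res R g N) :
    Res.moveHom R h' (u + v) = Res.moveHom R h' u + Res.moveHom R h' v := by
  apply Res.hom_ext
  intro m
  simp [Res.moveHom_unit]

theorem Res.moveHom_zero (h' : W ≤ V) :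
    Res.moveHom R h' (0 : Res R h M →ₗ[R.obj (op V)] Res R g N) = 0 := by
  apply Res.hom_ext
  intro m
  simp [Res.moveHom_unit]

variable (h g M N) in
/-- `Res.moveHom` as a homomorphism of groups. -/
def Res.moveHomAdd (h' : W ≤ V) :
    (Res R h M →ₗ[R.obj (op V)] Res R g N) →+
      (Res R (h'.trans h) M →ₗ[R.obj (op W)] Res R (h'.trans g) N) :=
  AddMonoidHom.mk' (Res.moveHom R h') (Res.moveHom_add R h')

end

section

variable {U V V' W : Opens X} (h : V ≤ U) (h' : W ≤ V) (g : V' ≤ U) (g' : W ≤ V')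
  {M : Type u} [AddCommGroup M] [Module (R.obj (op U)) M]
  {N : Type u} [AddCommGroup N] [Module (R.obj (op U)) N]

/-- The canonical map `(M|_V)|_W → M|_W`. -/
def Res.collapse : Res R h' (Res R h M) →ₗ[R.obj (op W)] Res R (h'.trans h) M :=
  Res.lift R h' (Res.move R h h')

/-- The canonical map `M|_W → (M|_V)|_W`. -/
def Res.expand : Res R (h'.trans h) M →ₗ[R.obj (op W)] Res R h' (Res R h M) :=
  Res.lift R (h'.trans h) ((Res.unit R h').comp (Res.unit R h))

/-- The map `(M|_V)|_W → (N|_V')|_W` induced by an `R(U)`-linear map `M → N`. It is the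
composite of `M|_W → N|_W` with the canonical identifications `(M|_V)|_W = M|_W` and
`(N|_V')|_W = N|_W`. -/
def Res.map₂ (f : M →ₗ[R.obj (op U)] N) :
    Res R h' (Res R h M) →ₗ[R.obj (op W)] Res R g' (Res R g N) :=
  Res.expand R g g' ∘ₗ Res.map R (h'.trans h) f ∘ₗ Res.collapse R h h'

theorem Res.hom_ext₂ {P : Type u} [AddCommGroup P] [Module (R.obj (op W)) P]
    {a b : Res R h' (Res R h M) →ₗ[R.obj (op W)] P}
    (H : ∀ m, a (Res.unit R h' (Res.unit R h m)) = b (Res.unit R h' (Res.unit R h m))) : a = b := by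
  apply Res.hom_ext
  intro x
  induction x using Res.induction with
  | zero => simp
  | unit r m => simp [LinearMap.map_smulₛₗ, H]
  | add x y hx hy => simp [hx, hy]

theorem Res.map₂_unit (f : M →ₗ[R.obj (op U)] N) (m : M) :
    Res.map₂ R h h' g g' f (Res.unit R h' (Res.unit R h m)) =
      Res.unit R g' (Res.unit R g (f m)) := by
  simp [Res.map₂, Res.collapse, Res.expand]

theorem Res.map₂_comp {V'' : Opens X} (k : V'' ≤ U) (k' : W ≤ V'') {P : Type u} [AddCommGroup P]
    [Module (R.obj (op U)) P] (f : N →ₗ[R.obj (op U)] P) (f' : M →ₗ[R.obj (op U)] N) :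
    Res.map₂ R h h' k k' (f.comp f') = (Res.map₂ R g g' k k' f).comp (Res.map₂ R h h' g g' f') := by
  apply Res.hom_ext₂
  intro m
  simp [Res.map₂_unit]

theorem Res.moveHom_map₂ {W' : Opens X} (k : W' ≤ W) (f : M →ₗ[R.obj (op U)] N) :
    Res.moveHom R k (Res.map₂ R h h' g g' f) = Res.map₂ R h (k.trans h') g (k.trans g') f := by
  apply Res.hom_ext₂
  intro m
  rw [Res.map₂_unit, Res.moveHom_unit, Res.map₂_unit, Res.move_unit]

theorem Res.map₂_self (f : M →ₗ[R.obj (op U)] N) :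
    Res.map₂ R h h' h h' f = Res.map R h' (Res.map R h f) := by
  apply Res.hom_ext₂
  intro m
  rw [Res.map₂_unit, Res.map_unit, Res.map_unit]

variable (M N) in
/-- `Res.map₂` as a homomorphism of groups. -/
def Res.map₂Add : (M →ₗ[R.obj (op U)] N) →+
    (Res R h' (Res R h M) →ₗ[R.obj (op W)] Res R g' (Res R g N)) :=
  AddMonoidHom.mk' (Res.map₂ R h h' g g') fun f f' => by
    apply Res.hom_ext₂
    intro m
    simp [Res.map₂_unit]

end

end Restriction

/-! ### Complexes of modules -/

section Complexes

variable {X : TopCat.{u}} (R : (Opens X)ᵒᵖ ⥤ RingCat.{u})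

/-- Cochain complexes of `R(U)`-modules. -/
abbrev Cpx (U : Opens X) := CochainComplex (ModuleCat.{u} (R.obj (op U))) ℤ

variable {R}

/-- The restriction of a complex of `R(U)`-modules to `V ≤ U`. -/
def resCpx {U V : Opens X} (h : V ≤ U) (E : Cpx R U) : Cpx R V where
  X n := ModuleCat.of _ (Res R h (E.X n))
  d i j := ModuleCat.ofHom (Res.map R h (E.d i j).hom)
  shape i j hij := by
    ext : 1
    apply Res.hom_ext
    intro m
    simp [E.shape i j hij]
  d_comp_d' i j k _ _ := by
    ext : 1
    apply Res.hom_ext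
    intro m
    have := congr($(E.d_comp_d i j k).hom m)
    simp only [ModuleCat.hom_comp, LinearMap.comp_apply, ModuleCat.hom_zero,
      LinearMap.zero_apply] at this
    simp [this]

/-- A bounded complex of finitely generated projective modules. -/
def IsStrictlyPerfect {U : Opens X} (E : Cpx R U) : Prop :=
  (∃ a b : ℤ, ∀ n, n < a ∨ b < n → Subsingleton (E.X n)) ∧
    ∀ n, Module.Finite (R.obj (op U)) (E.X n) ∧ Module.Projective (R.obj (op U)) (E.X n)

end Complexes

/-! ### Čech cochains with values in morphisms

A tuple `i₀ … i_p` of indices is a list of length `p + 1`. -/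

/-- An index of a component `u^{p,q}_{i₀…i_p} : E^n_{i_p} → F^m_{i₀}`, where `q = m - n` and
`p + q = d`, of a Čech cochain `u` of total degree `d`. It is determined by `i₀ … i_p` and `n`;
the names `tgt` for `i₀`, `src` for `i_p` and `m` for `n + q` are fields, with equations, so that
no transport along equalities is needed below. -/
structure HomIndex (ι : Type u) (d : ℤ) where
  p : ℕ
  l : List ι
  src : ι
  tgt : ι
  n : ℤ
  m : ℤ
  len : l.length = p + 1
  hsrc : l.getLast? = some src
  htgt : l.head? = some tgt
  deg : n + d = m + p

namespace HomIndex

variable {ι : Type u} {d : ℤ} (s : HomIndex ι d)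

theorem src_mem : s.src ∈ s.l := List.mem_of_getLast? s.hsrc

theorem tgt_mem : s.tgt ∈ s.l := List.mem_of_head? s.htgt

theorem src_eq_tgt (h : s.p = 0) : s.src = s.tgt := by
  have h1 := s.hsrc
  have h2 := s.htgt
  obtain ⟨x, hx⟩ := List.length_eq_one_iff.1 (s.len.trans (by rw [h]))
  rw [hx] at h1 h2
  simp at h1 h2
  exact h1.symm.trans h2

end HomIndex

section Tuples

variable {ι : Type u} {l : List ι} {p k : ℕ} {x : ι}

theorem length_face (h : l.length = p + 1) (hk : k < p) :
    (l.eraseIdx (k + 1)).length = p - 1 + 1 := by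
  rw [List.length_eraseIdx]; split <;> omega

theorem getLast_face (h : l.length = p + 1) (hk : k < p - 1) (hx : l.getLast? = some x) :
    (l.eraseIdx (k + 1)).getLast? = some x := by
  rw [List.getLast?_eq_getElem?] at hx ⊢
  rw [List.getElem?_eraseIdx, List.length_eraseIdx, ← hx]
  split_ifs <;> first | omega | (congr 1; omega)

theorem head_face (hx : l.head? = some x) : (l.eraseIdx (k + 1)).head? = some x := by
  rw [List.head?_eq_getElem?] at hx ⊢
  rw [List.getElem?_eraseIdx, if_pos (by omega), hx]

theorem length_front (h : l.length = p + 1) (hk : k < p + 1) :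
    (l.take (k + 1)).length = k + 1 := by
  rw [List.length_take]; omega

theorem getLast_front (hk : k < l.length) : (l.take (k + 1)).getLast? = some l[k] := by
  rw [List.getLast?_eq_getElem?, List.length_take, List.getElem?_take,
    if_pos (by omega), List.getElem?_eq_getElem (by omega)]
  congr 2; omega

theorem head_front (hx : l.head? = some x) : (l.take (k + 1)).head? = some x := by
  rw [List.head?_eq_getElem?] at hx ⊢
  rw [List.getElem?_take, if_pos (by omega), hx]

theorem length_back (h : l.length = p + 1) (hk : k < p + 1) :
    (l.drop k).length = p - k + 1 := by
  rw [List.length_drop]; omega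

theorem getLast_back (hk : k < l.length) (hx : l.getLast? = some x) :
    (l.drop k).getLast? = some x := by
  rw [List.getLast?_eq_getElem?] at hx ⊢
  rw [List.length_drop, List.getElem?_drop, ← hx]
  congr 1; omega

theorem head_back (hk : k < l.length) : (l.drop k).head? = some l[k] := by
  rw [List.head?_eq_getElem?, List.getElem?_drop, List.getElem?_eq_getElem (by omega)]
  rfl

end Tuples

section Cochains

variable {X : TopCat.{u}} {R : (Opens X)ᵒᵖ ⥤ RingCat.{u}} {ι : Type u} {U : ι → Opens X}

theorem le_of_head {l : List ι} {x : ι} (hx : l.head? = some x) {W : Opens X}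
    (hW : W ≤ inter U l) : W ≤ U x :=
  hW.trans (inter_le (List.mem_of_head? hx))

theorem le_of_getLast {l : List ι} {x : ι} (hx : l.getLast? = some x) {W : Opens X}
    (hW : W ≤ inter U l) : W ≤ U x :=
  hW.trans (inter_le (List.mem_of_getLast? hx))

/-- The group `∏_{p+q=d} C^p(U, Mor^q(E, F))`: a cochain `u` of total degree `d` has components
`u^{p,q}_{i₀…i_p}`, which are maps from `E_{i_p}` to `F_{i₀}` of degree `q` over `U_{i₀…i_p}`. -/
def Cochain (E F : ∀ i, Cpx R (U i)) (d : ℤ) : Type u :=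
  ∀ s : HomIndex ι d,
    Res R (inter_le (U := U) s.src_mem) ((E s.src).X s.n) →ₗ[R.obj (op (inter U s.l))]
      Res R (inter_le (U := U) s.tgt_mem) ((F s.tgt).X s.m)

namespace Cochain

variable {E F G : ∀ i, Cpx R (U i)} {d e f : ℤ}

instance : AddCommGroup (Cochain E F d) := Pi.addCommGroup

@[ext]
theorem ext {u v : Cochain E F d} (h : ∀ s, u s = v s) : u = v := funext h

/-- The restriction to `W ≤ U_l` of the component with index `l` of a cochain. -/
def ev (u : Cochain E F d) {p : ℕ} {l : List ι} {x y : ι} {n m : ℤ} (hl : l.length = p + 1)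
    (hx : l.getLast? = some x) (hy : l.head? = some y) (hd : n + d = m + p)
    {W : Opens X} (hW : W ≤ inter U l) :
    Res R (le_of_getLast hx hW) ((E x).X n) →ₗ[R.obj (op W)] Res R (le_of_head hy hW) ((F y).X m) :=
  Res.moveHom R hW (u ⟨p, l, x, y, n, m, hl, hx, hy, hd⟩)

/-- The Čech differential
`(δu)_{i₀…i_p} = ∑_{0<k<p} (-1)^k u_{i₀…î_k…i_p}|_{U_{i₀…i_p}}`. -/
def cech (h : d + 1 = e) (u : Cochain E F d) : Cochain E F e := fun s =>
  ∑ k : Fin (s.p - 1), (-1 : ℤ) ^ (k.1 + 1) •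
    u.ev (n := s.n) (m := s.m) (length_face s.len (by omega)) (getLast_face s.len k.2 s.hsrc)
      (head_face s.htgt) (by have := s.deg; have := k.2; omega) (inter_mono (List.eraseIdx_subset (l := s.l) (k := k.1 + 1)))

/-- The product
`(u·v)_{i₀…i_p} = ∑_{0≤k≤p} (-1)^{(d-k)(p-k)} u^{k,d-k}_{i₀…i_k} ∘ v^{p-k,e-(p-k)}_{i_k…i_p}`. -/
def comp (h : d + e = f) (u : Cochain F G d) (v : Cochain E F e) : Cochain E G f := fun s =>
  ∑ k : Fin (s.p + 1), (Int.negOnePow ((d - k.1) * (s.p - k.1 : ℕ)) : ℤ) •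
    (u.ev (n := s.n + e - (s.p - k.1 : ℕ)) (length_front s.len k.2)
        (getLast_front (by have := s.len; omega)) (head_front s.htgt)
        (by have := s.deg; omega) (inter_mono (List.take_subset (k.1 + 1) s.l))).comp
      (v.ev (length_back s.len k.2)
        (getLast_back (by have := s.len; omega) s.hsrc) (head_back (by have := s.len; omega))
        (by omega) (inter_mono (List.drop_subset k.1 s.l)))

/-- The map `E_i^n|_V → E_j^m|_V` which is the identity, when `i = j` and `n = m`. -/
def castRes (E : ∀ i, Cpx R (U i)) {V : Opens X} {i j : ι} (hij : i = j) {n m : ℤ} (hnm : n = m)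
    (hi : V ≤ U i) (hj : V ≤ U j) :
    Res R hi ((E i).X n) →ₗ[R.obj (op V)] Res R hj ((E j).X m) := by
  subst hij hnm
  exact LinearMap.id

/-- The identity, which is concentrated in bidegree `(0, 0)`. -/
def one (E : ∀ i, Cpx R (U i)) : Cochain E E 0 := fun s =>
  if h : s.p = 0 then
    castRes E (s.src_eq_tgt h) (by have := s.deg; omega) _ _
  else 0

end Cochain

/-! ### Twisted complexes -/

/-- The index of the component `a^{0,1}_i : E^n_i → E^{n+1}_i`. -/
def vertexIndex (i : ι) (n m : ℤ) (h : n + 1 = m) : HomIndex ι 1 where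
  p := 0
  l := [i]
  src := i
  tgt := i
  n := n
  m := m
  len := rfl
  hsrc := rfl
  htgt := rfl
  deg := by simpa using h

/-- The index of the component `a^{1,0}_{ii} : E^n_i → E^n_i`. -/
def loopIndex (i : ι) (n : ℤ) : HomIndex ι 1 where
  p := 1
  l := [i, i]
  src := i
  tgt := i
  n := n
  m := n
  len := rfl
  hsrc := rfl
  htgt := rfl
  deg := by simp

variable (R U) in
/-- A twisted complex of `R`-modules with respect to the family of open sets `U`: complexes `E_i`
of `R(U_i)`-modules and `a = ∑_k a^{k,1-k}` with `δa + a·a = 0`, such that `a^{0,1}_i` is the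
differential of `E_i` and `a^{1,0}_{ii}` is invertible up to homotopy. -/
structure TwistedComplex where
  obj : ∀ i, Cpx R (U i)
  a : Cochain obj obj 1
  a_zero : ∀ (i : ι) (n m : ℤ) (h : n + 1 = m),
    a (vertexIndex i n m h) = Res.map R _ ((obj i).d n m).hom
  maurerCartan : a.cech (e := 2) rfl + Cochain.comp (f := 2) rfl a a = 0
  a_one : ∀ i, ∃ w : HomotopyEquiv
      (resCpx (V := inter U [i, i]) (inter_le List.mem_cons_self) (obj i))
      (resCpx (V := inter U [i, i]) (inter_le List.mem_cons_self) (obj i)),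
    ∀ n, (w.hom.f n).hom = a (loopIndex i n)

namespace TwistedComplex

variable {E F G : TwistedComplex R U}

/-- Morphisms of degree `d` of twisted complexes. -/
abbrev Hom (E F : TwistedComplex R U) (d : ℤ) := Cochain E.obj F.obj d

/-- The differential `dφ = δφ + b·φ - (-1)^{|φ|} φ·a`. -/
def diff {d e : ℤ} (h : d + 1 = e) (φ : Hom E F d) : Hom E F e :=
  φ.cech h + Cochain.comp (by omega) F.a φ - (Int.negOnePow d : ℤ) • Cochain.comp h φ E.a

/-- A closed morphism of degree zero which has an inverse up to homotopy. -/
def IsHomotopyEquivalence (φ : Hom E F 0) : Prop :=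
  diff (e := 1) rfl φ = 0 ∧
    ∃ ψ : Hom F E 0, diff (e := 1) rfl ψ = 0 ∧
      (∃ η : Hom E E (-1), diff (e := 0) rfl η = Cochain.comp (f := 0) rfl ψ φ - Cochain.one E.obj) ∧
      ∃ θ : Hom F F (-1), diff (e := 0) rfl θ = Cochain.comp (f := 0) rfl φ ψ - Cochain.one F.obj

end TwistedComplex

end Cochains

section Sums

variable {M : Type*} [AddCommGroup M]

theorem sum_fin_eq (p : ℕ) (f : ∀ k, k < p → M) (g : ℕ → M) (h : ∀ k hk, g k = f k hk) :
    ∑ k : Fin p, f k.1 k.2 = ∑ k ∈ Finset.range p, g k := by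
  rw [← Fin.sum_univ_eq_sum_range]
  exact Finset.sum_congr rfl fun k _ => (h k.1 k.2).symm

theorem sum_front_back (p : ℕ) (f : ∀ k j, k < p + 1 → j < p - k + 1 → M) :
    ∑ k : Fin (p + 1), ∑ j : Fin (p - k.1 + 1), f k.1 j.1 k.2 j.2 =
      ∑ i : Fin (p + 1), ∑ k : Fin (i.1 + 1), f k.1 (i.1 - k.1) (by omega) (by omega) := by
  let g : ℕ → ℕ → M := fun k j =>
    if h : k < p + 1 ∧ j < p - k + 1 then f k j h.1 h.2 else 0
  have hg : ∀ k j h1 h2, g k j = f k j h1 h2 := fun k j h1 h2 => dif_pos ⟨h1, h2⟩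
  rw [sum_fin_eq (p + 1) (fun k hk => ∑ j : Fin (p - k + 1), f k j.1 hk j.2)
      (fun k => ∑ j ∈ Finset.range (p - k + 1), g k j)
      (fun k hk => (sum_fin_eq _ (fun j hj => f k j hk hj) (g k) fun j hj => hg k j hk hj).symm),
    sum_fin_eq (p + 1) (fun i hi => ∑ k : Fin (i + 1), f k.1 (i - k.1) (by omega) (by omega))
      (fun i => ∑ k ∈ Finset.range (i + 1), g k (i - k))
      (fun i hi => (sum_fin_eq _ (fun k hk => f k (i - k) (by omega) (by omega))
        (fun k => g k (i - k)) fun k hk => hg k (i - k) (by omega) (by omega)).symm),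
    Finset.sum_sigma', Finset.sum_sigma']
  refine Finset.sum_bij' (fun x _ => ⟨x.1 + x.2, x.1⟩) (fun x _ => ⟨x.2, x.1 - x.2⟩) ?_ ?_ ?_ ?_ ?_
  all_goals
    rintro ⟨a, b⟩ hab
    simp only [Finset.mem_sigma, Finset.mem_range] at hab ⊢
  · omega
  · omega
  · simp
  · simp; omega
  · simp

theorem sum_leibniz (p : ℕ) (f : ∀ a k, a < p → k < p → M) :
    ∑ a : Fin p, ∑ k : Fin (p - 1 + 1), f a.1 k.1 a.2 (by have := a.2; omega) =
      ∑ i : Fin (p + 1), ∑ t : Fin (i.1 - 1), f t.1 (i.1 - 1) (by have := t.2; have := i.2; omega)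
        (by have := t.2; have := i.2; omega) +
      ∑ k : Fin (p + 1), ∑ t : Fin (p - k.1), f (k.1 + t.1) k.1 (by have := t.2; omega)
        (by have := t.2; omega) := by
  let g : ℕ → ℕ → M := fun a k => if h : a < p ∧ k < p then f a k h.1 h.2 else 0
  have hg : ∀ k j h1 h2, g k j = f k j h1 h2 := fun k j h1 h2 => dif_pos ⟨h1, h2⟩
  rw [sum_fin_eq p (fun a ha => ∑ k : Fin (p - 1 + 1), f a k.1 ha (by omega))
      (fun a => ∑ k ∈ Finset.range p, g a k)
      (fun a ha => by
        have e : p - 1 + 1 = p := by omega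
        rw [sum_fin_eq (p - 1 + 1) (fun k hk => f a k ha (by omega)) (g a)
          fun k hk => hg a k ha (by omega), e]),
    sum_fin_eq (p + 1) (fun i hi => ∑ t : Fin (i - 1), f t.1 (i - 1) (by have := t.2; omega)
        (by have := t.2; omega))
      (fun i => ∑ t ∈ Finset.range (i - 1), g t (i - 1))
      (fun i hi => (sum_fin_eq _ (fun t ht => f t (i - 1) (by omega) (by omega))
        (fun t => g t (i - 1)) fun k hk => hg k (i - 1) (by omega) (by omega)).symm),
    sum_fin_eq (p + 1) (fun k hk => ∑ t : Fin (p - k), f (k + t.1) k (by have := t.2; omega)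
        (by have := t.2; omega))
      (fun k => ∑ t ∈ Finset.range (p - k), g (k + t) k)
      (fun k hk => (sum_fin_eq _ (fun t ht => f (k + t) k (by omega) (by omega))
        (fun t => g (k + t) k) fun t ht => hg (k + t) k (by omega) (by omega)).symm),
    Finset.sum_sigma', Finset.sum_sigma', Finset.sum_sigma',
    ← Finset.sum_filter_add_sum_filter_not _ (fun x : (_ : ℕ) × ℕ => x.1 < x.2)]
  congr 1
  · refine Finset.sum_bij' (fun x _ => ⟨x.2 + 1, x.1⟩) (fun x _ => ⟨x.2, x.1 - 1⟩) ?_ ?_ ?_ ?_ ?_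
    all_goals
      rintro ⟨a, b⟩ hab
      simp only [Finset.mem_filter, Finset.mem_sigma, Finset.mem_range] at hab ⊢
    · omega
    · omega
    · simp
    · simp; omega
    · simp
  · refine Finset.sum_bij' (fun x _ => ⟨x.2, x.1 - x.2⟩) (fun x _ => ⟨x.1 + x.2, x.1⟩) ?_ ?_ ?_ ?_ ?_
    all_goals
      rintro ⟨a, b⟩ hab
      simp only [Finset.mem_filter, Finset.mem_sigma, Finset.mem_range] at hab ⊢
    · omega
    · omega
    · simp; omega
    · simp
    · congr 1; omega

theorem sum_cancel (p : ℕ) (f : ∀ a b, a < p → b < p - 1 → M)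
    (hf : ∀ a b (ha : a < p) (hb : b < a),
      f a b ha (by omega) + f b (a - 1) (by omega) (by omega) = 0) :
    ∑ a : Fin p, ∑ b : Fin (p - 1), f a.1 b.1 a.2 b.2 = 0 := by
  let g : ℕ → ℕ → M := fun a b => if h : a < p ∧ b < p - 1 then f a b h.1 h.2 else 0
  have hg : ∀ k j h1 h2, g k j = f k j h1 h2 := fun k j h1 h2 => dif_pos ⟨h1, h2⟩
  rw [sum_fin_eq p (fun a ha => ∑ b : Fin (p - 1), f a b.1 ha b.2)
      (fun a => ∑ b ∈ Finset.range (p - 1), g a b)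
      (fun a ha => (sum_fin_eq _ (fun b hb => f a b ha hb) (g a) fun b hb => hg a b ha hb).symm),
    Finset.sum_sigma',
    ← Finset.sum_filter_add_sum_filter_not _ (fun x : (_ : ℕ) × ℕ => x.2 < x.1)]
  have : ∑ x ∈ Finset.filter (fun x : (_ : ℕ) × ℕ => ¬ x.2 < x.1)
        ((Finset.range p).sigma fun _ => Finset.range (p - 1)), g x.1 x.2 =
      ∑ x ∈ Finset.filter (fun x : (_ : ℕ) × ℕ => x.2 < x.1)
        ((Finset.range p).sigma fun _ => Finset.range (p - 1)), g x.2 (x.1 - 1) := by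
    refine Finset.sum_bij' (fun x _ => ⟨x.2 + 1, x.1⟩) (fun x _ => ⟨x.2, x.1 - 1⟩) ?_ ?_ ?_ ?_ ?_
    all_goals
      rintro ⟨a, b⟩ hab
      simp only [Finset.mem_filter, Finset.mem_sigma, Finset.mem_range] at hab ⊢
    · omega
    · omega
    · simp
    · simp; omega
    · simp
  rw [this, ← Finset.sum_add_distrib]
  refine Finset.sum_eq_zero ?_
  rintro ⟨a, b⟩ hab
  simp only [Finset.mem_filter, Finset.mem_sigma, Finset.mem_range] at hab
  rw [hg a b (by omega) (by omega), hg b (a - 1) (by omega) (by omega)]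
  exact hf a b (by omega) hab.2

end Sums

/-! ### The sheafification of a twisted complex -/

/-- An index of a component `c^{p,m}_{i₀…i_p} ∈ E^m_{i₀}|_{U_{i₀…i_p}}`, where `p + m = n`. It is
determined by `i₀ … i_p`; as above, `x = i₀` and `m = n - p` are fields with equations. -/
structure SecIndex (ι : Type u) (n : ℤ) where
  p : ℕ
  l : List ι
  x : ι
  m : ℤ
  len : l.length = p + 1
  hx : l.head? = some x
  deg : m + p = n

namespace SecIndex

variable {ι : Type u} {n n' d : ℤ}

theorem mem (s : SecIndex ι n) : s.x ∈ s.l := List.mem_of_head? s.hx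

end SecIndex

section Sheafification

variable {X : TopCat.{u}} {R : (Opens X)ᵒᵖ ⥤ RingCat.{u}} {ι : Type u} {U : ι → Opens X}

/-- The module `∏_{p+q=n} ∏_{i₀…i_p} E^q_{i₀}|_{U_{i₀…i_p}}`. -/
def Sec (E : ∀ i, Cpx R (U i)) (n : ℤ) : Type u :=
  ∀ s : SecIndex ι n, Res R (inter_le (U := U) s.mem) ((E s.x).X s.m)

namespace Sec

variable {E F G : ∀ i, Cpx R (U i)} {n n' n'' d e f : ℤ}

instance : AddCommGroup (Sec E n) := Pi.addCommGroup

/-- `R(X)` acts on each factor through the restriction homomorphism `R(X) → R(U_{i₀…i_p})`. -/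
instance : SMul (R.obj (op ⊤)) (Sec E n) :=
  ⟨fun r c s => rho R (le_top : inter U s.l ≤ ⊤) r • c s⟩

@[simp]
theorem smul_apply (r : R.obj (op ⊤)) (c : Sec E n) (s : SecIndex ι n) :
    (r • c) s = rho R (le_top : inter U s.l ≤ ⊤) r • c s := rfl

@[simp]
theorem add_apply (c c' : Sec E n) (s : SecIndex ι n) : (c + c') s = c s + c' s := rfl

@[simp]
theorem zero_apply (s : SecIndex ι n) : (0 : Sec E n) s = 0 := rfl

instance : Module (R.obj (op ⊤)) (Sec E n) where
  one_smul c := by funext s; simp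
  mul_smul r r' c := by funext s; simp [mul_smul]
  smul_zero r := by funext s; simp
  smul_add r c c' := by funext s; simp
  add_smul r r' c := by funext s; simp [add_smul]
  zero_smul c := by funext s; simp

@[ext]
theorem ext {c c' : Sec E n} (h : ∀ s, c s = c' s) : c = c' := funext h

@[simp]
theorem sum_apply {α : Type*} (t : Finset α) (c : α → Sec E n) (s : SecIndex ι n) :
    (∑ i ∈ t, c i) s = ∑ i ∈ t, c i s := Finset.sum_apply _ _ _

/-- The restriction to `W ≤ U_l` of the component with index `l`. -/
def ev (c : Sec E n) {p : ℕ} {l : List ι} {x : ι} {m : ℤ} (hl : l.length = p + 1)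
    (hx : l.head? = some x) (hd : m + p = n) {W : Opens X} (hW : W ≤ inter U l) :
    Res R (le_of_head hx hW) ((E x).X m) :=
  Res.move R (inter_le (List.mem_of_head? hx)) hW (c ⟨p, l, x, m, hl, hx, hd⟩)

theorem ev_add (c c' : Sec E n) {p : ℕ} {l : List ι} {x : ι} {m : ℤ} (hl : l.length = p + 1)
    (hx : l.head? = some x) (hd : m + p = n) {W : Opens X} (hW : W ≤ inter U l) :
    (c + c').ev hl hx hd hW = c.ev hl hx hd hW + c'.ev hl hx hd hW := by
  simp [ev]

theorem ev_smul (r : R.obj (op ⊤)) (c : Sec E n) {p : ℕ} {l : List ι} {x : ι} {m : ℤ}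
    (hl : l.length = p + 1)
    (hx : l.head? = some x) (hd : m + p = n) {W : Opens X} (hW : W ≤ inter U l) :
    (r • c).ev hl hx hd hW = rho R (le_top : W ≤ ⊤) r • c.ev hl hx hd hW := by
  simp [ev, LinearMap.map_smulₛₗ]

theorem ev_sum {α : Type*} (t : Finset α) (g : α → Sec E n) {p : ℕ} {l : List ι} {x : ι} {m : ℤ}
    (hl : l.length = p + 1)
    (hx : l.head? = some x) (hd : m + p = n) {W : Opens X} (hW : W ≤ inter U l) :
    (∑ i ∈ t, g i).ev hl hx hd hW = ∑ i ∈ t, (g i).ev hl hx hd hW := by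
  simp [ev]

/-- The Čech differential
`(δc)_{i₀…i_p} = ∑_{0<k≤p} (-1)^k c_{i₀…î_k…i_p}|_{U_{i₀…i_p}}`. -/
def cech (h : n + 1 = n') (c : Sec E n) : Sec E n' := fun s =>
  ∑ k : Fin s.p, (-1 : ℤ) ^ (k.1 + 1) •
    c.ev (m := s.m) (length_face s.len k.2) (head_face s.hx)
      (by have := s.deg; have := k.2; omega)
      (inter_mono (List.eraseIdx_subset (l := s.l) (k := k.1 + 1)))

/-- The action
`(u·c)_{i₀…i_p} = ∑_{0≤k≤p} (-1)^{(d-k)(p-k)} u^{k,d-k}_{i₀…i_k} (c_{i_k…i_p})`. -/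
def act (h : n + d = n') (u : Cochain E F d) (c : Sec E n) : Sec F n' := fun s =>
  ∑ k : Fin (s.p + 1), (Int.negOnePow ((d - k.1) * (s.p - k.1 : ℕ)) : ℤ) •
    u.ev (n := n - (s.p - k.1 : ℕ)) (length_front s.len k.2)
      (getLast_front (by have := s.len; omega)) (head_front s.hx)
      (by have := s.deg; omega) (inter_mono (List.take_subset (k.1 + 1) s.l))
      (c.ev (length_back s.len k.2) (head_back (by have := s.len; omega)) (by omega)
        (inter_mono (List.drop_subset k.1 s.l)))

theorem cech_add (h : n + 1 = n') (c c' : Sec E n) : cech h (c + c') = cech h c + cech h c' := by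
  ext s
  rw [add_apply]
  simp only [cech, ev_add, smul_add, Finset.sum_add_distrib]

theorem cech_smul (h : n + 1 = n') (r : R.obj (op ⊤)) (c : Sec E n) :
    cech h (r • c) = r • cech h c := by
  ext s
  simp only [smul_apply, cech, Finset.smul_sum, ev_smul]
  exact Finset.sum_congr rfl fun k _ => smul_comm _ _ _

theorem act_add (h : n + d = n') (u : Cochain E F d) (c c' : Sec E n) :
    act h u (c + c') = act h u c + act h u c' := by
  ext s
  rw [add_apply]
  simp only [act, ev_add, map_add, smul_add, Finset.sum_add_distrib]

theorem act_smul (h : n + d = n') (u : Cochain E F d) (r : R.obj (op ⊤)) (c : Sec E n) :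
    act h u (r • c) = r • act h u c := by
  ext s
  simp only [smul_apply, act, Finset.smul_sum, ev_smul, map_smul]
  exact Finset.sum_congr rfl fun k _ => smul_comm _ _ _

theorem ev_congr (c : Sec E n) {p p' : ℕ} {l l' : List ι} {x : ι} {m : ℤ}
    (hl : l.length = p + 1) (hx : l.head? = some x) (hd : m + p = n)
    (hl' : l'.length = p' + 1) (hx' : l'.head? = some x) (hd' : m + p' = n)
    {W : Opens X} (hW : W ≤ inter U l) (hW' : W ≤ inter U l') (e : l = l') :
    c.ev hl hx hd hW = c.ev hl' hx' hd' hW' := by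
  subst e
  obtain rfl : p = p' := by omega
  rfl

theorem ev_ev_congr (u : Cochain E F d) (c : Sec E n) {p q p' q' : ℕ} {l₁ l₂ l₁' l₂' : List ι}
    {y z z' : ι} {m μ μ' : ℤ}
    (h1 : l₁.length = p + 1) (h2 : l₁.getLast? = some z) (h3 : l₁.head? = some y)
    (h4 : μ + d = m + p) (h5 : l₂.length = q + 1) (h6 : l₂.head? = some z) (h7 : μ + q = n)
    (h1' : l₁'.length = p' + 1) (h2' : l₁'.getLast? = some z') (h3' : l₁'.head? = some y)
    (h4' : μ' + d = m + p') (h5' : l₂'.length = q' + 1) (h6' : l₂'.head? = some z')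
    (h7' : μ' + q' = n) {W : Opens X} (hW₁ : W ≤ inter U l₁) (hW₂ : W ≤ inter U l₂)
    (hW₁' : W ≤ inter U l₁') (hW₂' : W ≤ inter U l₂') (e₁ : l₁ = l₁') (e₂ : l₂ = l₂') :
    u.ev h1 h2 h3 h4 hW₁ (c.ev h5 h6 h7 hW₂) =
      u.ev h1' h2' h3' h4' hW₁' (c.ev h5' h6' h7' hW₂') := by
  subst e₁ e₂
  obtain rfl : p = p' := by omega
  obtain rfl : q = q' := by omega
  obtain rfl : μ = μ' := by omega
  obtain rfl : z = z' := Option.some.inj (h2.symm.trans h2')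
  rfl

theorem ev_ev_ev_congr (u : Cochain F G d) (v : Cochain E F e) (c : Sec E n)
    {p q r p' q' r' : ℕ} {l₁ l₂ l₃ l₁' l₂' l₃' : List ι}
    {y z z' w w' : ι} {m μ μ' ν ν' : ℤ}
    (h1 : l₁.length = p + 1) (h2 : l₁.getLast? = some z) (h3 : l₁.head? = some y)
    (h4 : μ + d = m + p)
    (g1 : l₂.length = q + 1) (g2 : l₂.getLast? = some w) (g3 : l₂.head? = some z)
    (g4 : ν + e = μ + q) (h5 : l₃.length = r + 1) (h6 : l₃.head? = some w) (h7 : ν + r = n)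
    (h1' : l₁'.length = p' + 1) (h2' : l₁'.getLast? = some z') (h3' : l₁'.head? = some y)
    (h4' : μ' + d = m + p')
    (g1' : l₂'.length = q' + 1) (g2' : l₂'.getLast? = some w') (g3' : l₂'.head? = some z')
    (g4' : ν' + e = μ' + q') (h5' : l₃'.length = r' + 1) (h6' : l₃'.head? = some w')
    (h7' : ν' + r' = n) {W : Opens X} (hW₁ : W ≤ inter U l₁) (hW₂ : W ≤ inter U l₂)
    (hW₃ : W ≤ inter U l₃) (hW₁' : W ≤ inter U l₁') (hW₂' : W ≤ inter U l₂')
    (hW₃' : W ≤ inter U l₃') (e₁ : l₁ = l₁') (e₂ : l₂ = l₂') (e₃ : l₃ = l₃') :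
    u.ev h1 h2 h3 h4 hW₁ (v.ev g1 g2 g3 g4 hW₂ (c.ev h5 h6 h7 hW₃)) =
      u.ev h1' h2' h3' h4' hW₁' (v.ev g1' g2' g3' g4' hW₂' (c.ev h5' h6' h7' hW₃')) := by
  subst e₁ e₂ e₃
  obtain rfl : p = p' := by omega
  obtain rfl : q = q' := by omega
  obtain rfl : r = r' := by omega
  obtain rfl : μ = μ' := by omega
  obtain rfl : ν = ν' := by omega
  obtain rfl : z = z' := Option.some.inj (h2.symm.trans h2')
  obtain rfl : w = w' := Option.some.inj (g2.symm.trans g2')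
  rfl

theorem ev_cech (h : n + 1 = n') (c : Sec E n) {p : ℕ} {l : List ι} {x : ι} {m : ℤ}
    (hl : l.length = p + 1) (hx : l.head? = some x) (hd : m + p = n') {W : Opens X}
    (hW : W ≤ inter U l) :
    (cech h c).ev hl hx hd hW = ∑ k : Fin p, (-1 : ℤ) ^ (k.1 + 1) •
      c.ev (m := m) (length_face hl k.2) (head_face hx) (by have := k.2; omega)
        (hW.trans (inter_mono (List.eraseIdx_subset (l := l) (k := k.1 + 1)))) := by
  simp only [ev, cech, map_sum, map_zsmul, Res.move_move]

theorem ev_act (h : n + d = n') (u : Cochain E F d) (c : Sec E n) {p : ℕ} {l : List ι} {x : ι}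
    {m : ℤ} (hl : l.length = p + 1) (hx : l.head? = some x) (hd : m + p = n') {W : Opens X}
    (hW : W ≤ inter U l) :
    (act h u c).ev hl hx hd hW =
      ∑ k : Fin (p + 1), (Int.negOnePow ((d - k.1) * (p - k.1 : ℕ)) : ℤ) •
        u.ev (n := n - (p - k.1 : ℕ)) (length_front hl k.2)
          (getLast_front (by omega)) (head_front hx) (by omega)
          (hW.trans (inter_mono (List.take_subset (k.1 + 1) l)))
          (c.ev (length_back hl k.2) (head_back (by omega)) (by omega)
            (hW.trans (inter_mono (List.drop_subset k.1 l)))) := by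
  simp only [ev, Cochain.ev, act, map_sum, map_zsmul, ← Res.moveHom_move, Res.moveHom_moveHom,
    Res.move_move]

theorem _root_.TwistedDescent.Cochain.ev_cech (h : d + 1 = e) (u : Cochain E F d) {p : ℕ}
    {l : List ι} {x y : ι} {n m : ℤ} (hl : l.length = p + 1)
    (hx : l.getLast? = some x) (hy : l.head? = some y) (hd : n + e = m + p)
    {W : Opens X} (hW : W ≤ inter U l) :
    (u.cech h).ev hl hx hy hd hW = ∑ k : Fin (p - 1), (-1 : ℤ) ^ (k.1 + 1) •
      u.ev (n := n) (m := m) (length_face hl (by omega)) (getLast_face hl k.2 hx)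
        (head_face hy) (by have := k.2; omega)
        (hW.trans (inter_mono (List.eraseIdx_subset (l := l) (k := k.1 + 1)))) := by
  change Res.moveHomAdd R _ _ _ _ hW _ = _
  simp only [Cochain.cech, map_sum, map_zsmul]
  exact Finset.sum_congr rfl fun k _ => congr_arg _ (Res.moveHom_moveHom R _ hW _)

theorem _root_.TwistedDescent.Cochain.ev_comp (h : d + e = f) (u : Cochain F G d)
    (v : Cochain E F e) {p : ℕ}
    {l : List ι} {x y : ι} {n m : ℤ} (hl : l.length = p + 1)
    (hx : l.getLast? = some x) (hy : l.head? = some y) (hd : n + f = m + p)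
    {W : Opens X} (hW : W ≤ inter U l) :
    (Cochain.comp h u v).ev hl hx hy hd hW =
    ∑ k : Fin (p + 1), (Int.negOnePow ((d - k.1) * (p - k.1 : ℕ)) : ℤ) •
    (u.ev (n := n + e - (p - k.1 : ℕ)) (length_front hl k.2)
        (getLast_front (by omega)) (head_front hy)
        (by omega) (hW.trans (inter_mono (List.take_subset (k.1 + 1) l)))).comp
      (v.ev (length_back hl k.2)
        (getLast_back (by omega) hx) (head_back (by omega))
        (by omega) (hW.trans (inter_mono (List.drop_subset k.1 l)))) := by
  change Res.moveHomAdd R _ _ _ _ hW _ = _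
  simp only [Cochain.comp, map_sum, map_zsmul]
  refine Finset.sum_congr rfl fun k _ => congr_arg _ ?_
  refine (Res.moveHom_comp R hW _ _).trans ?_
  simp only [Cochain.ev, Res.moveHom_moveHom]

theorem _root_.TwistedDescent.Cochain.ev_comp_apply (h : d + e = f) (u : Cochain F G d)
    (v : Cochain E F e) {p : ℕ}
    {l : List ι} {x y : ι} {n m : ℤ} (hl : l.length = p + 1)
    (hx : l.getLast? = some x) (hy : l.head? = some y) (hd : n + f = m + p)
    {W : Opens X} (hW : W ≤ inter U l) (z : Res R (le_of_getLast hx hW) ((E x).X n)) :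
    (Cochain.comp h u v).ev hl hx hy hd hW z =
    ∑ k : Fin (p + 1), (Int.negOnePow ((d - k.1) * (p - k.1 : ℕ)) : ℤ) •
    (u.ev (n := n + e - (p - k.1 : ℕ)) (length_front hl k.2)
        (getLast_front (by omega)) (head_front hy)
        (by omega) (hW.trans (inter_mono (List.take_subset (k.1 + 1) l))))
      (v.ev (length_back hl k.2)
        (getLast_back (by omega) hx) (head_back (by omega))
        (by omega) (hW.trans (inter_mono (List.drop_subset k.1 l))) z) := by
  rw [Cochain.ev_comp]
  exact LinearMap.sum_apply _ _ _

theorem _root_.TwistedDescent.Cochain.ev_cech_apply (h : d + 1 = e) (u : Cochain E F d) {p : ℕ}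
    {l : List ι} {x y : ι} {n m : ℤ} (hl : l.length = p + 1)
    (hx : l.getLast? = some x) (hy : l.head? = some y) (hd : n + e = m + p)
    {W : Opens X} (hW : W ≤ inter U l) (z : Res R (le_of_getLast hx hW) ((E x).X n)) :
    (u.cech h).ev hl hx hy hd hW z = ∑ k : Fin (p - 1), (-1 : ℤ) ^ (k.1 + 1) •
      u.ev (n := n) (m := m) (length_face hl (by omega)) (getLast_face hl k.2 hx)
        (head_face hy) (by have := k.2; omega)
        (hW.trans (inter_mono (List.eraseIdx_subset (l := l) (k := k.1 + 1)))) z := by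
  rw [Cochain.ev_cech]
  exact LinearMap.sum_apply _ _ _

theorem act_act (h : n + e = n') (h' : n' + d = n'') (hf : d + e = f) (u : Cochain F G d)
    (v : Cochain E F e) (c : Sec E n) :
    act h' u (act h v c) = act (by omega) (Cochain.comp hf u v) c := by
  ext s
  obtain ⟨p, l, x, m, hl, hx, hd⟩ := s
  simp only [act]
  simp only [ev_act, Cochain.ev_comp_apply, map_sum, map_zsmul, Finset.smul_sum, smul_smul]
  refine (sum_front_back (M := Res R (le_of_head (U := U) hx le_rfl) ((G x).X m)) p (fun k j hk hj =>
    ((Int.negOnePow ((d - k) * (p - k : ℕ)) : ℤ) *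
      (Int.negOnePow ((e - j) * (p - k - j : ℕ)) : ℤ)) •
    u.ev (n := n' - (p - k : ℕ)) (m := m) (length_front hl hk)
      (getLast_front (by omega)) (head_front hx) (by omega)
      (inter_mono (List.take_subset (k + 1) l))
      (v.ev (n := n - (p - k - j : ℕ)) (length_front (length_back hl hk) hj)
        (getLast_front (by rw [length_back hl hk]; exact hj))
        (head_front (head_back (by omega))) (by omega)
        ((inter_mono (List.drop_subset k l)).trans (inter_mono (List.take_subset (j + 1) _)))
        (c.ev (length_back (length_back hl hk) hj)
          (head_back (by rw [length_back hl hk]; exact hj)) (by omega)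
          ((inter_mono (List.drop_subset k l)).trans (inter_mono (List.drop_subset j _))))))).trans ?_
  refine Finset.sum_congr rfl fun i _ => Finset.sum_congr rfl fun k _ => ?_
  congr 1
  · rw [← Units.val_mul, ← Units.val_mul, ← Int.negOnePow_add, ← Int.negOnePow_add]
    congr 2
    have := i.2
    have := k.2
    rw [← hf]
    push_cast [Nat.cast_sub (show k.1 ≤ p by omega), Nat.cast_sub (show k.1 ≤ i.1 by omega),
      Nat.cast_sub (show i.1 ≤ p by omega), show p - k.1 - (i.1 - k.1) = p - i.1 by omega]
    ring
  · apply ev_ev_ev_congr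
    · rw [List.take_take]; congr 1; omega
    · rw [List.drop_take]; congr 1; omega
    · rw [List.drop_drop]; congr 1; omega

theorem cech_cech (h : n + 1 = n') (h' : n' + 1 = n'') (c : Sec E n) :
    cech h' (cech h c) = 0 := by
  ext s
  obtain ⟨p, l, x, m, hl, hx, hd⟩ := s
  rw [zero_apply]
  simp only [cech]
  simp only [ev_cech, Finset.smul_sum, smul_smul]
  refine sum_cancel (M := Res R (le_of_head (U := U) hx le_rfl) ((E x).X m)) p (fun a b ha hb => ((-1 : ℤ) ^ (a + 1) * (-1) ^ (b + 1)) •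
    c.ev (m := m) (length_face (length_face hl ha) hb) (head_face (head_face hx)) (by omega)
      ((inter_mono (List.eraseIdx_subset (l := l) (k := a + 1))).trans
        (inter_mono (List.eraseIdx_subset (k := b + 1))))) ?_
  intro a b ha hb
  have : (-1 : ℤ) ^ (b + 1) * (-1) ^ (a - 1 + 1) = - ((-1 : ℤ) ^ (a + 1) * (-1) ^ (b + 1)) := by
    rw [show a - 1 + 1 = a by omega, pow_succ _ a]
    ring
  rw [this, neg_smul, add_neg_eq_zero]
  congr 1
  apply ev_congr
  apply List.ext_getElem?
  intro i
  simp only [List.getElem?_eraseIdx]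
  split_ifs <;> first | rfl | omega

theorem cech_act (h : n + d = n') (h1 : n' + 1 = n'') (hn : n + 1 = f) (hd : d + 1 = e)
    (u : Cochain E F d) (c : Sec E n) :
    cech h1 (act h u c) = act (by omega) (u.cech hd) c +
      (Int.negOnePow d : ℤ) • act (by omega) u (cech hn c) := by
  ext s
  obtain ⟨p, l, x, m, hl, hx, hdeg⟩ := s
  rw [add_apply]
  change _ = _ + (Int.negOnePow d : ℤ) • (act (by omega) u (cech hn c)) _
  simp only [cech, act]
  simp only [ev_act, ev_cech, Cochain.ev_cech_apply, map_sum, map_zsmul, Finset.smul_sum,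
    smul_smul]
  refine (sum_leibniz (M := Res R (le_of_head (U := U) hx le_rfl) ((F x).X m)) p (fun a k ha hk =>
    ((-1 : ℤ) ^ (a + 1) * (Int.negOnePow ((d - k) * (p - 1 - k : ℕ)) : ℤ)) •
    u.ev (n := n - (p - 1 - k : ℕ)) (m := m) (length_front (length_face hl ha) (by omega))
      (getLast_front (by rw [length_face hl ha]; omega)) (head_front (head_face hx)) (by omega)
      ((inter_mono (List.eraseIdx_subset (l := l) (k := a + 1))).trans
        (inter_mono (List.take_subset (k + 1) _)))
      (c.ev (length_back (length_face hl ha) (by omega))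
        (head_back (by rw [length_face hl ha]; omega)) (by omega)
        ((inter_mono (List.eraseIdx_subset (l := l) (k := a + 1))).trans
          (inter_mono (List.drop_subset k _)))))).trans ?_
  congr 1
  · refine Finset.sum_congr rfl fun i _ => Finset.sum_congr rfl fun t _ => ?_
    have := i.2
    have := t.2
    congr 1
    · rw [mul_comm]
      congr 3
      rw [← hd]
      push_cast [Nat.cast_sub (show 1 ≤ i.1 by omega), Nat.cast_sub (show i.1 ≤ p by omega),
        show p - 1 - (i.1 - 1) = p - i.1 by omega]
      ring
    · apply ev_ev_congr
      · apply List.ext_getElem?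
        intro j
        simp only [List.getElem?_eraseIdx, List.getElem?_take]
        split_ifs <;> first | rfl | omega
      · apply List.ext_getElem?
        intro j
        simp only [List.getElem?_eraseIdx, List.getElem?_drop]
        split_ifs <;> first | omega | (congr 1; omega)
  · refine Finset.sum_congr rfl fun k _ => Finset.sum_congr rfl fun t _ => ?_
    have := k.2
    have := t.2
    congr 1
    · have hpow : ∀ j : ℕ, (-1 : ℤ) ^ j = (Int.negOnePow (j : ℤ) : ℤ) := by
        intro j
        simp [Int.negOnePow]
      rw [hpow, hpow]
      simp only [← Units.val_mul, ← Int.negOnePow_add]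
      congr 1
      rw [Int.negOnePow_eq_iff]
      refine ⟨(k.1 : ℤ) - d, ?_⟩
      push_cast [Nat.cast_sub (show k.1 ≤ p by omega), Nat.cast_sub (show 1 ≤ p by omega),
        Nat.cast_sub (show k.1 ≤ p - 1 by omega)]
      ring
    · apply ev_ev_congr
      · apply List.ext_getElem?
        intro j
        simp only [List.getElem?_eraseIdx, List.getElem?_take]
        split_ifs <;> first | rfl | omega
      · apply List.ext_getElem?
        intro j
        simp only [List.getElem?_eraseIdx, List.getElem?_drop]
        split_ifs <;> first | omega | congr 1

theorem act_zero_left (h : n + d = n') (c : Sec E n) : act h (0 : Cochain E F d) c = 0 := by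
  ext s
  refine Finset.sum_eq_zero fun k _ => ?_
  have : (0 : Cochain E F d) = fun _ => 0 := rfl
  simp [this, Cochain.ev, Res.moveHom_zero]

theorem act_add_left (h : n + d = n') (u v : Cochain E F d) (c : Sec E n) :
    act h (u + v) c = act h u c + act h v c := by
  ext s
  rw [add_apply]
  simp only [act]
  rw [← Finset.sum_add_distrib]
  refine Finset.sum_congr rfl fun k _ => ?_
  rw [← smul_add]
  exact congr_arg _ (congr($(Res.moveHom_add R _ _ _) _))

end Sec

namespace TwistedComplex

/-- The differential `δ + a` of the sheafification. -/
def secDiff (E : TwistedComplex R U) {n n' : ℤ} (h : n + 1 = n') :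
    Sec E.obj n →ₗ[R.obj (op ⊤)] Sec E.obj n' where
  toFun c := Sec.cech h c + Sec.act h E.a c
  map_add' c c' := by
    rw [Sec.cech_add, Sec.act_add, add_add_add_comm]
  map_smul' r c := by
    rw [Sec.cech_smul, Sec.act_smul, ← smul_add, RingHom.id_apply]

theorem secDiff_secDiff (E : TwistedComplex R U) {n n' n'' : ℤ} (h : n + 1 = n')
    (h' : n' + 1 = n'') (c : Sec E.obj n) : E.secDiff h' (E.secDiff h c) = 0 := by
  change Sec.cech h' (Sec.cech h c + Sec.act h E.a c) +
    Sec.act h' E.a (Sec.cech h c + Sec.act h E.a c) = 0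
  have h2 : n + 2 = n'' := by omega
  have key : Sec.act h2 (E.a.cech (e := 2) rfl) c +
      Sec.act h2 (Cochain.comp (f := 2) rfl E.a E.a) c = 0 := by
    rw [← Sec.act_add_left, E.maurerCartan, Sec.act_zero_left]
  rw [Sec.cech_add, Sec.act_add, Sec.cech_cech, Sec.act_act h h' (f := 2) rfl,
    Sec.cech_act h h' h (e := 2) rfl]
  refine Eq.trans ?_ key
  rw [Int.negOnePow_one, Units.val_neg, Units.val_one, neg_smul, one_smul, zero_add]
  abel

/-- The sheafification `S(E)` of a twisted complex, a complex of `R(X)`-modules. -/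
def sheafification (E : TwistedComplex R U) : Cpx R ⊤ where
  X n := ModuleCat.of _ (Sec E.obj n)
  d n n' := if h : n + 1 = n' then ModuleCat.ofHom (E.secDiff h) else 0
  shape n n' h := dif_neg h
  d_comp_d' n n' n'' h h' := by
    have h1 : n + 1 = n' := h
    have h2 : n' + 1 = n'' := h'
    rw [dif_pos h1, dif_pos h2]
    ext c : 2
    exact E.secDiff_secDiff h1 h2 c

end TwistedComplex

end Sheafification

/-! ### The twisting functor and the counit -/

section Twisting

variable {X : TopCat.{u}} {R : (Opens X)ᵒᵖ ⥤ RingCat.{u}} {ι : Type u} (U : ι → Opens X)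

/-- The restrictions `E|_{U_i}` of a complex of `R(X)`-modules. -/
def restrictions (E : Cpx R ⊤) (i : ι) : Cpx R (U i) := resCpx le_top E

/-- The cochain whose component with index `i₀…i_p` is the restriction of a map
`E^n → F^m` of `R(X)`-modules. -/
def constCochain {E F : Cpx R ⊤} {d : ℤ} (f : ∀ s : HomIndex ι d, E.X s.n ⟶ F.X s.m) :
    Cochain (restrictions U E) (restrictions U F) d := fun s =>
  Res.map₂ R le_top _ le_top _ (f s).hom

/-- The maps `a^{0,1} = d_E`, `a^{1,0} = id` and `a^{k,1-k} = 0` for `k ≥ 2`. -/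
def twistingMap (E : Cpx R ⊤) (s : HomIndex ι 1) : E.X s.n ⟶ E.X s.m :=
  if s.p = 0 then E.d s.n s.m
  else if h : s.p = 1 then (E.XIsoOfEq (by have := s.deg; omega)).hom
  else 0

/-- The component of bidegree `(0, 0)` of a chain map. -/
def twistingHomMap {E F : Cpx R ⊤} (φ : E ⟶ F) (s : HomIndex ι 0) : E.X s.n ⟶ F.X s.m :=
  if h : s.p = 0 then φ.f s.n ≫ (F.XIsoOfEq (by have := s.deg; omega)).hom
  else 0

theorem constCochain_ev {E F : Cpx R ⊤} {d : ℤ} (f : ∀ s : HomIndex ι d, E.X s.n ⟶ F.X s.m)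
    {p : ℕ} {l : List ι} {x y : ι} {n m : ℤ} (hl : l.length = p + 1)
    (hx : l.getLast? = some x) (hy : l.head? = some y) (hd : n + d = m + p)
    {W : Opens X} (hW : W ≤ inter U l) :
    (constCochain U f).ev hl hx hy hd hW =
      Res.map₂ R le_top (le_of_getLast hx hW) le_top (le_of_head hy hW)
        (f ⟨p, l, x, y, n, m, hl, hx, hy, hd⟩).hom :=
  Res.moveHom_map₂ R le_top _ le_top _ hW _

theorem constCochain_cech {E F : Cpx R ⊤} {d e : ℤ} (h : d + 1 = e)
    (f : ∀ s : HomIndex ι d, E.X s.n ⟶ F.X s.m) (s : HomIndex ι e) :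
    (constCochain U f).cech h s = Res.map₂ R le_top _ le_top _
      (∑ k : Fin (s.p - 1), (-1 : ℤ) ^ (k.1 + 1) •
        f ⟨s.p - 1, s.l.eraseIdx (k.1 + 1), s.src, s.tgt, s.n, s.m, length_face s.len (by omega),
          getLast_face s.len k.2 s.hsrc, head_face s.htgt,
          by have := s.deg; have := k.2; omega⟩ : E.X s.n ⟶ F.X s.m).hom := by
  refine Eq.trans ?_ (map_sum ((Res.map₂Add R le_top (inter_le (U := U) s.src_mem) le_top
    (inter_le (U := U) s.tgt_mem) (E.X s.n) (F.X s.m)).comp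
      (ModuleCat.homAddEquiv (M := E.X s.n) (N := F.X s.m)).toAddMonoidHom) _ _).symm
  refine Finset.sum_congr rfl fun k _ => ?_
  rw [constCochain_ev]
  exact (map_zsmul ((Res.map₂Add R le_top (inter_le (U := U) s.src_mem) le_top
    (inter_le (U := U) s.tgt_mem) (E.X s.n) (F.X s.m)).comp
      (ModuleCat.homAddEquiv (M := E.X s.n) (N := F.X s.m)).toAddMonoidHom) _ _).symm

theorem constCochain_comp {E F G : Cpx R ⊤} {d e e' : ℤ} (h : d + e = e')
    (f : ∀ s : HomIndex ι d, F.X s.n ⟶ G.X s.m) (g : ∀ s : HomIndex ι e, E.X s.n ⟶ F.X s.m)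
    (s : HomIndex ι e') :
    Cochain.comp h (constCochain U f) (constCochain U g) s = Res.map₂ R le_top _ le_top _
      (∑ k : Fin (s.p + 1), (Int.negOnePow ((d - k.1) * (s.p - k.1 : ℕ)) : ℤ) •
        (g ⟨s.p - k.1, s.l.drop k.1, s.src, s.l[k.1]'(by have := s.len; omega), s.n,
            s.n + e - (s.p - k.1 : ℕ),
            length_back s.len k.2, getLast_back (by have := s.len; omega) s.hsrc,
            head_back (by have := s.len; omega), by omega⟩ ≫
          f ⟨k.1, s.l.take (k.1 + 1), s.l[k.1]'(by have := s.len; omega), s.tgt,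
            s.n + e - (s.p - k.1 : ℕ), s.m,
            length_front s.len k.2, getLast_front (by have := s.len; omega), head_front s.htgt,
            by have := s.deg; omega⟩) : E.X s.n ⟶ G.X s.m).hom := by
  refine Eq.trans ?_ (map_sum ((Res.map₂Add R le_top (inter_le (U := U) s.src_mem) le_top
    (inter_le (U := U) s.tgt_mem) (E.X s.n) (G.X s.m)).comp
      (ModuleCat.homAddEquiv (M := E.X s.n) (N := G.X s.m)).toAddMonoidHom) _ _).symm
  refine Finset.sum_congr rfl fun k _ => ?_
  rw [constCochain_ev, constCochain_ev]
  refine Eq.trans ?_ (map_zsmul ((Res.map₂Add R le_top (inter_le (U := U) s.src_mem) le_top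
    (inter_le (U := U) s.tgt_mem) (E.X s.n) (G.X s.m)).comp
      (ModuleCat.homAddEquiv (M := E.X s.n) (N := G.X s.m)).toAddMonoidHom) _ _).symm
  exact congr_arg _ (Res.map₂_comp R le_top _ le_top _ le_top _ _ _).symm

theorem twistingMap_zero (E : Cpx R ⊤) (s : HomIndex ι 1) (h : s.p = 0) :
    twistingMap E s = E.d s.n s.m := if_pos h

theorem twistingMap_one (E : Cpx R ⊤) (s : HomIndex ι 1) (h : s.p = 1) :
    twistingMap E s = (E.XIsoOfEq (by have := s.deg; omega)).hom := by
  rw [twistingMap, if_neg (by omega), dif_pos h]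

theorem twistingMap_two (E : Cpx R ⊤) (s : HomIndex ι 1) (h : 2 ≤ s.p) :
    twistingMap E s = 0 := by
  rw [twistingMap, if_neg (by omega), dif_neg (by omega)]

theorem twisting_maurerCartan (E : Cpx R ⊤) :
    (constCochain U (twistingMap E)).cech (e := 2) rfl +
      Cochain.comp (f := 2) rfl (constCochain U (twistingMap E))
        (constCochain U (twistingMap E)) = 0 := by
  ext1 s
  refine (congr_arg₂ (· + ·) (constCochain_cech U _ _ s)
    (constCochain_comp U _ _ _ s)).trans ?_
  refine ((map_add ((Res.map₂Add R le_top (inter_le (U := U) s.src_mem) le_top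
    (inter_le (U := U) s.tgt_mem) (E.X s.n) (E.X s.m)).comp
      (ModuleCat.homAddEquiv (M := E.X s.n) (N := E.X s.m)).toAddMonoidHom) _ _).symm).trans ?_
  refine Eq.trans (congr_arg _ ?_) (map_zero ((Res.map₂Add R le_top
    (inter_le (U := U) s.src_mem) le_top
    (inter_le (U := U) s.tgt_mem) (E.X s.n) (E.X s.m)).comp
      (ModuleCat.homAddEquiv (M := E.X s.n) (N := E.X s.m)).toAddMonoidHom))
  obtain ⟨p, l, x, y, n, m, hl, hx, hy, hd⟩ := s
  dsimp only
  match p, hl, hd with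
  | 0, hl, hd =>
    simp [twistingMap_zero]
  | 1, hl, hd =>
    simp [Fin.sum_univ_succ, twistingMap_zero, twistingMap_one]
  | 2, hl, hd =>
    simp [Fin.sum_univ_succ, twistingMap_zero, twistingMap_one, twistingMap_two]
  | p + 3, hl, hd =>
    rw [Finset.sum_eq_zero, Finset.sum_eq_zero, add_zero]
    · intro k _
      by_cases hk : 2 ≤ k.1
      · rw [twistingMap_two E (HomIndex.mk k.1 _ _ _ _ _ _ _ _ _) hk, Limits.comp_zero, smul_zero]
      · rw [twistingMap_two E _ (show 2 ≤ p + 3 - k.1 by omega), Limits.zero_comp, smul_zero]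
    · intro k _
      rw [twistingMap_two E _ (show 2 ≤ p + 3 - 1 by omega), smul_zero]

/-- The twisted complex `T(E)` of a complex of `R(X)`-modules: the restrictions `E|_{U_i}`, with
`a^{0,1}` the differential, `a^{1,0} = id` and `a^{k,1-k} = 0` for `k ≥ 2`. -/
def twisting (E : Cpx R ⊤) : TwistedComplex R U where
  obj := restrictions U E
  a := constCochain U (twistingMap E)
  a_zero i n m h := by
    refine Eq.trans ?_ (Res.map₂_self R le_top (inter_le (U := U) List.mem_cons_self)
      (E.d n m).hom)
    exact congr_arg (fun f : E.X n ⟶ E.X m => Res.map₂ R le_top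
      (inter_le (U := U) (l := [i]) List.mem_cons_self) le_top
      (inter_le (U := U) (l := [i]) List.mem_cons_self) f.hom)
      (twistingMap_zero E (vertexIndex i n m h) rfl)
  maurerCartan := twisting_maurerCartan U E
  a_one i := by
    refine ⟨HomotopyEquiv.refl _, fun n => ?_⟩
    refine Eq.trans ?_ (congr_arg (fun f : E.X n ⟶ E.X n => Res.map₂ R le_top
      (inter_le (U := U) (l := [i, i]) List.mem_cons_self) le_top
      (inter_le (U := U) (l := [i, i]) List.mem_cons_self) f.hom)
      (twistingMap_one E (loopIndex i n) rfl)).symm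
    apply Res.hom_ext₂
    intro m
    refine Eq.trans ?_ (Res.map₂_unit R _ _ _ _ _ m).symm
    rfl

/-- The morphism `T(φ)` induced by a chain map `φ`: the maps `φ|_{U_i}` in bidegree `(0, 0)`. -/
def twistingHom {E F : Cpx R ⊤} (φ : E ⟶ F) :
    TwistedComplex.Hom (twisting U E) (twisting U F) 0 :=
  constCochain U (twistingHomMap φ)

variable {U}

/-- The projection of `S(F)` to the factor `F^m_{i₀}|_{U_{i₀…i_p}}`. -/
def Sec.proj (F : ∀ i, Cpx R (U i)) {n : ℤ} (s : SecIndex ι n) :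
    Sec F n →ₛₗ[rho R (le_top : inter U s.l ≤ ⊤)] Res R (inter_le (U := U) s.mem) ((F s.x).X s.m) where
  toFun c := c s
  map_add' _ _ := rfl
  map_smul' _ _ := rfl

/-- The counit `T(S(F)) → F`: its component with index `i₀…i_p` is the `R(U_{i₀…i_p})`-linear
extension `r ⊗ c ↦ r • c_{i₀…i_p}` of the projection to the factor with index `i₀…i_p`. -/
def TwistedComplex.counit (F : TwistedComplex R U) :
    TwistedComplex.Hom (twisting U F.sheafification) F 0 := fun s =>
  Res.lift R le_top (Sec.proj F.obj
      ⟨s.p, s.l, s.tgt, s.m, s.len, s.htgt, by have := s.deg; omega⟩) ∘ₗ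
    Res.collapse R le_top (inter_le (U := U) s.src_mem)

end Twisting

end TwistedDescent

end

open TwistedDescent

noncomputable section

namespace TwistedDescent

/-! ### Soft sheaves of rings: global sections -/

section SoftSheaves

variable {X : TopCat.{u}}

/-! Softness enters through two facts about `R = closureSections A` (`IsSoftPresheaf`): global
elements restrict onto every R(W), and an element that restricts to zero on W is killed by some f
that restricts to 1 on W. Consequently M|_W is the quotient of M by the elements killed by such an f
(`Res.unit_eq_zero_iff`). Restriction therefore commutes with cohomology, and statements over X can
be checked locally with a finite partition of unity μ_j (`FinitePartition`). The rings need not be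
commutative: partitions come from expanding 1 - ∏(1 - e_j), and cutoffs act on the right where left
linearity must survive.

The projection of S(F) to the component with index [i] becomes a quasi-isomorphism onto F_i after
restriction to U_i (`TwistedComplex.isLocalModel_toVertex`). Let h_j evaluate a section on tuples
with τ j appended and multiply by μ_j, up to sign. In D h_j + h_j D + μ_j everything cancels except
the term where the full-length component of the twisting cochain acts on c_{τ j}
(`TwistedComplex.secDiff_contract`), so up to homotopy μ_j c depends only on c_{τ j}. The
Maurer–Cartan equation in low degrees says that the a_{ij} are chain maps and compose up to
homotopy. With the invertibility of a_{ii} up to homotopy this yields injectivity and surjectivity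
on cohomology.

A complex S with strictly perfect local models is quasi-isomorphic to a strictly perfect complex
(`exists_isStrictlyPerfect_of_local`). Its top cohomology is locally a quotient of a finitely
generated module of cycles, hence finitely generated over X; a free module is mapped onto it, and
the cone has cohomology in fewer degrees. When only the lowest possible degree is left, the
cohomology is locally the module of cycles, which is projective; a finitely generated, locally
projective module is projective (`FinitePartition.projective_of_local`), and the induction ends.

Finally, the components of g = η ∘ T(φ) on an element e are those of φ e, which makes g closed
(`diff_adjoint`). At each vertex g compares two local models along φ, so it is a quasi-isomorphism
between bounded complexes of projectives and hence a homotopy equivalence. The inverses at the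
vertices form an inverse of g up to terms of positive Čech degree. The filtration by Čech degree is
complete, so a geometric series removes these errors
(`TwistedComplex.isHomotopyEquivalence_of_filtration`). -/

instance (K : Set X) : IsFiltered (Nhds K)ᵒᵖ := by
  have : Nonempty (Nhds K) := ⟨⟨⊤, fun _ _ => trivial⟩⟩
  have : IsCodirectedOrder (Nhds K) :=
    ⟨fun V W => ⟨⟨V.1 ⊓ W.1, fun _ hx => ⟨V.2 hx, W.2 hx⟩⟩, inf_le_left (a := V.1),
      inf_le_right (a := V.1)⟩⟩
  infer_instance

theorem germNear_exists_rep (A : (Opens X)ᵒᵖ ⥤ RingCat.{u}) {K : Set X} (x : sectionsNear A K) :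
    ∃ (V : Nhds K) (s : A.obj (op V.1)), (germNear A K V).hom s = x := by
  obtain ⟨V, s, h⟩ := Concrete.colimit_exists_rep (nhdsDiagram A K) x
  exact ⟨V.unop, s, h⟩

theorem germNear_map (A : (Opens X)ᵒᵖ ⥤ RingCat.{u}) {K : Set X} {V W : Nhds K} (h : W.1 ≤ V.1)
    (s : A.obj (op V.1)) :
    (germNear A K W).hom ((A.map (homOfLE h).op).hom s) = (germNear A K V).hom s :=
  congr($(colimit.w (nhdsDiagram A K) (homOfLE (show W ≤ V from h)).op).hom s)

theorem germNear_eq_zero_iff (A : (Opens X)ᵒᵖ ⥤ RingCat.{u}) {K : Set X} (V : Nhds K)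
    (s : A.obj (op V.1)) : (germNear A K V).hom s = 0 ↔
      ∃ (W : Nhds K) (h : W.1 ≤ V.1), (A.map (homOfLE h).op).hom s = 0 := by
  constructor
  · intro h
    obtain ⟨W, f, g, e⟩ := Concrete.colimit_exists_of_rep_eq (nhdsDiagram A K)
      (i := op V) (j := op V) s 0 (h.trans (map_zero (germNear A K V).hom).symm)
    exact ⟨W.unop, leOfHom f.unop, e.trans (map_zero ((nhdsDiagram A K).map g).hom)⟩
  · rintro ⟨W, h, e⟩
    rw [← germNear_map A h, e, map_zero]

/-- The union of the open sets on which a global section vanishes. -/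
def zeroLocus (A : (Opens X)ᵒᵖ ⥤ RingCat.{u}) (s : A.obj (op ⊤)) : Opens X :=
  sSup {V | (A.map (homOfLE (le_top : V ≤ ⊤)).op).hom s = 0}

theorem le_zeroLocus {A : (Opens X)ᵒᵖ ⥤ RingCat.{u}} {s : A.obj (op ⊤)} {V : Opens X}
    (h : (A.map (homOfLE (le_top : V ≤ ⊤)).op).hom s = 0) : V ≤ zeroLocus A s :=
  le_sSup h

variable (A : TopCat.Sheaf RingCat.{u} X)

/-- Locality of the sheaf: the open sets on which `s` vanishes cover `V`. Vanishing of a section is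
thus governed by a single largest open set. -/
theorem map_eq_zero_of_le_zeroLocus {s : A.obj.obj (op ⊤)} {V : Opens X}
    (h : V ≤ zeroLocus A.obj s) : (A.obj.map (homOfLE (le_top : V ≤ ⊤)).op).hom s = 0 := by
  let I := {W : Opens X // (A.obj.map (homOfLE (le_top : W ≤ ⊤)).op).hom s = 0}
  refine A.eq_of_locally_eq' (fun W : I => V ⊓ W.1) V (fun W => homOfLE inf_le_left) ?_ _ _ ?_
  · intro x hx
    obtain ⟨W, hW, hxW⟩ := Opens.mem_sSup.1 (h hx)
    exact Opens.mem_iSup.2 ⟨⟨W, hW⟩, hx, hxW⟩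
  · rintro ⟨W, hW⟩
    have e : A.obj.map (homOfLE (le_top : V ≤ ⊤)).op ≫
          A.obj.map (homOfLE (inf_le_left : V ⊓ W ≤ V)).op =
        A.obj.map (homOfLE (le_top : W ≤ ⊤)).op ≫
          A.obj.map (homOfLE (inf_le_right : V ⊓ W ≤ W)).op := by
      rw [← A.obj.map_comp, ← A.obj.map_comp]; rfl
    have e' := congr($(e).hom s)
    simp only [RingCat.hom_comp, RingHom.comp_apply] at e'
    rw [hW, map_zero] at e'
    exact e'.trans (map_zero (A.obj.map (homOfLE (inf_le_left : V ⊓ W ≤ V)).op).hom).symm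

theorem eq_zero_of_zeroLocus_eq_top {s : A.obj.obj (op ⊤)} (h : zeroLocus A.obj s = ⊤) : s = 0 := by
  have := map_eq_zero_of_le_zeroLocus A (s := s) (V := ⊤) h.ge
  have e : (homOfLE (le_top : (⊤ : Opens X) ≤ ⊤)).op = 𝟙 _ := rfl
  rw [e, A.obj.map_id] at this
  exact this

theorem zeroLocus_mul_left (s t : A.obj.obj (op ⊤)) :
    zeroLocus A.obj s ≤ zeroLocus A.obj (s * t) :=
  le_zeroLocus (by rw [map_mul, map_eq_zero_of_le_zeroLocus A le_rfl, zero_mul])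

theorem zeroLocus_mul_right (s t : A.obj.obj (op ⊤)) :
    zeroLocus A.obj t ≤ zeroLocus A.obj (s * t) :=
  le_zeroLocus (by rw [map_mul, map_eq_zero_of_le_zeroLocus A (le_refl (zeroLocus A.obj t)),
    mul_zero])

/-- Global sections as sections near the closure of `X`. -/
def globalSection (A : (Opens X)ᵒᵖ ⥤ RingCat.{u}) :
    A.obj (op ⊤) →+* (closureSections A).obj (op ⊤) :=
  (germNear A (closure ((⊤ : Opens X) : Set X)) ⟨⊤, fun _ _ => trivial⟩).hom

theorem globalSection_surjective (A : (Opens X)ᵒᵖ ⥤ RingCat.{u}) :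
    Function.Surjective (globalSection A) := by
  intro x
  obtain ⟨⟨V, hV⟩, s, rfl⟩ := germNear_exists_rep A x
  -- A neighbourhood of the closure of X is X itself.
  obtain rfl : V = ⊤ := eq_top_iff.2 fun x hx => hV (subset_closure hx)
  exact ⟨s, rfl⟩

theorem rho_globalSection (A : (Opens X)ᵒᵖ ⥤ RingCat.{u}) (W : Opens X) (s : A.obj (op ⊤)) :
    rho (closureSections A) (le_top : W ≤ ⊤) (globalSection A s) =
      (germNear A (closure (W : Set X)) ⟨⊤, fun _ _ => trivial⟩).hom s :=
  congr($(germNear_restrictNear A (closure_mono (le_top : W ≤ ⊤)) ⟨⊤, fun _ _ => trivial⟩).hom s)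

/-- A germ near the closure of `W` is zero when it dies on some neighbourhood. This dictionary turns
purity and partitions of unity into statements about open sets. -/
theorem rho_globalSection_eq_zero_iff (W : Opens X) (s : A.obj.obj (op ⊤)) :
    rho (closureSections A.obj) (le_top : W ≤ ⊤) (globalSection A.obj s) = 0 ↔
      closure (W : Set X) ⊆ zeroLocus A.obj s := by
  rw [rho_globalSection]
  refine (germNear_eq_zero_iff A.obj ⟨⊤, fun _ _ => trivial⟩ s).trans ?_
  constructor
  · rintro ⟨V, h, e⟩
    exact V.2.trans (le_zeroLocus e)
  · intro h
    exact ⟨⟨zeroLocus A.obj s, h⟩, le_top, map_eq_zero_of_le_zeroLocus A le_rfl⟩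

theorem rho_globalSection_eq_one_iff (W : Opens X) (s : A.obj.obj (op ⊤)) :
    rho (closureSections A.obj) (le_top : W ≤ ⊤) (globalSection A.obj s) = 1 ↔
      closure (W : Set X) ⊆ zeroLocus A.obj (1 - s) := by
  rw [← rho_globalSection_eq_zero_iff, map_sub, map_sub, map_one, map_one, sub_eq_zero, eq_comm]

variable {A}

theorem rho_surjective_of_isSoft (hA : IsSoft A) (W : Opens X) :
    Function.Surjective (rho (closureSections A.obj) (le_top : W ≤ ⊤)) := by
  intro x
  obtain ⟨s, rfl⟩ := hA _ isClosed_closure x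
  exact ⟨globalSection A.obj s, rho_globalSection _ _ _⟩

/-- Disjoint closed sets are separated by global sections of a soft sheaf of rings. -/
theorem exists_separating_section [NormalSpace X] (hA : IsSoft A) {K C : Set X} (hK : IsClosed K)
    (hC : IsClosed C) (h : Disjoint K C) :
    ∃ s : A.obj.obj (op ⊤), K ⊆ zeroLocus A.obj (1 - s) ∧ C ⊆ zeroLocus A.obj s := by
  obtain ⟨V, W, hV, hW, hKV, hCW, hVW⟩ := normal_separation hK hC h
  let V' : Bool → Opens X := fun b => bif b then ⟨V, hV⟩ else ⟨W, hW⟩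
  -- The empty cover of the empty set makes its ring of sections zero, so 1 on `V` and 0 on `W`
  -- agree on their overlap and glue.
  have hsub : Subsingleton (A.obj.obj (op (⊥ : Opens X))) := by
    refine ⟨fun a b => A.eq_of_locally_eq' (fun i : Empty => ⊥) ⊥ (fun i => i.elim) bot_le a b
      fun i => i.elim⟩
  have hVW' : (⟨V, hV⟩ : Opens X) ⊓ ⟨W, hW⟩ = ⊥ := by
    ext x
    exact ⟨fun hx => Set.disjoint_left.1 hVW hx.1 hx.2, fun hx => hx.elim⟩
  have hsub' : ∀ i j, i ≠ j → Subsingleton (A.obj.obj (op (V' i ⊓ V' j))) := by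
    rintro (_ | _) (_ | _) hij
    · exact (hij rfl).elim
    · exact ((inf_comm _ _).trans hVW' : V' false ⊓ V' true = ⊥) ▸ hsub
    · exact (hVW' : V' true ⊓ V' false = ⊥) ▸ hsub
    · exact (hij rfl).elim
  obtain ⟨t, ht, -⟩ := A.existsUnique_gluing V'
    (fun b => match b with | true => (1 : A.obj.obj _) | false => (0 : A.obj.obj _))
    (fun i j => by
      by_cases hij : i = j
      · subst hij; rfl
      · exact (hsub' i j hij).elim _ _)
  have hKC : K ∪ C ⊆ (iSup V' : Opens X) := by
    rintro x (hx | hx)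
    · exact Opens.mem_iSup.2 ⟨true, hKV hx⟩
    · exact Opens.mem_iSup.2 ⟨false, hCW hx⟩
  -- Softness extends the germ of the glued section; the extension agrees with it only on a smaller
  -- neighbourhood `Y` of `K ∪ C`.
  obtain ⟨s, hs⟩ := hA (K ∪ C) (hK.union hC) ((germNear A.obj (K ∪ C) ⟨iSup V', hKC⟩).hom t)
  rw [← sub_eq_zero, ← germNear_map A.obj (V := ⟨⊤, fun _ _ => trivial⟩) (W := ⟨iSup V', hKC⟩)
    le_top, ← map_sub, germNear_eq_zero_iff] at hs
  obtain ⟨Y, hY, e⟩ := hs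
  have key : ∀ b, (A.obj.map (homOfLE (le_top : Y.1 ⊓ V' b ≤ ⊤)).op).hom s =
      (A.obj.map (homOfLE (inf_le_right : Y.1 ⊓ V' b ≤ V' b)).op).hom
        ((A.obj.map (Opens.leSupr V' b).op).hom t) := by
    intro b
    have e' := congr((A.obj.map (homOfLE (inf_le_left : Y.1 ⊓ V' b ≤ Y.1)).op).hom $e)
    rw [map_zero, map_sub, map_sub, sub_eq_zero] at e'
    simp only [← RingHom.comp_apply, ← RingCat.hom_comp, ← A.obj.map_comp] at e' ⊢
    exact e'
  refine ⟨s, fun x hx => ?_, fun x hx => ?_⟩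
  · refine le_zeroLocus (V := Y.1 ⊓ V' true) ?_ ⟨Y.2 (Or.inl hx), hKV hx⟩
    rw [map_sub, key, sub_eq_zero]
    refine Eq.trans ?_ (congr_arg _ (ht true).symm)
    rw [map_one]
    exact (map_one (A.obj.map (homOfLE (inf_le_right : Y.1 ⊓ V' true ≤ V' true)).op).hom).symm
  · refine le_zeroLocus (V := Y.1 ⊓ V' false) ?_ ⟨Y.2 (Or.inr hx), hCW hx⟩
    rw [key]
    refine (congr_arg _ (ht false)).trans ?_
    exact (map_zero (A.obj.map (homOfLE (inf_le_right : Y.1 ⊓ V' false ≤ V' false)).op).hom)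

end SoftSheaves

/-! ### Presheaves of rings with surjective restrictions and pure kernels -/

section SoftRings

variable {X : TopCat.{u}}

/-- The restrictions from `X` are surjective, and each element of their kernels is annihilated by
a global section that restricts to `1`. -/
structure IsSoftPresheaf (R : (Opens X)ᵒᵖ ⥤ RingCat.{u}) : Prop where
  surjective (W : Opens X) : Function.Surjective (rho R (le_top : W ≤ ⊤))
  pure (W : Opens X) (a : R.obj (op ⊤)) (ha : rho R (le_top : W ≤ ⊤) a = 0) :
    ∃ f : R.obj (op ⊤), rho R (le_top : W ≤ ⊤) f = 1 ∧ f * a = 0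

/-- A finite partition of unity `μ` subordinate to open sets `O j ≤ U (τ j)`, together with
functions `χ j` that are `1` near `O j` and supported in `U (τ j)`. -/
structure FinitePartition (R : (Opens X)ᵒᵖ ⥤ RingCat.{u}) {ι : Type u} (U : ι → Opens X) where
  r : ℕ
  τ : Fin r → ι
  O : Fin r → Opens X
  μ : Fin r → R.obj (op ⊤)
  χ : Fin r → R.obj (op ⊤)
  le (j : Fin r) : O j ≤ U (τ j)
  sum_μ : ∑ j, μ j = 1
  rho_χ (j : Fin r) : rho R (le_top : O j ≤ ⊤) (χ j) = 1
  mul_χ (j : Fin r) (a : R.obj (op ⊤)) (ha : rho R (le_top : U (τ j) ≤ ⊤) a = 0) : a * χ j = 0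
  rho_μ_mul (j : Fin r) {V W : Opens X} (h : W ⊓ O j ≤ V) (a : R.obj (op ⊤))
    (ha : rho R (le_top : V ≤ ⊤) a = 0) : rho R (le_top : W ≤ ⊤) (μ j * a) = 0

/-- A section that vanishes near the closure of `W` vanishes on an open set containing this closure.
A section that is 1 near the closure and 0 near the complement of that open set then annihilates it
everywhere. -/
theorem isSoftPresheaf_closureSections [NormalSpace X] {A : TopCat.Sheaf RingCat.{u} X}
    (hA : IsSoft A) : IsSoftPresheaf (closureSections A.obj) where
  surjective := rho_surjective_of_isSoft hA
  pure W a ha := by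
    obtain ⟨a, rfl⟩ := globalSection_surjective A.obj a
    rw [rho_globalSection_eq_zero_iff] at ha
    obtain ⟨s, h1, h2⟩ := exists_separating_section hA (isClosed_closure (s := (W : Set X)))
      (zeroLocus A.obj a).isOpen.isClosed_compl (Set.disjoint_compl_right_iff_subset.2 ha)
    refine ⟨globalSection A.obj s, ?_, ?_⟩
    · rwa [rho_globalSection_eq_one_iff]
    · rw [← map_mul, eq_zero_of_zeroLocus_eq_top A (s := s * a), map_zero]
      rw [eq_top_iff]
      intro x _
      by_cases hx : x ∈ zeroLocus A.obj a
      · exact zeroLocus_mul_right A _ _ hx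
      · exact zeroLocus_mul_left A _ _ (h2 hx)

/-- Telescoping expansion that needs no commutativity. The summand of index j has `e j` as its left
factor, so it vanishes wherever `e j` does. It serves both for sections and for endomorphisms of
modules. -/
theorem sum_prod_one_sub {S : Type*} [Ring S] {r : ℕ} (e : Fin r → S) :
    ∃ c : Fin r → S, ∑ j, e j * c j = 1 - (List.ofFn fun j => 1 - e j).prod := by
  induction r with
  | zero => exact ⟨e, by simp⟩
  | succ r ih =>
    obtain ⟨c, hc⟩ := ih fun j => e j.succ
    refine ⟨Fin.cons (List.ofFn fun j : Fin r => 1 - e j.succ).prod c, ?_⟩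
    rw [Fin.sum_univ_succ, List.ofFn_succ, List.prod_cons]
    simp only [Fin.cons_zero, Fin.cons_succ, hc]
    noncomm_ring

/-- The finite cover is shrunk twice, to open `O j` with closure in `V j` and to closed `K j` in `O
j`. The `e j`, equal to 1 near `K j` and 0 off `O j`, produce the partition of unity; the `χ j`,
equal to 1 near the closure of `O j` and 0 off `V j`, are the larger cutoffs. -/
theorem exists_finitePartition [NormalSpace X] {A : TopCat.Sheaf RingCat.{u} X}
    (hA : IsSoft A) {ι : Type u} {U : ι → Opens X} (h : HasFiniteGoodRefinement U) :
    Nonempty (FinitePartition (closureSections A.obj) U) := by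
  obtain ⟨r, V, hV, hVU, -⟩ := h
  choose τ hτ using hVU
  have hV' : ⋃ j, (V j : Set X) = Set.univ := by
    rw [← Opens.coe_iSup, hV]; rfl
  obtain ⟨O, hO, hOo, hOV⟩ := exists_iUnion_eq_closure_subset (fun j => (V j).isOpen)
    (fun x => Set.toFinite _) hV'
  obtain ⟨K, hK, hKc, hKO⟩ := exists_iUnion_eq_closed_subset hOo (fun x => Set.toFinite _) hO
  choose χ hχ1 hχ2 using fun j => exists_separating_section hA (isClosed_closure (s := O j))
    (V j).isOpen.isClosed_compl (Set.disjoint_compl_right_iff_subset.2 (hOV j))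
  choose e he1 he2 using fun j => exists_separating_section hA (hKc j)
    (hOo j).isClosed_compl (Set.disjoint_compl_right_iff_subset.2 (hKO j))
  obtain ⟨c, hc⟩ := sum_prod_one_sub e
  -- Near each point some factor `1 - e j` vanishes, because the `K j` cover X; this kills the
  -- product whatever stands on either side of the factor.
  have hprod : (List.ofFn fun j => 1 - e j).prod = 0 := by
    apply eq_zero_of_zeroLocus_eq_top A
    rw [eq_top_iff]
    intro x _
    obtain ⟨j, hj⟩ := Set.mem_iUnion.1 (hK.ge (Set.mem_univ x))
    have : ∀ l : List (A.obj.obj (op ⊤)), (1 - e j) ∈ l →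
        zeroLocus A.obj (1 - e j) ≤ zeroLocus A.obj l.prod := by
      intro l
      induction l with
      | nil => simp
      | cons a l ih =>
        intro hl
        rw [List.prod_cons]
        rcases List.mem_cons.1 hl with rfl | hl
        · exact zeroLocus_mul_left A _ _
        · exact (ih hl).trans (zeroLocus_mul_right A _ _)
    exact this _ (List.mem_ofFn.2 ⟨j, rfl⟩) (he1 j hj)
  refine ⟨⟨r, τ, fun j => ⟨O j, hOo j⟩, fun j => globalSection A.obj (e j * c j),
    fun j => globalSection A.obj (χ j), ?_, ?_, ?_, ?_, ?_⟩⟩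
  · exact fun j => (subset_closure.trans (hOV j)).trans (hτ j)
  · rw [← map_sum, hc, hprod, sub_zero, map_one]
  · intro j
    rw [rho_globalSection_eq_one_iff]
    exact hχ1 j
  · intro j a ha
    obtain ⟨a, rfl⟩ := globalSection_surjective A.obj a
    rw [rho_globalSection_eq_zero_iff] at ha
    rw [← map_mul, eq_zero_of_zeroLocus_eq_top A (s := a * χ j), map_zero]
    rw [eq_top_iff]
    intro x _
    by_cases hx : x ∈ V j
    · exact zeroLocus_mul_left A _ _ (ha (subset_closure (hτ j hx)))
    · exact zeroLocus_mul_right A _ _ (hχ2 j hx)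
  · intro j V' W h a ha
    obtain ⟨a, rfl⟩ := globalSection_surjective A.obj a
    rw [rho_globalSection_eq_zero_iff] at ha
    rw [← map_mul, rho_globalSection_eq_zero_iff]
    intro x hx
    -- In the open set `O j`, the point lies in the closure of `W ⊓ O j`, hence in that of `V'`,
    -- near which `a` vanishes. Off `O j` the factor `e j` vanishes near the point.
    by_cases hxO : x ∈ O j
    · refine zeroLocus_mul_right A _ _ (ha (closure_mono h ?_))
      rw [mem_closure_iff] at hx ⊢
      intro o ho hxo
      obtain ⟨y, hy, hyW⟩ := hx _ (ho.inter (hOo j)) ⟨hxo, hxO⟩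
      exact ⟨y, hy.1, hyW, hy.2⟩
    · exact zeroLocus_mul_left A _ _ (zeroLocus_mul_left A _ _ (he2 j hxO))

end SoftRings

end TwistedDescent

end

noncomputable section

namespace TwistedDescent

/-! ### Restriction of modules over a soft presheaf of rings -/

section Vanishing

variable {X : TopCat.{u}} {R : (Opens X)ᵒᵖ ⥤ RingCat.{u}} (hR : IsSoftPresheaf R)

@[simp]
theorem rho_self {U : Opens X} (h : U ≤ U) (r : R.obj (op U)) : rho R h r = r := by
  have : R.map (homOfLE h).op = 𝟙 _ := R.map_id _
  rw [rho, this]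
  rfl

include hR

theorem IsSoftPresheaf.rho_surjective {U V : Opens X} (h : V ≤ U) :
    Function.Surjective (rho R h) := by
  intro x
  obtain ⟨r, rfl⟩ := hR.surjective V x
  exact ⟨rho R le_top r, rho_rho R _ _ _⟩

theorem IsSoftPresheaf.pure₂ {V : Opens X} {a b : R.obj (op ⊤)}
    (ha : rho R (le_top : V ≤ ⊤) a = 0) (hb : rho R (le_top : V ≤ ⊤) b = 0) :
    ∃ f, rho R (le_top : V ≤ ⊤) f = 1 ∧ f * a = 0 ∧ f * b = 0 := by
  obtain ⟨f, hf, hfa⟩ := hR.pure V a ha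
  obtain ⟨g, hg, hgb⟩ := hR.pure V (f * b) (by rw [map_mul, hb, mul_zero])
  exact ⟨g * f, by rw [map_mul, hf, hg, mul_one], by rw [mul_assoc, hfa, mul_zero],
    by rw [mul_assoc, hgb]⟩

/-- The elements of an `R(U)`-module that vanish on `V`. -/
def vanishing {U : Opens X} (V : Opens X) (_hV : V ≤ U) (M : Type*) [AddCommGroup M]
    [Module (R.obj (op U)) M] : Submodule (R.obj (op U)) M where
  carrier := {m | ∃ f : R.obj (op ⊤), rho R (le_top : V ≤ ⊤) f = 1 ∧
    rho R (le_top : U ≤ ⊤) f • m = 0}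
  zero_mem' := ⟨1, map_one _, smul_zero _⟩
  add_mem' := by
    rintro m m' ⟨f, hf, hfm⟩ ⟨f', hf', hfm'⟩
    -- `g = g * f = g * f'`, so this single cutoff kills both elements.
    obtain ⟨g, hg, h1, h2⟩ := hR.pure₂ (V := V) (a := 1 - f) (b := 1 - f')
      (by rw [map_sub, hf, map_one, sub_self]) (by rw [map_sub, hf', map_one, sub_self])
    rw [mul_sub, mul_one, sub_eq_zero] at h1 h2
    refine ⟨g, hg, ?_⟩
    have e1 : rho R (le_top : U ≤ ⊤) g • m = 0 := by
      rw [h1, map_mul, mul_smul, hfm, smul_zero]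
    have e2 : rho R (le_top : U ≤ ⊤) g • m' = 0 := by
      rw [h2, map_mul, mul_smul, hfm', smul_zero]
    rw [smul_add, e1, e2, add_zero]
  smul_mem' := by
    rintro r m ⟨f, hf, hfm⟩
    obtain ⟨r, rfl⟩ := hR.surjective U r
    -- Without commutativity `f` need not kill `r • m`. Since `m = (1 - f) • m`, an element that
    -- kills `r * (1 - f)` does.
    obtain ⟨g, hg, hg'⟩ := hR.pure V (r * (1 - f))
      (by rw [map_mul, map_sub, hf, map_one, sub_self, mul_zero])
    refine ⟨g, hg, ?_⟩
    have : m = rho R (le_top : U ≤ ⊤) (1 - f) • m := by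
      rw [map_sub, sub_smul, hfm, map_one, one_smul, sub_zero]
    rw [this, ← mul_smul, ← mul_smul, ← map_mul, ← map_mul, mul_assoc, hg', map_zero, zero_smul]

variable {U V : Opens X} (h : V ≤ U) {M : Type*} [AddCommGroup M] [Module (R.obj (op U)) M]

/-- Purity is what makes the kernel of restriction act trivially modulo `vanishing`, so that the
quotient becomes an R(V)-module. -/
theorem smul_mem_vanishing {a : R.obj (op U)} (ha : rho R h a = 0) (m : M) :
    a • m ∈ vanishing hR V h M := by
  obtain ⟨a, rfl⟩ := hR.surjective U a
  rw [rho_rho] at ha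
  obtain ⟨f, hf, hfa⟩ := hR.pure V a ha
  exact ⟨f, hf, by rw [← mul_smul, ← map_mul, hfa, map_zero, zero_smul]⟩

theorem vanishing_anti {V' : Opens X} (h' : V' ≤ V) {m : M} (hm : m ∈ vanishing hR V h M) :
    m ∈ vanishing hR V' (h'.trans h) M := by
  obtain ⟨f, hf, hfm⟩ := hm
  exact ⟨f, by rw [← rho_rho R le_top h', hf, map_one], hfm⟩

theorem map_mem_vanishing {N : Type*} [AddCommGroup N] [Module (R.obj (op U)) N]
    (g : M →ₗ[R.obj (op U)] N) {m : M} (hm : m ∈ vanishing hR V h M) :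
    g m ∈ vanishing hR V h N := by
  obtain ⟨f, hf, hfm⟩ := hm
  exact ⟨f, hf, by rw [← map_smul, hfm, map_zero]⟩

end Vanishing

/-! ### Restriction as a quotient, and extension by zero -/

section ResVanishing

variable {X : TopCat.{u}} {R : (Opens X)ᵒᵖ ⥤ RingCat.{u}} (hR : IsSoftPresheaf R)
  {U V W : Opens X} (h : V ≤ U) {M : Type u} [AddCommGroup M] [Module (R.obj (op U)) M]

include hR

theorem Res.unit_surjective : Function.Surjective (Res.unit R h (M := M)) := by
  intro x
  induction x using Res.induction with
  | zero => exact ⟨0, map_zero _⟩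
  | unit r m =>
    obtain ⟨r, rfl⟩ := hR.rho_surjective h r
    exact ⟨r • m, LinearMap.map_smulₛₗ _ _ _⟩
  | add x y hx hy =>
    obtain ⟨a, rfl⟩ := hx
    obtain ⟨b, rfl⟩ := hy
    exact ⟨a + b, map_add _ _ _⟩

/-- The quotient of `M` by `vanishing` is an R(V)-module, since R(U) → R(V) is onto and its kernel
acts by zero. By the universal property M|_V maps to this quotient, so nothing outside `vanishing`
dies in M|_V. -/
theorem Res.unit_eq_zero_iff (m : M) : Res.unit R h m = 0 ↔ m ∈ vanishing hR V h M := by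
  constructor
  · intro hm
    let Q := M ⧸ vanishing hR V h M
    have hs := hR.rho_surjective h
    -- Scalars act through arbitrarily chosen lifts; `key` shows that the choice is immaterial.
    let : SMul (R.obj (op V)) Q := ⟨fun r x => Function.surjInv hs r • x⟩
    have key : ∀ (c : R.obj (op U)) (x : Q), rho R h c • x = c • x := by
      intro c x
      change Function.surjInv hs (rho R h c) • x = c • x
      rw [← sub_eq_zero, ← sub_smul]
      obtain ⟨m, rfl⟩ := Submodule.Quotient.mk_surjective _ x
      rw [← Submodule.Quotient.mk_smul, Submodule.Quotient.mk_eq_zero]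
      exact smul_mem_vanishing hR h (by rw [map_sub, Function.surjInv_eq hs, sub_self]) m
    let : Module (R.obj (op V)) Q := Function.Surjective.moduleLeft (rho R h) hs key
    let f : M →ₛₗ[rho R h] Q :=
      { toFun := Submodule.Quotient.mk
        map_add' := fun _ _ => rfl
        map_smul' := fun r m => (key r (Submodule.Quotient.mk m)).symm }
    have := Res.lift_unit R h f m
    rw [hm, map_zero] at this
    exact (Submodule.Quotient.mk_eq_zero _).1 this.symm
  · rintro ⟨f, hf, hfm⟩
    have := LinearMap.map_smulₛₗ (Res.unit R h) (rho R (le_top : U ≤ ⊤) f) m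
    rwa [hfm, map_zero, rho_rho, hf, one_smul, eq_comm] at this

theorem Res.unit_eq_unit_iff (m m' : M) :
    Res.unit R h m = Res.unit R h m' ↔ m - m' ∈ vanishing hR V h M := by
  rw [← Res.unit_eq_zero_iff hR h, map_sub, sub_eq_zero]

theorem Res.move_surjective (h' : W ≤ V) : Function.Surjective (Res.move R h h' (M := M)) := by
  intro x
  obtain ⟨m, rfl⟩ := Res.unit_surjective hR (h'.trans h) x
  exact ⟨Res.unit R h m, Res.move_unit R h h' m⟩

theorem Res.move_eq_zero (h' : W ≤ V) {x : Res R h M} (hx : Res.move R h h' x = 0) :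
    ∃ f : R.obj (op ⊤), rho R (le_top : W ≤ ⊤) f = 1 ∧ rho R (le_top : V ≤ ⊤) f • x = 0 := by
  obtain ⟨m, rfl⟩ := Res.unit_surjective hR h x
  rw [Res.move_unit, Res.unit_eq_zero_iff hR] at hx
  obtain ⟨f, hf, hfm⟩ := hx
  refine ⟨f, hf, ?_⟩
  rw [← rho_rho R le_top h, ← LinearMap.map_smulₛₗ, hfm, map_zero]

/-- Multiplication by a section `σ` which is supported in `V`, relative to `W`, followed by
extension by zero from `V` to `W`. -/
def Res.extend (h' : V ≤ W) (hW : W ≤ U) (σ : R.obj (op ⊤))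
    (hσ : ∀ a, rho R (le_top : V ≤ ⊤) a = 0 → rho R (le_top : W ≤ ⊤) (σ * a) = 0) :
    Res R (h'.trans hW) M →+ Res R hW M :=
  (Res.move R hW h' (M := M)).toAddMonoidHom.liftOfSurjective (Res.move_surjective hR hW h')
    ⟨DistribSMul.toAddMonoidHom _ (rho R (le_top : W ≤ ⊤) σ), by
      intro x hx
      obtain ⟨f, hf, hfx⟩ := Res.move_eq_zero hR hW h' (show Res.move R hW h' x = 0 from hx)
      change rho R (le_top : W ≤ ⊤) σ • x = 0
      have := hσ (1 - f) (by rw [map_sub, hf, map_one, sub_self])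
      rw [mul_sub, mul_one, map_sub, map_mul, sub_eq_zero] at this
      rw [this, mul_smul, hfx, smul_zero]⟩

theorem Res.extend_move (h' : V ≤ W) (hW : W ≤ U) (σ : R.obj (op ⊤))
    (hσ : ∀ a, rho R (le_top : V ≤ ⊤) a = 0 → rho R (le_top : W ≤ ⊤) (σ * a) = 0)
    (x : Res R hW M) :
    Res.extend hR h' hW σ hσ (Res.move R hW h' x) = rho R (le_top : W ≤ ⊤) σ • x :=
  AddMonoidHom.liftOfRightInverse_comp_apply _ _ _ _ x

theorem Res.finite [Module.Finite (R.obj (op U)) M] :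
    Module.Finite (R.obj (op V)) (Res R h M) := by
  have : RingHomSurjective (rho R h) := ⟨hR.rho_surjective h⟩
  exact Module.Finite.of_surjective (Res.unit R h) (Res.unit_surjective hR h)

omit hR in
-- A free cover of M|_V is split by lifting M → M|_V over R(U), where `M` is projective, and
-- extending the lift linearly to M|_V.
theorem Res.projective [Module.Projective (R.obj (op U)) M] :
    Module.Projective (R.obj (op V)) (Res R h M) := by
  refine Module.Projective.of_lifting_property'' fun f hf => ?_
  let i1 : Module (R.obj (op U)) (Res R h M) := Module.compHom _ (rho R h)
  let i2 : Module (R.obj (op U)) (Res R h M →₀ R.obj (op V)) := Module.compHom _ (rho R h)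
  let f' : (Res R h M →₀ R.obj (op V)) →ₗ[R.obj (op U)] Res R h M :=
    { toFun := f, map_add' := f.map_add, map_smul' := fun r x => f.map_smul (rho R h r) x }
  let u' : M →ₗ[R.obj (op U)] Res R h M :=
    { toFun := Res.unit R h, map_add' := map_add _, map_smul' := LinearMap.map_smulₛₗ _ }
  obtain ⟨g, hg⟩ := Module.projective_lifting_property f' u' hf
  refine ⟨Res.lift R h { toFun := g, map_add' := map_add g, map_smul' := g.map_smul }, ?_⟩
  apply Res.hom_ext
  intro m
  simp only [LinearMap.comp_apply, Res.lift_unit, LinearMap.id_apply]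
  exact congr($hg m)

end ResVanishing

/-! ### Local properties of modules -/

section LocalToGlobal

variable {X : TopCat.{u}} {R : (Opens X)ᵒᵖ ⥤ RingCat.{u}} (hR : IsSoftPresheaf R)
  {ι : Type u} {U : ι → Opens X} (P : FinitePartition R U)

include hR in
-- If `f` is 1 on `W ⊓ O j` and kills `m`, then `μ j * (1 - f)` is zero on `W`, so `μ j • m = (μ j *
-- f) • m = 0`. Summation over j gives `m = 0`.
theorem FinitePartition.eq_zero_of_forall_mem_vanishing {W : Opens X} {M : Type*} [AddCommGroup M]
    [Module (R.obj (op W)) M] {m : M}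
    (hm : ∀ j, m ∈ vanishing hR (W ⊓ P.O j) inf_le_left M) : m = 0 := by
  have : ∀ j, rho R (le_top : W ≤ ⊤) (P.μ j) • m = 0 := by
    intro j
    obtain ⟨f, hf, hfm⟩ := hm j
    have := P.rho_μ_mul j (V := W ⊓ P.O j) (W := W) le_rfl (1 - f)
      (by rw [map_sub, hf, map_one, sub_self])
    rw [mul_sub, mul_one, map_sub, map_mul, sub_eq_zero] at this
    rw [this, mul_smul, hfm, smul_zero]
  rw [← one_smul (R.obj (op W)) m, ← map_one (rho R (le_top : W ≤ ⊤)), ← P.sum_μ, map_sum,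
    Finset.sum_smul, Finset.sum_eq_zero fun j _ => this j]

include hR in
theorem FinitePartition.eq_zero_of_forall_mem_vanishing_top {M : Type*} [AddCommGroup M]
    [Module (R.obj (op ⊤)) M] {m : M}
    (hm : ∀ j, m ∈ vanishing hR (P.O j) le_top M) : m = 0 :=
  P.eq_zero_of_forall_mem_vanishing hR fun j =>
    vanishing_anti hR le_top inf_le_right (hm j)

include hR in
-- Lifts of generators of the finitely many `N j` generate `M`, because the quotient of `M` by their
-- span vanishes on every `O j`.
theorem FinitePartition.finite_of_local (M : Type u) [AddCommGroup M] [Module (R.obj (op ⊤)) M]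
    (V : Fin P.r → Opens X) (hV : ∀ j, U (P.τ j) ≤ V j)
    (N : Fin P.r → Type u) [∀ j, AddCommGroup (N j)] [∀ j, Module (R.obj (op (V j))) (N j)]
    [∀ j, Module.Finite (R.obj (op (V j))) (N j)]
    (π : ∀ j, M →ₛₗ[rho R (le_top : V j ≤ ⊤)] N j) (hπ : ∀ j, Function.Surjective (π j))
    (hπ' : ∀ j m, π j m = 0 → m ∈ vanishing hR (V j) le_top M) :
    Module.Finite (R.obj (op ⊤)) M := by
  have hlift : ∀ j, ∃ N' : Submodule (R.obj (op ⊤)) M, N'.FG ∧ ∀ m, ∃ n ∈ N', π j n = π j m := by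
    intro j
    have : RingHomSurjective (rho R (le_top : V j ≤ ⊤)) := ⟨hR.surjective _⟩
    obtain ⟨t, ht⟩ := Module.Finite.fg_top (R := R.obj (op (V j))) (M := N j)
    refine ⟨Submodule.span _ (Function.surjInv (hπ j) '' t),
      Submodule.fg_span (t.finite_toSet.image _), fun m => ?_⟩
    have e : Submodule.map (π j) (Submodule.span _ (Function.surjInv (hπ j) '' t)) = ⊤ := by
      rw [Submodule.map_span, ← Set.image_comp, (Function.rightInverse_surjInv (hπ j)).comp_eq_id,
        Set.image_id, ht]
    exact e.ge (show π j m ∈ ⊤ from trivial)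
  choose N' hN' hN'' using hlift
  refine ⟨?_⟩
  have : (⨆ j, N' j) = ⊤ := by
    rw [eq_top_iff]
    intro m _
    rw [← Submodule.Quotient.mk_eq_zero]
    refine P.eq_zero_of_forall_mem_vanishing_top hR fun j => ?_
    obtain ⟨n, hn, hmn⟩ := hN'' j m
    have e : (Submodule.Quotient.mk m : M ⧸ ⨆ j, N' j) = (⨆ j, N' j).mkQ (m - n) := by
      rw [map_sub]
      have : (⨆ j, N' j).mkQ n = 0 := (Submodule.Quotient.mk_eq_zero _).2 (le_iSup N' j hn)
      rw [this, sub_zero]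
      rfl
    rw [e]
    apply map_mem_vanishing
    apply vanishing_anti hR le_top ((P.le j).trans (hV j))
    apply hπ'
    rw [map_sub, hmn, sub_self]
  rw [← this]
  exact Submodule.fg_iSup _ hN'

/-- Right multiplication by `χ j`, followed by extension by zero. -/
def FinitePartition.rightExtend (j : Fin P.r) {V : Opens X} (hV : U (P.τ j) ≤ V) :
    R.obj (op V) →+ R.obj (op ⊤) :=
  (rho R (le_top : V ≤ ⊤)).toAddMonoidHom.liftOfSurjective (hR.surjective V)
    ⟨AddMonoidHom.mulRight (P.χ j), fun a ha =>
      P.mul_χ j a (by rw [← rho_rho R le_top hV, show rho R (le_top : V ≤ ⊤) a = 0 from ha,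
        map_zero])⟩

theorem FinitePartition.rightExtend_rho (j : Fin P.r) {V : Opens X} (hV : U (P.τ j) ≤ V)
    (a : R.obj (op ⊤)) : P.rightExtend hR j hV (rho R le_top a) = a * P.χ j :=
  AddMonoidHom.liftOfRightInverse_comp_apply _ _ _ _ a

theorem FinitePartition.rightExtend_rho_mul (j : Fin P.r) {V : Opens X} (hV : U (P.τ j) ≤ V)
    (a : R.obj (op ⊤)) (b : R.obj (op V)) :
    P.rightExtend hR j hV (rho R le_top a * b) = a * P.rightExtend hR j hV b := by
  obtain ⟨b, rfl⟩ := hR.surjective V b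
  rw [← map_mul, rightExtend_rho, rightExtend_rho, mul_assoc]

include hR in
/-- A finitely generated module whose restrictions are projective is projective. -/
theorem FinitePartition.projective_of_local (M : Type u) [AddCommGroup M]
    [Module (R.obj (op ⊤)) M] [Module.Finite (R.obj (op ⊤)) M]
    (V : Fin P.r → Opens X) (hV : ∀ j, U (P.τ j) ≤ V j)
    (N : Fin P.r → Type u) [∀ j, AddCommGroup (N j)] [∀ j, Module (R.obj (op (V j))) (N j)]
    [∀ j, Module.Projective (R.obj (op (V j))) (N j)]
    (π : ∀ j, M →ₛₗ[rho R (le_top : V j ≤ ⊤)] N j) (hπ : ∀ j, Function.Surjective (π j))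
    (hπ' : ∀ j m, π j m = 0 → m ∈ vanishing hR (V j) le_top M) :
    Module.Projective (R.obj (op ⊤)) M := by
  obtain ⟨k, p, hp⟩ := Module.Finite.exists_fin' (R.obj (op ⊤)) M
  -- `s j` splits the free cover of `N j` induced by `p`; the second clause expresses this through
  -- global lifts `y` of the coordinates.
  have hlift : ∀ j, ∃ s : N j →ₗ[R.obj (op (V j))] (Fin k → R.obj (op (V j))),
      ∀ (m : M) (y : Fin k → R.obj (op ⊤)), (∀ i, rho R le_top (y i) = s (π j m) i) →
        π j (p y) = π j m := by
    intro j
    let q : (Fin k → R.obj (op (V j))) →ₗ[R.obj (op (V j))] N j :=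
      Fintype.linearCombination _ fun i => π j (p (Pi.single i 1))
    have hq : ∀ y : Fin k → R.obj (op ⊤), q (fun i => rho R le_top (y i)) = π j (p y) := by
      intro y
      have : p y = ∑ i, y i • p (Pi.single i 1) := by
        rw [← Fintype.linearCombination_apply]
        have : Fintype.linearCombination (R.obj (op ⊤)) (fun i => p (Pi.single i 1)) = p := by
          apply LinearMap.pi_ext'
          intro i
          ext
          simp [Fintype.linearCombination_apply_single]
        rw [this]
      rw [this, map_sum, Fintype.linearCombination_apply]
      simp only [LinearMap.map_smulₛₗ]
    have hqs : Function.Surjective q := by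
      intro n
      obtain ⟨m, rfl⟩ := hπ j n
      obtain ⟨y, rfl⟩ := hp m
      exact ⟨_, hq y⟩
    obtain ⟨s, hs⟩ := Module.projective_lifting_property q LinearMap.id hqs
    refine ⟨s, fun m y hy => ?_⟩
    rw [← hq]
    have : (fun i => rho R (le_top : V j ≤ ⊤) (y i)) = s (π j m) := funext hy
    rw [this]
    exact congr($hs (π j m))
  choose s hs using hlift
  -- Extension by zero uses right multiplication by `χ j`, which keeps `σ j` left linear.
  let σ : ∀ j, M →ₗ[R.obj (op ⊤)] (Fin k → R.obj (op ⊤)) := fun j =>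
    { toFun := fun m i => P.rightExtend hR j (hV j) (s j (π j m) i)
      map_add' := fun m m' => by
        ext i
        simp
      map_smul' := fun r m => by
        ext i
        simp only [LinearMap.map_smulₛₗ, RingHom.id_apply, Pi.smul_apply, smul_eq_mul]
        exact P.rightExtend_rho_mul hR j _ _ _ }
  let θ : Fin P.r → Module.End (R.obj (op ⊤)) M := fun j => p ∘ₗ σ j
  -- `σ j` is a section of `p` on `O j`: its coordinates differ from the global lifts `y i` by `y i
  -- * (1 - χ j)`, which restricts to zero there.
  have hθ : ∀ j m, (1 - θ j) m ∈ vanishing hR (P.O j) le_top M := by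
    intro j m
    choose y hy using fun i => hR.surjective (V j) (s j (π j m) i)
    have h1 : m - p y ∈ vanishing hR (P.O j) le_top M := by
      apply vanishing_anti hR le_top ((P.le j).trans (hV j))
      apply hπ'
      rw [map_sub, hs j m y hy, sub_self]
    have h2 : p y - θ j m ∈ vanishing hR (P.O j) le_top M := by
      change p y - p (σ j m) ∈ _
      rw [← map_sub]
      apply map_mem_vanishing
      have e : y - σ j m = ∑ i, (y i * (1 - P.χ j)) • (Pi.single i 1 : Fin k → R.obj (op ⊤)) := by
        ext i
        have : σ j m i = y i * P.χ j := by
          change P.rightExtend hR j (hV j) (s j (π j m) i) = _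
          rw [← hy, P.rightExtend_rho]
        simp [this, mul_sub, Pi.single_apply]
      rw [e]
      refine Submodule.sum_mem _ fun i _ => smul_mem_vanishing hR _ ?_ _
      rw [map_mul, map_sub, P.rho_χ, map_one, sub_self, mul_zero]
    have := Submodule.add_mem _ h1 h2
    rwa [sub_add_sub_cancel] at this
  -- The local sections are combined in the endomorphism ring: the product of the `1 - θ j` vanishes
  -- on every `O j`, hence is zero, and `∑ σ j ∘ c j` is a global section of `p`.
  obtain ⟨c, hc⟩ := sum_prod_one_sub θ
  have hprod : (List.ofFn fun j => 1 - θ j).prod = 0 := by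
    ext m
    refine P.eq_zero_of_forall_mem_vanishing_top hR fun j => ?_
    -- Factors to the left of `1 - θ j` are linear and preserve `vanishing`; those to the right only
    -- change the argument.
    have : ∀ l : List (Module.End (R.obj (op ⊤)) M), (1 - θ j) ∈ l →
        l.prod m ∈ vanishing hR (P.O j) le_top M := by
      intro l
      induction l with
      | nil => simp
      | cons a l ih =>
        intro hl
        rw [List.prod_cons, Module.End.mul_apply]
        rcases List.mem_cons.1 hl with rfl | hl
        · exact hθ j _
        · exact map_mem_vanishing hR _ a (ih hl)
    exact this _ (List.mem_ofFn.2 ⟨j, rfl⟩)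
  rw [hprod, sub_zero] at hc
  refine Module.Projective.of_split (∑ j, σ j ∘ₗ c j) p ?_
  ext m
  have := congr($hc m)
  simpa [θ] using this

end LocalToGlobal

end TwistedDescent

end

noncomputable section

namespace TwistedDescent

/-! ### Complexes of modules in terms of elements -/

section Elements

variable {A : Type u} [Ring A]

theorem d_d_apply (E : CochainComplex (ModuleCat.{u} A) ℤ) (i j k : ℤ) (x : E.X i) :
    (E.d j k).hom ((E.d i j).hom x) = 0 :=
  congr($(E.d_comp_d i j k).hom x)

theorem hom_d_apply {E F : CochainComplex (ModuleCat.{u} A) ℤ} (φ : E ⟶ F) (i j : ℤ) (x : E.X i) :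
    (φ.f j).hom ((E.d i j).hom x) = (F.d i j).hom ((φ.f i).hom x) :=
  congr($(φ.comm i j).hom x).symm

/-- Quasi-isomorphisms in terms of elements. -/
def IsQuasiIso {E F : CochainComplex (ModuleCat.{u} A) ℤ} (φ : E ⟶ F) : Prop :=
  ∀ n : ℤ,
    (∀ y : F.X (n + 1), (F.d (n + 1) (n + 1 + 1)).hom y = 0 →
      ∃ x : E.X (n + 1), (E.d (n + 1) (n + 1 + 1)).hom x = 0 ∧
        ∃ t : F.X n, y = (φ.f (n + 1)).hom x + (F.d n (n + 1)).hom t) ∧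
    (∀ x : E.X (n + 1), (E.d (n + 1) (n + 1 + 1)).hom x = 0 →
      (∃ t : F.X n, (φ.f (n + 1)).hom x = (F.d n (n + 1)).hom t) →
        ∃ t : E.X n, x = (E.d n (n + 1)).hom t)

theorem shortComplex_quasiIso_of_elements {S₁ S₂ : ShortComplex (ModuleCat.{u} A)} (φ : S₁ ⟶ S₂)
    (hsurj : ∀ y : S₂.X₂, S₂.g.hom y = 0 → ∃ x : S₁.X₂, S₁.g.hom x = 0 ∧
      ∃ t : S₂.X₁, y = φ.τ₂.hom x + S₂.f.hom t)
    (hinj : ∀ x : S₁.X₂, S₁.g.hom x = 0 → (∃ t : S₂.X₁, φ.τ₂.hom x = S₂.f.hom t) →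
      ∃ t : S₁.X₁, x = S₁.f.hom t) : ShortComplex.QuasiIso φ := by
  let h₁ := S₁.moduleCatLeftHomologyData
  let h₂ := S₂.moduleCatLeftHomologyData
  let γ : ShortComplex.LeftHomologyMapData φ h₁ h₂ := Classical.arbitrary _
  rw [γ.quasiIso_iff]
  have hK : ∀ x : LinearMap.ker S₁.g.hom, h₂.i.hom (γ.φK.hom x) = φ.τ₂.hom x.1 := fun x =>
    congr($(γ.commi).hom x)
  have hπ : ∀ x : LinearMap.ker S₁.g.hom, γ.φH.hom (h₁.π.hom x) = h₂.π.hom (γ.φK.hom x) := fun x =>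
    congr($(γ.commπ).hom x)
  rw [ConcreteCategory.isIso_iff_bijective]
  constructor
  · rw [injective_iff_map_eq_zero]
    intro x hx
    obtain ⟨x, rfl⟩ := Submodule.Quotient.mk_surjective _ x
    have h1 : h₂.π.hom (γ.φK.hom x) = 0 := (hπ x).symm.trans hx
    obtain ⟨t, ht⟩ := (Submodule.Quotient.mk_eq_zero _).1 h1
    obtain ⟨t', ht'⟩ := hinj x.1 x.2 ⟨t, (hK x).symm.trans congr(($ht).1).symm⟩
    exact (Submodule.Quotient.mk_eq_zero _).2 ⟨t', Subtype.ext ht'.symm⟩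
  · intro y
    obtain ⟨y, rfl⟩ := Submodule.Quotient.mk_surjective _ y
    obtain ⟨x, hx, t, ht⟩ := hsurj y.1 y.2
    refine ⟨h₁.π.hom (⟨x, hx⟩ : LinearMap.ker S₁.g.hom), (hπ ⟨x, hx⟩).trans ?_⟩
    refine ((Submodule.Quotient.eq _).2 ⟨-t, Subtype.ext ?_⟩)
    refine Eq.trans ?_ (congr_arg (· - y.1) (hK ⟨x, hx⟩).symm)
    rw [ht]
    change S₂.f.hom (-t) = _
    simp

theorem IsQuasiIso.quasiIso {E F : CochainComplex (ModuleCat.{u} A) ℤ} {φ : E ⟶ F}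
    (h : IsQuasiIso φ) : QuasiIso φ := by
  rw [quasiIso_iff]
  intro n
  obtain ⟨m, rfl⟩ : ∃ m, n = m + 1 := ⟨n - 1, by omega⟩
  rw [quasiIsoAt_iff' φ m (m + 1) (m + 1 + 1) (by simp) (by simp)]
  exact shortComplex_quasiIso_of_elements _ (h m).1 (h m).2

/-- The differential `(x, s) ↦ (-dx, α x + ds)` of the mapping cone. -/
def coneD {P S : CochainComplex (ModuleCat.{u} A) ℤ} (α : P ⟶ S) (n : ℤ) :
    ModuleCat.of A (P.X (n + 1) × S.X n) ⟶ ModuleCat.of A (P.X (n + 1 + 1) × S.X (n + 1)) :=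
  ModuleCat.ofHom (LinearMap.prod
    (-((P.d (n + 1) (n + 1 + 1)).hom ∘ₗ LinearMap.fst _ _ _))
    ((α.f (n + 1)).hom ∘ₗ LinearMap.fst _ _ _ + (S.d n (n + 1)).hom ∘ₗ LinearMap.snd _ _ _))

/-- The mapping cone of `α : P → S`, with terms `P^{n+1} × S^n`. -/
def cone {P S : CochainComplex (ModuleCat.{u} A) ℤ} (α : P ⟶ S) :
    CochainComplex (ModuleCat.{u} A) ℤ :=
  CochainComplex.of (fun n => ModuleCat.of A (P.X (n + 1) × S.X n)) (coneD α) (fun n => by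
    apply ModuleCat.hom_ext
    refine LinearMap.ext fun x => Prod.ext ?_ ?_
    · simp [coneD, d_d_apply]
    · simp [coneD, d_d_apply, hom_d_apply])

theorem cone_d {P S : CochainComplex (ModuleCat.{u} A) ℤ} (α : P ⟶ S) (n : ℤ) :
    (cone α).d n (n + 1) = coneD α n :=
  CochainComplex.of_d (fun n => ModuleCat.of A (P.X (n + 1) × S.X n)) (coneD α) n

namespace cone

variable {P S : CochainComplex (ModuleCat.{u} A) ℤ} (α : P ⟶ S)

/-- The projection `cone(α)^n → P^{n+1}`. -/
def fst (n : ℤ) : (cone α).X n →ₗ[A] P.X (n + 1) := LinearMap.fst A (P.X (n + 1)) (S.X n)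

/-- The projection `cone(α)^n → S^n`. -/
def snd (n : ℤ) : (cone α).X n →ₗ[A] S.X n := LinearMap.snd A (P.X (n + 1)) (S.X n)

/-- The element of the cone with the given components. -/
def mk {n : ℤ} (x : P.X (n + 1)) (s : S.X n) : (cone α).X n := (x, s)

@[simp] theorem fst_mk {n : ℤ} (x : P.X (n + 1)) (s : S.X n) : fst α n (mk α x s) = x := rfl

@[simp] theorem snd_mk {n : ℤ} (x : P.X (n + 1)) (s : S.X n) : snd α n (mk α x s) = s := rfl

variable {α} in
theorem ext {n : ℤ} {c c' : (cone α).X n} (h1 : fst α n c = fst α n c')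
    (h2 : snd α n c = snd α n c') : c = c' :=
  Prod.ext h1 h2

@[simp] theorem fst_d (n : ℤ) (c : (cone α).X n) :
    fst α (n + 1) (((cone α).d n (n + 1)).hom c) = -(P.d (n + 1) (n + 1 + 1)).hom (fst α n c) :=
  congr(fst α (n + 1) (($(cone_d α n)).hom c))

@[simp] theorem snd_d (n : ℤ) (c : (cone α).X n) :
    snd α (n + 1) (((cone α).d n (n + 1)).hom c) =
      (α.f (n + 1)).hom (fst α n c) + (S.d n (n + 1)).hom (snd α n c) :=
  congr(snd α (n + 1) (($(cone_d α n)).hom c))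

end cone

/-- The differential of `uncone φ`. -/
def unconeD {P S E : CochainComplex (ModuleCat.{u} A) ℤ} {α : P ⟶ S} (φ : E ⟶ cone α) (n : ℤ) :
    ModuleCat.of A (E.X n × P.X n) ⟶ ModuleCat.of A (E.X (n + 1) × P.X (n + 1)) :=
  ModuleCat.ofHom (LinearMap.prod
    ((E.d n (n + 1)).hom ∘ₗ LinearMap.fst _ _ _)
    ((P.d n (n + 1)).hom ∘ₗ LinearMap.snd _ _ _ -
      (cone.fst α n ∘ₗ (φ.f n).hom) ∘ₗ LinearMap.fst _ _ _))

/-- The complex `E ⊕ P`, where `φ : E → cone (P → S)`, with differential twisted by the component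
`E^n → P^{n+1}`. -/
def uncone {P S E : CochainComplex (ModuleCat.{u} A) ℤ} {α : P ⟶ S} (φ : E ⟶ cone α) :
    CochainComplex (ModuleCat.{u} A) ℤ :=
  CochainComplex.of (fun n => ModuleCat.of A (E.X n × P.X n)) (unconeD φ) (fun n => by
    apply ModuleCat.hom_ext
    refine LinearMap.ext fun x => Prod.ext ?_ ?_
    · simp [unconeD, d_d_apply]
    · simp [unconeD, d_d_apply, hom_d_apply])

theorem uncone_d {P S E : CochainComplex (ModuleCat.{u} A) ℤ} {α : P ⟶ S} (φ : E ⟶ cone α)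
    (n : ℤ) : (uncone φ).d n (n + 1) = unconeD φ n :=
  CochainComplex.of_d (fun n => ModuleCat.of A (E.X n × P.X n)) (unconeD φ) n

namespace uncone

variable {P S E : CochainComplex (ModuleCat.{u} A) ℤ} {α : P ⟶ S} (φ : E ⟶ cone α)

/-- The projection to `E`. -/
def fst (n : ℤ) : (uncone φ).X n →ₗ[A] E.X n := LinearMap.fst A (E.X n) (P.X n)

/-- The projection to `P`. -/
def snd (n : ℤ) : (uncone φ).X n →ₗ[A] P.X n := LinearMap.snd A (E.X n) (P.X n)

/-- The element with the given components. -/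
def mk {n : ℤ} (e : E.X n) (x : P.X n) : (uncone φ).X n := (e, x)

@[simp] theorem fst_mk {n : ℤ} (e : E.X n) (x : P.X n) : fst φ n (mk φ e x) = e := rfl

@[simp] theorem snd_mk {n : ℤ} (e : E.X n) (x : P.X n) : snd φ n (mk φ e x) = x := rfl

variable {φ} in
theorem ext {n : ℤ} {c c' : (uncone φ).X n} (h1 : fst φ n c = fst φ n c')
    (h2 : snd φ n c = snd φ n c') : c = c' :=
  Prod.ext h1 h2

@[simp] theorem fst_d (n : ℤ) (c : (uncone φ).X n) :
    fst φ (n + 1) (((uncone φ).d n (n + 1)).hom c) = (E.d n (n + 1)).hom (fst φ n c) :=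
  congr(fst φ (n + 1) (($(uncone_d φ n)).hom c))

@[simp] theorem snd_d (n : ℤ) (c : (uncone φ).X n) :
    snd φ (n + 1) (((uncone φ).d n (n + 1)).hom c) =
      (P.d n (n + 1)).hom (snd φ n c) - cone.fst α n ((φ.f n).hom (fst φ n c)) :=
  congr(snd φ (n + 1) (($(uncone_d φ n)).hom c))

/-- The map `E ⊕ P → S` induced by `E → cone (P → S)`. -/
def hom : uncone φ ⟶ S where
  f n := ModuleCat.ofHom ((cone.snd α n ∘ₗ (φ.f n).hom) ∘ₗ fst φ n + (α.f n).hom ∘ₗ snd φ n)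
  comm' i j hij := by
    obtain rfl : i + 1 = j := hij
    apply ModuleCat.hom_ext
    refine LinearMap.ext fun c => ?_
    change (S.d i (i + 1)).hom (cone.snd α i ((φ.f i).hom (fst φ i c)) +
        (α.f i).hom (snd φ i c)) =
      cone.snd α (i + 1) ((φ.f (i + 1)).hom (fst φ (i + 1) (((uncone φ).d i (i + 1)).hom c))) +
        (α.f (i + 1)).hom (snd φ (i + 1) (((uncone φ).d i (i + 1)).hom c))
    rw [fst_d, snd_d, hom_d_apply, cone.snd_d, map_sub, hom_d_apply, map_add]
    abel

@[simp] theorem hom_f_apply (n : ℤ) (c : (uncone φ).X n) :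
    ((hom φ).f n).hom c =
      cone.snd α n ((φ.f n).hom (fst φ n c)) + (α.f n).hom (snd φ n c) := rfl

variable {φ}

/-- Up to a shift, `uncone φ` is the cone of E → cone(α) → P[1]. Comparison with the triangle P → S
→ cone(α) gives the claim by the five lemma, chased here on elements. -/
theorem isQuasiIso_hom (hφ : IsQuasiIso φ) : IsQuasiIso (hom φ) := by
  intro n
  constructor
  · intro s hs
    obtain ⟨e, he, c, hc⟩ := (hφ n).1 (cone.mk α 0 s) (cone.ext (by simp) (by simp [hs]))
    have h1 := congr(cone.fst α _ $hc)
    have h2 := congr(cone.snd α _ $hc)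
    simp only [cone.fst_mk, cone.snd_mk, map_add, cone.fst_d, cone.snd_d] at h1 h2
    refine ⟨mk φ e (cone.fst α n c), ext (by simp [he]) ?_, cone.snd α n c, ?_⟩
    · rw [eq_comm, ← sub_eq_add_neg, sub_eq_zero] at h1
      simp [h1]
    · simp [h2, add_assoc]
  · rintro c hc ⟨t, ht⟩
    have h1 := congr(fst φ _ $hc)
    have h2 := congr(snd φ _ $hc)
    simp only [fst_d, snd_d, map_zero, hom_f_apply] at h1 h2 ht
    obtain ⟨e', he'⟩ := (hφ n).2 (fst φ _ c) h1 ⟨cone.mk α (-snd φ _ c) t, cone.ext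
      (by simp [sub_eq_zero.1 h2]) (by simp [← ht])⟩
    obtain ⟨m, rfl⟩ : ∃ m, n = m + 1 := ⟨n - 1, by omega⟩
    -- `e'` bounds the E-component of `c`, but `φ e'` differs from the given primitive in the cone
    -- by a cycle. Surjectivity one degree lower provides a cycle `e''` of E that absorbs its class.
    obtain ⟨e'', he'', c', hc'⟩ := (hφ m).1 ((φ.f (m + 1)).hom e' - cone.mk α (-snd φ _ c) t) (by
      rw [map_sub, ← hom_d_apply, ← he', sub_eq_zero]
      exact cone.ext (by simp [sub_eq_zero.1 h2]) (by simp [← ht]))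
    have h4 := congr(cone.fst α _ $hc')
    simp only [cone.fst_mk, map_add, map_sub, cone.fst_d] at h4
    refine ⟨mk φ (e' - e'') (-cone.fst α _ c'), ext ?_ ?_⟩
    · simp [he', he'']
    · simp only [snd_d, snd_mk, fst_mk, map_sub, map_neg]
      rw [sub_neg_eq_add, ← eq_sub_iff_add_eq'] at h4
      rw [h4]
      abel

end uncone

end Elements

end TwistedDescent

end

noncomputable section

namespace TwistedDescent

/-! ### Cohomology modules and perfect complexes -/

section Cohomology

variable {A : Type u} [Ring A]

/-- The cycles of degree `n + 1`. -/
abbrev cycles (E : CochainComplex (ModuleCat.{u} A) ℤ) (n : ℤ) : Submodule A (E.X (n + 1)) :=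
  LinearMap.ker (E.d (n + 1) (n + 1 + 1)).hom

/-- The cohomology module of degree `n + 1`. -/
abbrev Cohomology (E : CochainComplex (ModuleCat.{u} A) ℤ) (n : ℤ) : Type u :=
  cycles E n ⧸ (LinearMap.range (E.d n (n + 1)).hom).submoduleOf (cycles E n)

/-- Exactness in degree `n + 1`. -/
def IsExactAt (E : CochainComplex (ModuleCat.{u} A) ℤ) (n : ℤ) : Prop :=
  ∀ x : E.X (n + 1), (E.d (n + 1) (n + 1 + 1)).hom x = 0 → ∃ t, x = (E.d n (n + 1)).hom t

theorem finite_projective_ker {M N : Type u} [AddCommGroup M] [Module A M] [AddCommGroup N]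
    [Module A N] [Module.Finite A M] [Module.Projective A M] [Module.Projective A N]
    (f : M →ₗ[A] N) (hf : Function.Surjective f) :
    Module.Finite A (LinearMap.ker f) ∧ Module.Projective A (LinearMap.ker f) := by
  obtain ⟨s, hs⟩ := Module.projective_lifting_property f LinearMap.id hf
  have hs' : ∀ x, f (s x) = x := fun x => congr($hs x)
  let p : M →ₗ[A] LinearMap.ker f := LinearMap.codRestrict _ (LinearMap.id - s ∘ₗ f) fun x => by
    simp [hs']
  have hp : p ∘ₗ (LinearMap.ker f).subtype = LinearMap.id := by
    ext x
    have : f x = 0 := x.2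
    simp [p, this]
  exact ⟨Module.Finite.of_surjective p fun x => ⟨x, congr($hp x)⟩, Module.Projective.of_split _ _ hp⟩

/-- Descending induction from the degrees where the complex is zero: by exactness the differential
maps onto the next module of cycles, which is projective, so its kernel is a direct summand. -/
theorem finite_projective_cycles (E : CochainComplex (ModuleCat.{u} A) ℤ) (b : ℤ)
    (hb : ∀ n, b < n → Subsingleton (E.X n))
    (hE : ∀ n, Module.Finite A (E.X n) ∧ Module.Projective A (E.X n)) (n : ℤ)
    (hn : ∀ m, n < m → IsExactAt E m) :
    Module.Finite A (cycles E n) ∧ Module.Projective A (cycles E n) := by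
  obtain ⟨k, hk⟩ : ∃ k : ℕ, b < n + 1 + k := ⟨(b - n).toNat, by omega⟩
  induction k generalizing n with
  | zero =>
    have := hb (n + 1) (by simpa using hk)
    constructor <;> infer_instance
  | succ k ih =>
    have h := ih (n + 1) (fun m hm => hn m (by omega)) (by push_cast at hk; omega)
    have := h.2
    have h1 := (hE (n + 1)).1
    have h2 := (hE (n + 1)).2
    let f : E.X (n + 1) →ₗ[A] cycles E (n + 1) :=
      LinearMap.codRestrict _ (E.d (n + 1) (n + 1 + 1)).hom fun x => d_d_apply E _ _ _ x
    have hf : LinearMap.ker f = cycles E n := LinearMap.ker_codRestrict _ _ _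
    rw [← hf]
    refine finite_projective_ker f fun x => ?_
    obtain ⟨t, ht⟩ := hn (n + 1) (by omega) x.1 x.2
    exact ⟨t, Subtype.ext ht.symm⟩

/-- The submodule of `N` which is everything for `m = n`, and zero otherwise. -/
def concentratedTerm (N : Type u) [AddCommGroup N] [Module A N] (n m : ℤ) : Submodule A N :=
  if m = n then ⊤ else ⊥

theorem concentratedTerm_self (N : Type u) [AddCommGroup N] [Module A N] (n : ℤ) :
    concentratedTerm (A := A) N n n = ⊤ := if_pos rfl

theorem concentratedTerm_of_ne (N : Type u) [AddCommGroup N] [Module A N] {n m : ℤ} (h : m ≠ n) :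
    concentratedTerm (A := A) N n m = ⊥ := if_neg h

variable (A) in
/-- The complex with the module `N` in degree `n`. -/
def concentrated (N : Type u) [AddCommGroup N] [Module A N] (n : ℤ) :
    CochainComplex (ModuleCat.{u} A) ℤ where
  X m := ModuleCat.of A (concentratedTerm (A := A) N n m)
  d _ _ := 0

theorem subsingleton_concentrated (N : Type u) [AddCommGroup N] [Module A N] {n m : ℤ}
    (h : m ≠ n) : Subsingleton ((concentrated A N n).X m) := by
  change Subsingleton (concentratedTerm (A := A) N n m)
  rw [concentratedTerm_of_ne N h]
  infer_instance

theorem finite_projective_concentrated (N : Type u) [AddCommGroup N] [Module A N]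
    [Module.Finite A N] [Module.Projective A N] (n m : ℤ) :
    Module.Finite A ((concentrated A N n).X m) ∧
      Module.Projective A ((concentrated A N n).X m) := by
  change Module.Finite A (concentratedTerm (A := A) N n m) ∧
    Module.Projective A (concentratedTerm (A := A) N n m)
  by_cases h : m = n
  · subst h
    rw [concentratedTerm_self]
    exact ⟨Module.Finite.equiv Submodule.topEquiv.symm,
      Module.Projective.of_equiv Submodule.topEquiv.symm⟩
  · rw [concentratedTerm_of_ne N h]
    constructor <;> infer_instance

/-- An element of `N`, in degree `n`. -/
def concentratedMk (N : Type u) [AddCommGroup N] [Module A N] (n : ℤ) (x : N) :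
    (concentrated A N n).X n :=
  (⟨x, by rw [concentratedTerm_self]; trivial⟩ : concentratedTerm (A := A) N n n)

theorem concentratedMk_surjective (N : Type u) [AddCommGroup N] [Module A N] (n : ℤ) :
    Function.Surjective (concentratedMk (A := A) N n) := fun x => ⟨x.1, rfl⟩

/-- The map from a concentrated complex induced by a map from `N` to the cycles of degree `n`. -/
def concentratedHom {N : Type u} [AddCommGroup N] [Module A N]
    {S : CochainComplex (ModuleCat.{u} A) ℤ} {n : ℤ} (α : N →ₗ[A] S.X n)
    (hα : ∀ x, (S.d n (n + 1)).hom (α x) = 0) : concentrated A N n ⟶ S where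
  f m := if h : m = n then
      ModuleCat.ofHom (α ∘ₗ Submodule.subtype _) ≫ (S.XIsoOfEq h.symm).hom
    else 0
  comm' i j hij := by
    obtain rfl : i + 1 = j := hij
    by_cases h : i = n
    · subst h
      apply ModuleCat.hom_ext
      refine LinearMap.ext fun x => ?_
      rw [dif_pos rfl]
      have : (concentrated A N i).d i (i + 1) = 0 := rfl
      simp only [this, HomologicalComplex.XIsoOfEq_rfl, Iso.refl_hom, Limits.zero_comp]
      exact hα _
    · rw [dif_neg h, Limits.zero_comp]
      have : (concentrated A N n).d i (i + 1) = 0 := rfl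
      rw [this, Limits.zero_comp]

theorem concentratedHom_mk {N : Type u} [AddCommGroup N] [Module A N]
    {S : CochainComplex (ModuleCat.{u} A) ℤ} {n : ℤ} (α : N →ₗ[A] S.X n)
    (hα : ∀ x, (S.d n (n + 1)).hom (α x) = 0) (x : N) :
    ((concentratedHom α hα).f n).hom (concentratedMk N n x) = α x := by
  have : (concentratedHom α hα).f n = ModuleCat.ofHom (α ∘ₗ Submodule.subtype _) := by
    simp only [concentratedHom, dite_true]
    exact Category.comp_id _
  rw [this]
  rfl

/-- The cone of a map from a concentrated complex onto the top cohomology. -/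
theorem isExactAt_cone_concentratedHom {N : Type u} [AddCommGroup N] [Module A N]
    {S : CochainComplex (ModuleCat.{u} A) ℤ} {n : ℤ} (α : N →ₗ[A] S.X (n + 1))
    (hα : ∀ x, (S.d (n + 1) (n + 1 + 1)).hom (α x) = 0)
    (hsurj : ∀ s, (S.d (n + 1) (n + 1 + 1)).hom s = 0 → ∃ x t, s = α x + (S.d n (n + 1)).hom t)
    (hS : ∀ m, n < m → IsExactAt S m) (m : ℤ) (hm : n ≤ m) :
    IsExactAt (cone (concentratedHom α hα)) m := by
  intro c hc
  have h2 := congr(cone.snd _ _ $hc)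
  have := subsingleton_concentrated (A := A) N (n := n + 1) (m := m + 1 + 1) (by omega)
  have h1 : cone.fst (concentratedHom α hα) (m + 1) c = 0 := Subsingleton.elim _ _
  rw [cone.snd_d, h1, map_zero, zero_add, map_zero] at h2
  rcases hm.lt_or_eq with hm | rfl
  · obtain ⟨t, ht⟩ := hS m hm _ h2
    refine ⟨cone.mk _ 0 t, cone.ext (Subsingleton.elim _ _) ?_⟩
    simp [ht]
  · obtain ⟨x, t, ht⟩ := hsurj _ h2
    refine ⟨cone.mk _ (concentratedMk N _ x) t, cone.ext (Subsingleton.elim _ _) ?_⟩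
    simp [ht, concentratedHom_mk]

end Cohomology

/-! ### Local models of complexes -/

section LocalModels

variable {X : TopCat.{u}} {R : (Opens X)ᵒᵖ ⥤ RingCat.{u}}

/-- A semilinear chain map from a complex of `R(X)`-modules to a complex of `R(V)`-modules which
becomes a quasi-isomorphism after restriction to `V`. -/
structure IsLocalModel {V : Opens X} {S : Cpx R ⊤} {P : Cpx R V}
    (π : ∀ n, S.X n →ₛₗ[rho R (le_top : V ≤ ⊤)] P.X n) : Prop where
  comm (n : ℤ) (x : S.X n) :
    π (n + 1) ((S.d n (n + 1)).hom x) = (P.d n (n + 1)).hom (π n x)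
  surj (n : ℤ) (z : P.X (n + 1)) (hz : (P.d (n + 1) (n + 1 + 1)).hom z = 0) :
    ∃ c, (S.d (n + 1) (n + 1 + 1)).hom c = 0 ∧ ∃ w, π (n + 1) c = z + (P.d n (n + 1)).hom w
  inj (n : ℤ) (c : S.X (n + 1)) (hc : (S.d (n + 1) (n + 1 + 1)).hom c = 0) (w : P.X n)
    (hw : π (n + 1) c = (P.d n (n + 1)).hom w) :
    ∃ f : R.obj (op ⊤), rho R (le_top : V ≤ ⊤) f = 1 ∧ ∃ t, f • c = (S.d n (n + 1)).hom t

theorem resCpx_d_unit {U V : Opens X} (h : V ≤ U) (E : Cpx R U) (i j : ℤ) (x : E.X i) :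
    ((resCpx h E).d i j).hom (Res.unit R h x) = Res.unit R h ((E.d i j).hom x) :=
  Res.map_unit R h _ x

/-- A relation over V holds globally after multiplication by some f that is 1 on V. The differential
is linear, and restrictions to V do not notice f, so restriction commutes with cohomology. -/
theorem isLocalModel_unit (hR : IsSoftPresheaf R) (Q : Cpx R ⊤) (V : Opens X) :
    IsLocalModel (P := resCpx (le_top : V ≤ ⊤) Q)
      (fun n => Res.unit R (le_top : V ≤ ⊤) (M := Q.X n)) where
  comm n x := (resCpx_d_unit _ _ _ _ _).symm
  surj n z hz := by
    obtain ⟨q, rfl⟩ := Res.unit_surjective hR (le_top : V ≤ ⊤) z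
    obtain ⟨f, hf, hfq⟩ := (Res.unit_eq_zero_iff hR (le_top : V ≤ ⊤) _).1
      ((resCpx_d_unit _ _ _ _ q).symm.trans hz)
    rw [rho_self] at hfq
    have e : Res.unit R (le_top : V ≤ ⊤) (f • q) = Res.unit R (le_top : V ≤ ⊤) q := by
      rw [LinearMap.map_smulₛₗ, hf, one_smul]
    refine ⟨f • q, by rw [map_smul, hfq], 0, e.trans ?_⟩
    rw [map_zero]
    exact (add_zero _).symm
  inj n c hc w hw := by
    obtain ⟨q, rfl⟩ := Res.unit_surjective hR (le_top : V ≤ ⊤) w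
    obtain ⟨f, hf, hfq⟩ := (Res.unit_eq_unit_iff hR (le_top : V ≤ ⊤) _ _).1
      (hw.trans (resCpx_d_unit _ _ _ _ q))
    rw [rho_self, smul_sub, sub_eq_zero, ← map_smul] at hfq
    exact ⟨f, hf, _, hfq⟩

section Cone

variable {V : Opens X} {Q S : Cpx R ⊤} {Q' P : Cpx R V}
  (η : ∀ n, Q.X n →ₛₗ[rho R (le_top : V ≤ ⊤)] Q'.X n)
  (π : ∀ n, S.X n →ₛₗ[rho R (le_top : V ≤ ⊤)] P.X n) (α : Q ⟶ S) (β : Q' ⟶ P)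

/-- The map of cones induced by a commutative square. -/
def coneMap (n : ℤ) : (cone α).X n →ₛₗ[rho R (le_top : V ≤ ⊤)] (cone β).X n where
  toFun c := cone.mk β (η (n + 1) (cone.fst α n c)) (π n (cone.snd α n c))
  map_add' c c' := cone.ext (by simp) (by simp)
  map_smul' r c := cone.ext (by simp [LinearMap.map_smulₛₗ]) (by simp [LinearMap.map_smulₛₗ])

@[simp] theorem fst_coneMap (n : ℤ) (c : (cone α).X n) :
    cone.fst β n (coneMap η π α β n c) = η (n + 1) (cone.fst α n c) := rfl

@[simp] theorem snd_coneMap (n : ℤ) (c : (cone α).X n) :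
    cone.snd β n (coneMap η π α β n c) = π n (cone.snd α n c) := rfl

variable {η π}

/-- The five lemma up to cutoffs: each use of `inj` costs a factor that is 1 on V, which is
invisible after restriction, and such factors can be multiplied. -/
theorem IsLocalModel.cone (hη : IsLocalModel η) (hπ : IsLocalModel π)
    (hβ : ∀ n x, (β.f n).hom (η n x) = π n ((α.f n).hom x)) :
    IsLocalModel (coneMap η π α β) where
  comm n c := cone.ext (by simp [hη.comm]) (by simp [hπ.comm, hβ])
  surj n z hz := by
    have h1 := congr(cone.fst _ _ $hz)
    have h2 := congr(cone.snd _ _ $hz)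
    simp only [cone.fst_d, cone.snd_d, map_zero, neg_eq_zero] at h1 h2
    obtain ⟨c, hc, q, hq⟩ := hη.surj _ _ h1
    -- The cycle condition for `z` makes `α c` a boundary over V, hence `f • α c = d t`. Then `f •
    -- c` still restricts like `c`, and the S-component corrected by `t` and `q` is a cycle, to be
    -- lifted by `c'`.
    obtain ⟨f, hf, t, ht⟩ := hπ.inj (n + 1) ((α.f _).hom c) (by rw [← hom_d_apply, hc, map_zero])
      (-cone.snd _ _ z + (β.f _).hom q) (by
        rw [← hβ, hq, map_add, map_add, map_neg, hom_d_apply, eq_neg_of_add_eq_zero_left h2])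
    have hfc : η _ (f • c) = η _ c := by rw [LinearMap.map_smulₛₗ, hf, one_smul]
    obtain ⟨c', hc', y, hy⟩ := hπ.surj n (cone.snd _ _ z + π _ t - (β.f _).hom q) (by
      rw [map_sub, map_add, ← hπ.comm, ← ht, map_smulₛₗ, hf, one_smul, ← hβ, hq, map_add,
        hom_d_apply]
      rw [← hom_d_apply, ← h2]
      abel)
    refine ⟨cone.mk α (f • c) (c' - t), cone.ext ?_ ?_, cone.mk β (-q) y, cone.ext ?_ ?_⟩
    · simp [hc]
    · simp [hc', ht]
    · simp only [fst_coneMap, cone.fst_mk, hfc, hq, map_add, cone.fst_d, map_neg, neg_neg]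
    · simp only [snd_coneMap, cone.snd_mk, map_add, cone.snd_d, map_sub, hy, cone.fst_mk, map_neg]
      abel
  inj n c hc w hw := by
    obtain ⟨m, rfl⟩ : ∃ m, n = m + 1 := ⟨n - 1, by omega⟩
    have h1 := congr(cone.fst _ _ $hc)
    have h2 := congr(cone.snd _ _ $hc)
    have h3 := congr(cone.fst _ _ $hw)
    have h4 := congr(cone.snd _ _ $hw)
    simp only [cone.fst_d, cone.snd_d, map_zero, neg_eq_zero, fst_coneMap, snd_coneMap] at h1 h2 h3 h4
    obtain ⟨f, hf, c', hc'⟩ := hη.inj _ _ h1 (-cone.fst _ _ w) (by rw [h3, map_neg])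
    -- Over V the primitives `c'` and `-w₁`, with `w₁` the first component of `w`, bound the same
    -- element. Their difference is a cycle, and subtracting a global cycle `c''` makes `c' - c''`
    -- restrict to `-w₁` up to a boundary.
    obtain ⟨c'', hc'', q, hq⟩ := hη.surj _ (η _ c' + cone.fst _ _ w) (by
      rw [map_add, ← hη.comm, ← hc', map_smulₛₗ, hf, one_smul, h3, neg_add_cancel])
    obtain ⟨g, hg, t, ht⟩ := hπ.inj _ (f • cone.snd _ _ c + (α.f _).hom (c' - c'')) (by
      rw [map_add, map_smul, ← hom_d_apply, map_sub, hc'', sub_zero, ← hc', map_smul, ← smul_add]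
      exact (congr_arg (f • ·) ((add_comm _ _).trans h2)).trans (smul_zero f))
      (cone.snd _ _ w - (β.f _).hom q) (by
      rw [map_add, map_smulₛₗ, hf, one_smul, h4, ← hβ, map_sub (η _), hq, map_sub, map_add, map_add,
        map_sub, hom_d_apply]
      abel)
    refine ⟨g * f, by rw [map_mul, hf, hg, mul_one], cone.mk α (-(g • (c' - c''))) t,
      cone.ext ?_ ?_⟩
    · simp only [map_smul, cone.fst_d, cone.fst_mk, map_neg, map_sub, hc'', sub_zero, neg_neg,
        mul_smul, hc']
    · simp only [map_smul, cone.snd_d, cone.fst_mk, cone.snd_mk, map_neg, ← ht, mul_smul, smul_add]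
      abel

end Cone

/-- The linear extension `Q|_V → P` of a semilinear chain map `Q → S → P`. -/
def extendHom {V : Opens X} {Q S : Cpx R ⊤} {P : Cpx R V}
    {π : ∀ n, S.X n →ₛₗ[rho R (le_top : V ≤ ⊤)] P.X n} (hπ : IsLocalModel π) (α : Q ⟶ S) :
    resCpx (le_top : V ≤ ⊤) Q ⟶ P where
  f n := ModuleCat.ofHom (Res.lift R le_top ((π n).comp (α.f n).hom))
  comm' i j hij := by
    obtain rfl : i + 1 = j := hij
    apply ModuleCat.hom_ext
    apply Res.hom_ext
    intro x
    have h1 := resCpx_d_unit (le_top : V ≤ ⊤) Q i (i + 1) x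
    have h2 := Res.lift_unit R (le_top : V ≤ ⊤) ((π i).comp (α.f i).hom) x
    have h3 := Res.lift_unit R (le_top : V ≤ ⊤) ((π (i + 1)).comp (α.f (i + 1)).hom)
      ((Q.d i (i + 1)).hom x)
    refine (congr_arg (P.d i (i + 1)).hom h2).trans (Eq.trans ?_
      ((congr_arg (Res.lift R (le_top : V ≤ ⊤) ((π (i + 1)).comp (α.f (i + 1)).hom)) h1).trans
        h3).symm)
    simp [hom_d_apply, hπ.comm]

theorem extendHom_unit {V : Opens X} {Q S : Cpx R ⊤} {P : Cpx R V}
    {π : ∀ n, S.X n →ₛₗ[rho R (le_top : V ≤ ⊤)] P.X n} (hπ : IsLocalModel π) (α : Q ⟶ S) (n : ℤ)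
    (x : Q.X n) :
    ((extendHom hπ α).f n).hom (Res.unit R (le_top : V ≤ ⊤) x) = π n ((α.f n).hom x) :=
  Res.lift_unit R (le_top : V ≤ ⊤) ((π n).comp (α.f n).hom) x

/-- The map on cohomology induced by a local model. -/
def IsLocalModel.map {V : Opens X} {S : Cpx R ⊤} {P : Cpx R V}
    {π : ∀ n, S.X n →ₛₗ[rho R (le_top : V ≤ ⊤)] P.X n} (hπ : IsLocalModel π) (n : ℤ) :
    Cohomology S n →ₛₗ[rho R (le_top : V ≤ ⊤)] Cohomology P n :=
  Submodule.mapQ _ _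
    (LinearMap.codRestrict (cycles P n) ((π (n + 1)).comp (cycles S n).subtype) fun c => by
      have : (S.d (n + 1) (n + 1 + 1)).hom c.1 = 0 := c.2
      simp [← hπ.comm, this]) (by
    rintro ⟨c, hc⟩ ⟨t, ht⟩
    exact ⟨π n t, (hπ.comm n t).symm.trans (congr_arg _ ht)⟩)

theorem IsLocalModel.map_surjective {V : Opens X} {S : Cpx R ⊤} {P : Cpx R V}
    {π : ∀ n, S.X n →ₛₗ[rho R (le_top : V ≤ ⊤)] P.X n} (hπ : IsLocalModel π) (n : ℤ) :
    Function.Surjective (hπ.map n) := by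
  intro z
  obtain ⟨⟨z, hz⟩, rfl⟩ := Submodule.Quotient.mk_surjective _ z
  obtain ⟨c, hc, w, hw⟩ := hπ.surj n z hz
  refine ⟨Submodule.Quotient.mk ⟨c, hc⟩, (Submodule.Quotient.eq _).2 ⟨w, ?_⟩⟩
  change _ = π (n + 1) c - z
  rw [hw, add_sub_cancel_left]

theorem IsLocalModel.mem_vanishing_of_map_eq_zero (hR : IsSoftPresheaf R) {V : Opens X}
    {S : Cpx R ⊤} {P : Cpx R V}
    {π : ∀ n, S.X n →ₛₗ[rho R (le_top : V ≤ ⊤)] P.X n} (hπ : IsLocalModel π) (n : ℤ)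
    (c : Cohomology S n) (hc : hπ.map n c = 0) : c ∈ vanishing hR V le_top (Cohomology S n) := by
  obtain ⟨⟨c, hc'⟩, rfl⟩ := Submodule.Quotient.mk_surjective _ c
  obtain ⟨w, hw⟩ := (Submodule.Quotient.mk_eq_zero _).1 hc
  obtain ⟨f, hf, t, ht⟩ := hπ.inj n c hc' w hw.symm
  refine ⟨f, hf, ?_⟩
  rw [rho_self, ← Submodule.Quotient.mk_smul, Submodule.Quotient.mk_eq_zero]
  exact ⟨t, ht.symm⟩

theorem isExactAt_iff_subsingleton {A : Type u} [Ring A]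
    (E : CochainComplex (ModuleCat.{u} A) ℤ) (n : ℤ) :
    IsExactAt E n ↔ Subsingleton (Cohomology E n) := by
  rw [Submodule.Quotient.subsingleton_iff]
  constructor
  · intro h
    rw [eq_top_iff]
    rintro ⟨x, hx⟩ _
    obtain ⟨t, ht⟩ := h x hx
    exact ⟨t, ht.symm⟩
  · intro h x hx
    obtain ⟨t, ht⟩ := h.ge (show (⟨x, hx⟩ : cycles E n) ∈ ⊤ from trivial)
    exact ⟨t, ht.symm⟩

end LocalModels

end TwistedDescent

end

noncomputable section

namespace TwistedDescent

/-! ### Strictly perfect complexes from local models -/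

section Perfect

variable {X : TopCat.{u}} {R : (Opens X)ᵒᵖ ⥤ RingCat.{u}} (hR : IsSoftPresheaf R)
  {ι : Type u} {U : ι → Opens X} (P : FinitePartition R U)
  {V : Fin P.r → Opens X} (hV : ∀ j, U (P.τ j) ≤ V j)

theorem IsStrictlyPerfect.cone {W : Opens X} {E F : Cpx R W} (hE : IsStrictlyPerfect E)
    (hF : IsStrictlyPerfect F) (α : E ⟶ F) : IsStrictlyPerfect (cone α) := by
  obtain ⟨⟨a, b, h⟩, hE⟩ := hE
  obtain ⟨⟨a', b', h'⟩, hF⟩ := hF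
  refine ⟨⟨min (a - 1) a', max b b', fun n hn => ?_⟩, fun n => ?_⟩
  · have h1 := h (n + 1) (by omega)
    have h2 := h' n (by omega)
    exact inferInstanceAs (Subsingleton (E.X (n + 1) × F.X n))
  · have h1 := hE (n + 1)
    have h2 := hF n
    have := h1.1
    have := h1.2
    have := h2.1
    have := h2.2
    exact ⟨inferInstanceAs (Module.Finite _ (E.X (n + 1) × F.X n)),
      inferInstanceAs (Module.Projective _ (E.X (n + 1) × F.X n))⟩

theorem IsStrictlyPerfect.uncone {W : Opens X} {Q S E : Cpx R W} (hQ : IsStrictlyPerfect Q)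
    (hE : IsStrictlyPerfect E) {α : Q ⟶ S} (φ : E ⟶ TwistedDescent.cone α) :
    IsStrictlyPerfect (uncone φ) := by
  obtain ⟨⟨a, b, h⟩, hE⟩ := hE
  obtain ⟨⟨a', b', h'⟩, hQ⟩ := hQ
  refine ⟨⟨min a a', max b b', fun n hn => ?_⟩, fun n => ?_⟩
  · have h1 := h n (by omega)
    have h2 := h' n (by omega)
    exact inferInstanceAs (Subsingleton (E.X n × Q.X n))
  · have h1 := hE n
    have h2 := hQ n
    have := h1.1
    have := h1.2
    have := h2.1
    have := h2.2
    exact ⟨inferInstanceAs (Module.Finite _ (E.X n × Q.X n)),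
      inferInstanceAs (Module.Projective _ (E.X n × Q.X n))⟩

theorem IsStrictlyPerfect.resCpx (hR : IsSoftPresheaf R) {W W' : Opens X} (h : W' ≤ W)
    {E : Cpx R W} (hE : IsStrictlyPerfect E) : IsStrictlyPerfect (resCpx h E) := by
  obtain ⟨⟨a, b, hab⟩, hE⟩ := hE
  refine ⟨⟨a, b, fun n hn => ⟨fun x y => ?_⟩⟩, fun n => ?_⟩
  · obtain ⟨x, rfl⟩ := Res.unit_surjective hR h x
    obtain ⟨y, rfl⟩ := Res.unit_surjective hR h y
    have := hab n hn
    rw [Subsingleton.elim x y]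
  · have := (hE n).1
    have := (hE n).2
    exact ⟨Res.finite hR h (M := E.X n), Res.projective h (M := E.X n)⟩

theorem isStrictlyPerfect_concentrated {W : Opens X} (N : Type u) [AddCommGroup N]
    [Module (R.obj (op W)) N] [Module.Finite (R.obj (op W)) N] [Module.Projective (R.obj (op W)) N]
    (n : ℤ) : IsStrictlyPerfect (R := R) (U := W) (concentrated (R.obj (op W)) N n) :=
  ⟨⟨n, n, fun m hm => subsingleton_concentrated N (by omega)⟩,
    fun m => finite_projective_concentrated N n m⟩

variable {S : Cpx R ⊤} {M : ∀ j, Cpx R (V j)}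
  {π : ∀ j n, S.X n →ₛₗ[rho R (le_top : V j ≤ ⊤)] (M j).X n}

include hR hV in
theorem isExactAt_of_local (hπ : ∀ j, IsLocalModel (π j)) (n : ℤ)
    (h : ∀ j, IsExactAt (M j) n) : IsExactAt S n := by
  rw [isExactAt_iff_subsingleton]
  have h' := fun j => (isExactAt_iff_subsingleton _ _).1 (h j)
  refine subsingleton_of_forall_eq 0 fun c => P.eq_zero_of_forall_mem_vanishing_top hR fun j => ?_
  apply vanishing_anti hR le_top ((P.le j).trans (hV j))
  exact (hπ j).mem_vanishing_of_map_eq_zero hR n c ((h' j).elim _ _)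

theorem isExactAt_of_isLocalModel {W : Opens X} {M : Cpx R W}
    {π : ∀ n, S.X n →ₛₗ[rho R (le_top : W ≤ ⊤)] M.X n} (hπ : IsLocalModel π) {n : ℤ}
    (h : IsExactAt S n) : IsExactAt M n := by
  intro z hz
  obtain ⟨c, hc, w, hw⟩ := hπ.surj n z hz
  obtain ⟨t, rfl⟩ := h c hc
  rw [hπ.comm] at hw
  exact ⟨π n t - w, by rw [map_sub, hw, add_sub_cancel_right]⟩

include hR hV in
-- Above degree n + 1 the local models are exact along with `S`. Their cycles in degree n + 1 are
-- thus finitely generated, hence so is their cohomology, and `finite_of_local` applies.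
theorem finite_cohomology_of_local (hM : ∀ j, IsStrictlyPerfect (M j))
    (hπ : ∀ j, IsLocalModel (π j)) (n : ℤ) (hS : ∀ m, n < m → IsExactAt S m) :
    Module.Finite (R.obj (op ⊤)) (Cohomology S n) := by
  have hfin : ∀ j, Module.Finite (R.obj (op (V j))) (Cohomology (M j) n) := by
    intro j
    obtain ⟨⟨a, b, h⟩, hE⟩ := hM j
    have := (finite_projective_cycles (M j) b (fun n hn => h n (Or.inr hn)) hE n
      fun m hm => isExactAt_of_isLocalModel (hπ j) (hS m hm)).1
    infer_instance
  exact P.finite_of_local hR _ V hV (fun j => Cohomology (M j) n) (fun j => (hπ j).map n)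
    (fun j => (hπ j).map_surjective n) (fun j => (hπ j).mem_vanishing_of_map_eq_zero hR n)

include hR hV in
-- With no terms in degree n there are no boundaries in degree n + 1, so the local cohomology is the
-- module of cycles, which is projective.
theorem projective_cohomology_of_local (hM : ∀ j, IsStrictlyPerfect (M j))
    (hπ : ∀ j, IsLocalModel (π j)) (n : ℤ) (hS : ∀ m, n < m → IsExactAt S m)
    (hlow : ∀ j, Subsingleton ((M j).X n)) :
    Module.Projective (R.obj (op ⊤)) (Cohomology S n) := by
  have := finite_cohomology_of_local hR P hV hM hπ n hS
  have hproj : ∀ j, Module.Projective (R.obj (op (V j))) (Cohomology (M j) n) := by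
    intro j
    obtain ⟨⟨a, b, h⟩, hE⟩ := hM j
    have := (finite_projective_cycles (M j) b (fun n hn => h n (Or.inr hn)) hE n
      fun m hm => isExactAt_of_isLocalModel (hπ j) (hS m hm)).2
    have hbot : (LinearMap.range ((M j).d n (n + 1)).hom).submoduleOf (cycles (M j) n) = ⊥ := by
      rw [eq_bot_iff]
      rintro x ⟨t, ht⟩
      have := hlow j
      rw [Subsingleton.elim t 0, map_zero] at ht
      exact Subtype.ext ht.symm
    exact Module.Projective.of_equiv (Submodule.quotEquivOfEqBot _ hbot).symm
  exact P.projective_of_local hR _ V hV (fun j => Cohomology (M j) n) (fun j => (hπ j).map n)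
    (fun j => (hπ j).map_surjective n) (fun j => (hπ j).mem_vanishing_of_map_eq_zero hR n)

theorem exists_cycle_lift {A : Type u} [Ring A] (S : CochainComplex (ModuleCat.{u} A) ℤ) (n : ℤ)
    {N : Type u} [AddCommGroup N] [Module A N] [Module.Projective A N]
    (f : N →ₗ[A] Cohomology S n) :
    ∃ α : N →ₗ[A] S.X (n + 1), ∃ hα : ∀ x, (S.d (n + 1) (n + 1 + 1)).hom (α x) = 0,
      ∀ x, Submodule.Quotient.mk ⟨α x, hα x⟩ = f x := by
  obtain ⟨g, hg⟩ := Module.projective_lifting_property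
    ((LinearMap.range (S.d n (n + 1)).hom).submoduleOf (cycles S n)).mkQ f
    (Submodule.mkQ_surjective _)
  exact ⟨(cycles S n).subtype ∘ₗ g, fun x => (g x).2, fun x => congr($hg x)⟩

theorem cohomology_mk_eq_iff {A : Type u} [Ring A] {S : CochainComplex (ModuleCat.{u} A) ℤ} {n : ℤ}
    (x y : cycles S n) :
    (Submodule.Quotient.mk x : Cohomology S n) = Submodule.Quotient.mk y ↔
      ∃ t, x.1 = y.1 + (S.d n (n + 1)).hom t := by
  rw [Submodule.Quotient.eq]
  constructor
  · rintro ⟨t, ht⟩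
    exact ⟨t, by rw [ht]; simp⟩
  · rintro ⟨t, ht⟩
    exact ⟨t, by simp [ht]⟩

include hR hV in
-- Only degree a + 1 carries cohomology, and this module is projective, so representing cycles can
-- be chosen linearly; the choice is the quasi-isomorphism.
theorem exists_isStrictlyPerfect_of_top (hM : ∀ j, IsStrictlyPerfect (M j))
    (hπ : ∀ j, IsLocalModel (π j)) (a : ℤ) (hlow : ∀ j n, n < a + 1 → Subsingleton ((M j).X n))
    (hS : ∀ m, a < m → IsExactAt S m) :
    ∃ (E : Cpx R ⊤) (φ : E ⟶ S), IsStrictlyPerfect E ∧ IsQuasiIso φ := by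
  have := finite_cohomology_of_local hR P hV hM hπ a hS
  have := projective_cohomology_of_local hR P hV hM hπ a hS fun j => hlow j a (by omega)
  obtain ⟨α, hα, h⟩ := exists_cycle_lift S a (LinearMap.id (R := R.obj (op ⊤))
    (M := Cohomology S a))
  refine ⟨concentrated _ (Cohomology S a) (a + 1), concentratedHom α hα,
    isStrictlyPerfect_concentrated _ _, fun n => ?_⟩
  by_cases hn : n = a
  · subst hn
    constructor
    · intro y hy
      have e := h (Submodule.Quotient.mk ⟨y, hy⟩)
      rw [LinearMap.id_apply, eq_comm, cohomology_mk_eq_iff] at e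
      obtain ⟨t, ht⟩ := e
      exact ⟨concentratedMk _ _ (Submodule.Quotient.mk ⟨y, hy⟩), rfl, t,
        by rw [concentratedHom_mk]; exact ht⟩
    · rintro x - ⟨t, ht⟩
      obtain ⟨x, rfl⟩ := concentratedMk_surjective _ _ x
      rw [concentratedHom_mk] at ht
      have e := h x
      rw [LinearMap.id_apply] at e
      have hx : x = 0 := by
        rw [← e, ← Submodule.Quotient.mk_zero, cohomology_mk_eq_iff]
        exact ⟨t, ht.trans (zero_add _).symm⟩
      exact ⟨0, by rw [hx, map_zero]; rfl⟩
  · have := subsingleton_concentrated (A := R.obj (op ⊤)) (Cohomology S a) (n := a + 1)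
      (m := n + 1) (by omega)
    have hex : IsExactAt S n := by
      rcases lt_or_gt_of_ne hn with hn | hn
      · refine isExactAt_of_local hR P hV hπ n fun j z _ => ⟨0, ?_⟩
        have := hlow j (n + 1) (by omega)
        exact Subsingleton.elim _ _
      · exact hS n hn
    refine ⟨fun y hy => ?_, fun x _ _ => ⟨0, Subsingleton.elim _ _⟩⟩
    obtain ⟨t, ht⟩ := hex y hy
    exact ⟨0, map_zero _, t, by rw [map_zero, zero_add, ht]⟩

include hR hV in
/-- A complex which has strictly perfect local models is quasi-isomorphic to a strictly perfect
complex. -/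
theorem exists_isStrictlyPerfect_of_local (hM : ∀ j, IsStrictlyPerfect (M j))
    (hπ : ∀ j, IsLocalModel (π j)) (a : ℤ) (hlow : ∀ j n, n < a + 1 → Subsingleton ((M j).X n))
    (k : ℕ) (hS : ∀ m, a + k < m → IsExactAt S m) :
    ∃ (E : Cpx R ⊤) (φ : E ⟶ S), IsStrictlyPerfect E ∧ IsQuasiIso φ := by
  induction k generalizing S M with
  | zero => exact exists_isStrictlyPerfect_of_top hR P hV hM hπ a hlow (by simpa using hS)
  | succ k ih =>
    have := finite_cohomology_of_local hR P hV hM hπ _ hS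
    -- A free module on generators of the top cohomology, to be placed in degree a + k + 2. The cone
    -- of its map to `S` is exact in that degree and above.
    obtain ⟨r, p, hp⟩ := Module.Finite.exists_fin' (R.obj (op ⊤)) (Cohomology S (a + (k + 1 : ℕ)))
    obtain ⟨α, hα, h⟩ := exists_cycle_lift S _ p
    have hQ := isStrictlyPerfect_concentrated (R := R) (W := ⊤) (Fin r → R.obj (op ⊤))
      (a + (k + 1 : ℕ) + 1)
    obtain ⟨E, φ, hE, hφ⟩ := ih (S := cone (concentratedHom α hα))
      (M := fun j => cone (extendHom (hπ j) (concentratedHom α hα)))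
      (π := fun j => coneMap _ _ _ _) (fun j => (hQ.resCpx hR le_top).cone (hM j) _)
      (fun j => (isLocalModel_unit hR _ (V j)).cone _ _ (hπ j)
        fun n x => extendHom_unit (hπ j) _ n x) (fun j n hn => by
          -- The free module enters the cone in degree a + k + 1, which is at least a + 1, so the
          -- lower bound survives the induction.
          have h1 := hlow j n hn
          have h2 := subsingleton_concentrated (A := R.obj (op ⊤)) (Fin r → R.obj (op ⊤))
            (n := a + (k + 1 : ℕ) + 1) (m := n + 1) (by omega)
          have h3 : Subsingleton ((resCpx (le_top : V j ≤ ⊤) (concentrated (R.obj (op ⊤))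
              (Fin r → R.obj (op ⊤)) (a + (k + 1 : ℕ) + 1))).X (n + 1)) := by
            refine ⟨fun x y => ?_⟩
            obtain ⟨x, rfl⟩ := Res.unit_surjective hR (le_top : V j ≤ ⊤) x
            obtain ⟨y, rfl⟩ := Res.unit_surjective hR (le_top : V j ≤ ⊤) y
            rw [Subsingleton.elim x y]
          exact ⟨fun x y => cone.ext (h3.elim _ _) (h1.elim _ _)⟩)
      (fun m hm => isExactAt_cone_concentratedHom α hα (fun s hs => by
          obtain ⟨x, hx⟩ := hp (Submodule.Quotient.mk ⟨s, hs⟩)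
          rw [← h x, eq_comm, cohomology_mk_eq_iff] at hx
          exact ⟨x, hx⟩) hS m (by push_cast; omega))
    exact ⟨_, _, hQ.uncone hE φ, uncone.isQuasiIso_hom hφ⟩

end Perfect

end TwistedDescent

end

noncomputable section

namespace TwistedDescent

/-! ### The components of the sheafification as local models -/

section Local

variable {X : TopCat.{u}} {R : (Opens X)ᵒᵖ ⥤ RingCat.{u}} (hR : IsSoftPresheaf R)
  {ι : Type u} {U : ι → Opens X} (P : FinitePartition R U)

/-- Multiplication by `μ j` followed by extension by zero. -/
def FinitePartition.extend (j : Fin P.r) {U' V W : Opens X} (hV : V ≤ W) (hVW : W ⊓ P.O j ≤ V)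
    (hW : W ≤ U') {M : Type u} [AddCommGroup M] [Module (R.obj (op U')) M] :
    Res R (hV.trans hW) M →+ Res R hW M :=
  Res.extend hR hV hW (P.μ j) fun a ha => P.rho_μ_mul j hVW a ha

namespace FinitePartition

variable (j : Fin P.r) {U' U'' V W V' W' : Opens X} (hV : V ≤ W) (hVW : W ⊓ P.O j ≤ V)
    (hW : W ≤ U') (hW'' : W ≤ U'') {M : Type u} [AddCommGroup M] [Module (R.obj (op U')) M]
    {N : Type u} [AddCommGroup N] [Module (R.obj (op U'')) N]

theorem extend_move (x : Res R hW M) :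
    P.extend hR j hV hVW hW (Res.move R hW hV x) = rho R (le_top : W ≤ ⊤) (P.μ j) • x :=
  Res.extend_move hR _ _ _ _ x

theorem extend_moveHom (u : Res R hW M →ₗ[R.obj (op W)] Res R hW'' N)
    (y : Res R (hV.trans hW) M) :
    P.extend hR j hV hVW hW'' (Res.moveHom R hV u y) = u (P.extend hR j hV hVW hW y) := by
  obtain ⟨x, rfl⟩ := Res.move_surjective hR hW hV y
  rw [Res.moveHom_move, extend_move, extend_move, map_smul]

theorem move_extend (hW' : W' ≤ W) (hV' : V' ≤ W') (hVW' : W' ⊓ P.O j ≤ V') (h : V' ≤ V)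
    (y : Res R (hV.trans hW) M) :
    Res.move R hW hW' (P.extend hR j hV hVW hW y) =
      P.extend hR j hV' hVW' (hW'.trans hW) (Res.move R (hV.trans hW) h y) := by
  obtain ⟨x, rfl⟩ := Res.move_surjective hR hW hV y
  rw [Res.move_move, extend_move, LinearMap.map_smulₛₗ, rho_rho]
  refine (extend_move hR P j hV' hVW' (hW'.trans hW) (Res.move R hW hW' x)).symm.trans ?_
  rw [Res.move_move]

/-- Extension by zero turns the factor `f` over `V` into `μ j * f` over `W`, so whatever annihilates
this product annihilates the extension. -/
theorem smul_extend_eq_zero {f g : R.obj (op ⊤)} (hg : g * (P.μ j * f) = 0)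
    (y : Res R (hV.trans hW) M) :
    rho R (le_top : W ≤ ⊤) g • P.extend hR j hV hVW hW (rho R (le_top : V ≤ ⊤) f • y) = 0 := by
  obtain ⟨x, rfl⟩ := Res.move_surjective hR hW hV y
  have e : rho R (le_top : V ≤ ⊤) f • Res.move R hW hV x =
      Res.move R hW hV (rho R (le_top : W ≤ ⊤) f • x) := by
    rw [LinearMap.map_smulₛₗ, rho_rho]
  rw [e, extend_move, ← mul_smul, ← mul_smul, ← map_mul, ← map_mul, mul_assoc, hg, map_zero, zero_smul]

end FinitePartition

theorem inter_append_le (l : List ι) (i : ι) : inter U (l ++ [i]) ≤ inter U l :=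
  inter_mono (List.subset_append_left _ _)

theorem inter_inf_le (l : List ι) (i : ι) : inter U l ⊓ U i ≤ inter U (l ++ [i]) := by
  rintro x ⟨h1, h2⟩
  refine Set.mem_iInter₂.2 fun k hk => ?_
  rcases List.mem_append.1 hk with hk | hk
  · exact Set.mem_iInter₂.1 h1 k hk
  · rw [List.mem_singleton] at hk
    subst hk
    exact h2

theorem FinitePartition.inter_inf_le (j : Fin P.r) (l : List ι) :
    inter U l ⊓ P.O j ≤ inter U (l ++ [P.τ j]) :=
  (inf_le_inf_left _ (P.le j)).trans (TwistedDescent.inter_inf_le l _)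

theorem snoc_subset_snoc {l l' : List ι} (h : l ⊆ l') (i : ι) : l ++ [i] ⊆ l' ++ [i] :=
  List.append_subset.2 ⟨List.Subset.trans h (List.subset_append_left _ _), List.subset_append_right _ _⟩

theorem length_snoc {l : List ι} {p : ℕ} (h : l.length = p + 1) (i : ι) :
    (l ++ [i]).length = p + 1 + 1 := by simp [h]

theorem head_snoc {l : List ι} {x : ι} (h : l.head? = some x) (i : ι) :
    (l ++ [i]).head? = some x := by simp [List.head?_append, h]

theorem getLast_snoc (l : List ι) (i : ι) : (l ++ [i]).getLast? = some i := by simp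

variable {E : ∀ i, Cpx R (U i)} {n n' n'' : ℤ}

/-- The contracting homotopy `(hc)_l = (-1)^p μ_j c_{li}`, where `i = τ j`, of the Čech complex. -/
def Sec.contract (j : Fin P.r) (h : n + 1 = n') (c : Sec E n') : Sec E n := fun s =>
  (-1 : ℤ) ^ s.p • P.extend hR j (inter_append_le s.l (P.τ j)) (P.inter_inf_le j s.l)
    (le_of_head s.hx le_rfl)
    (c.ev (m := s.m) (length_snoc s.len (P.τ j)) (head_snoc s.hx (P.τ j))
      (by have := s.deg; push_cast; omega) le_rfl)

/-- The map `(σ m)_l = (-1)^p μ_j a_{li} m`, where `i = τ j`. -/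
def TwistedComplex.spread (F : TwistedComplex R U) (j : Fin P.r)
    (m : Res R (inter_le (U := U) (List.mem_singleton_self (P.τ j))) ((F.obj (P.τ j)).X n)) :
    Sec F.obj n := fun s =>
  (-1 : ℤ) ^ s.p • P.extend hR j (inter_append_le s.l (P.τ j)) (P.inter_inf_le j s.l)
    (le_of_head s.hx le_rfl)
    (F.a.ev (n := n) (m := s.m) (length_snoc s.len (P.τ j)) (getLast_snoc _ _)
      (head_snoc s.hx (P.τ j)) (by have := s.deg; push_cast; omega) le_rfl
      (Res.move R _ (inter_mono (List.subset_append_right _ _)) m))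

theorem Sec.ev_contract (j : Fin P.r) (h : n + 1 = n') (c : Sec E n') {p : ℕ} {l : List ι} {x : ι}
    {m : ℤ} (hl : l.length = p + 1) (hx : l.head? = some x) (hd : m + p = n) {V W : Opens X}
    (hW : W ≤ inter U l) (hVW : V ≤ W) (hV : V ≤ inter U (l ++ [P.τ j])) (hO : W ⊓ P.O j ≤ V) :
    (contract hR P j h c).ev hl hx hd hW = (-1 : ℤ) ^ p • P.extend hR j hVW hO (le_of_head hx hW)
      (c.ev (length_snoc hl (P.τ j)) (head_snoc hx (P.τ j)) (by push_cast; omega) hV) := by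
  simp only [ev, contract, map_zsmul]
  congr 1
  refine (P.move_extend hR j _ _ _ hW hVW hO hV _).trans ?_
  rw [Res.move_move]

theorem Cochain.ev_extend {F : ∀ i, Cpx R (U i)} {d : ℤ} (u : Cochain E F d) (j : Fin P.r)
    {p : ℕ} {l : List ι} {x y : ι}
    {m : ℤ} (hl : l.length = p + 1) (hx : l.getLast? = some x) (hy : l.head? = some y)
    (hd : n + d = m + p) {V W : Opens X} (hW : W ≤ inter U l) (hVW : V ≤ W) (hO : W ⊓ P.O j ≤ V)
    (z : Res R (hVW.trans (le_of_getLast hx hW)) ((E x).X n)) :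
    u.ev hl hx hy hd hW (P.extend hR j hVW hO (le_of_getLast hx hW) z) =
      P.extend hR j hVW hO (le_of_head hy hW) (u.ev hl hx hy hd (hVW.trans hW) z) := by
  refine (P.extend_moveHom hR j hVW hO _ _ (u.ev hl hx hy hd hW) z).symm.trans ?_
  simp only [ev, Res.moveHom_moveHom]

/-- The component of a section with index `[i]`. -/
def Sec.vertex (i : ι) (c : Sec E n) :
    Res R (inter_le (U := U) (List.mem_singleton_self i)) ((E i).X n) :=
  c ⟨0, [i], i, n, rfl, rfl, by simp⟩

/-- Appending a last index anticommutes with most of δ + a. Two terms remain: omission of the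
appended index returns `c` and is cancelled by `μ j • c`; the full-length component of the twisting
cochain acts on the vertex value of `c` at `τ j`. Hence, up to homotopy, `μ j • c` depends on that
value alone. -/
theorem TwistedComplex.secDiff_contract (F : TwistedComplex R U) (j : Fin P.r) (h : n + 1 = n')
    (h' : n' + 1 = n'') (c : Sec F.obj n') :
    F.secDiff h (Sec.contract hR P j h c) + Sec.contract hR P j h' (F.secDiff h' c) + P.μ j • c =
      F.spread hR P j (c.vertex (P.τ j)) := by
  ext s
  obtain ⟨p, l, x, m, hl, hx, hd⟩ := s
  let ex : Res R ((inter_append_le l (P.τ j)).trans (le_of_head hx le_rfl)) ((F.obj x).X m) →+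
      Res R (le_of_head hx le_rfl) ((F.obj x).X m) :=
    P.extend hR j (inter_append_le l (P.τ j))
          (P.inter_inf_le j l) (le_of_head hx le_rfl)
  have e1 : Sec.cech h (Sec.contract hR P j h c) ⟨p, l, x, m, hl, hx, hd⟩ =
      ∑ k : Fin p, (-1 : ℤ) ^ (k.1 + 1) • (-1 : ℤ) ^ (p - 1) • P.extend hR j
        (inter_append_le l (P.τ j)) (P.inter_inf_le j l) (le_of_head hx le_rfl)
        (c.ev (m := m) (length_snoc (length_face hl k.2) (P.τ j))
          (head_snoc (head_face hx) (P.τ j)) (by have := k.2; push_cast; omega)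
          (inter_mono (snoc_subset_snoc List.eraseIdx_subset _))) :=
    Finset.sum_congr rfl fun k _ => congr_arg _ (Sec.ev_contract hR P j h c _ _ _ _ _ _ _)
  have e2 : Sec.act h F.a (Sec.contract hR P j h c) ⟨p, l, x, m, hl, hx, hd⟩ =
      ∑ k : Fin (p + 1), (Int.negOnePow ((1 - k.1) * (p - k.1 : ℕ)) : ℤ) •
        (-1 : ℤ) ^ (p - k.1) • P.extend hR j (inter_append_le l (P.τ j))
          (P.inter_inf_le j l) (le_of_head hx le_rfl)
        (F.a.ev (n := n - (p - k.1 : ℕ)) (m := m) (length_front hl k.2)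
          (getLast_front (by omega)) (head_front hx) (by omega)
          ((inter_append_le l (P.τ j)).trans (inter_mono (List.take_subset (k.1 + 1) l)))
          (c.ev (length_snoc (length_back hl k.2) (P.τ j))
            (head_snoc (head_back (by omega)) (P.τ j)) (by push_cast; omega)
            (inter_mono (snoc_subset_snoc (List.drop_subset k.1 l) _)))) := by
    refine Finset.sum_congr rfl fun k _ => congr_arg _ ?_
    rw [Sec.ev_contract hR P j h c _ _ _ _ (inter_append_le l (P.τ j))
      (inter_mono (snoc_subset_snoc (List.drop_subset k.1 l) _)) (P.inter_inf_le j l),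
      map_zsmul, Cochain.ev_extend]
  have e3 : Sec.contract hR P j h' (F.secDiff h' c) ⟨p, l, x, m, hl, hx, hd⟩ =
      (-1 : ℤ) ^ p • ex ((∑ k : Fin p, (-1 : ℤ) ^ (k.1 + 1) •
        (c.ev (m := m) (length_snoc (length_face hl k.2) (P.τ j))
          (head_snoc (head_face hx) (P.τ j)) (by have := k.2; push_cast; omega)
          (inter_mono (snoc_subset_snoc List.eraseIdx_subset _))) +
        (-1 : ℤ) ^ (p + 1) • c.ev (m := m) hl hx hd (inter_append_le l (P.τ j))) +
      (∑ k : Fin (p + 1), (Int.negOnePow ((1 - k.1) * (p + 1 - k.1 : ℕ)) : ℤ) •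
        (F.a.ev (n := n - (p - k.1 : ℕ)) (m := m) (length_front hl k.2)
          (getLast_front (by omega)) (head_front hx) (by omega)
          ((inter_append_le l (P.τ j)).trans (inter_mono (List.take_subset (k.1 + 1) l)))
          (c.ev (length_snoc (length_back hl k.2) (P.τ j))
            (head_snoc (head_back (by omega)) (P.τ j)) (by push_cast; omega)
            (inter_mono (snoc_subset_snoc (List.drop_subset k.1 l) _)))) +
        F.a.ev (n := n') (m := m) (length_snoc hl (P.τ j)) (getLast_snoc _ _)
          (head_snoc hx (P.τ j)) (by push_cast; omega) le_rfl
          (c.ev (l := [P.τ j]) (x := P.τ j) (m := n') (p := 0) rfl rfl (by simp)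
            (inter_mono (List.subset_append_right _ _))))) := by
    refine congr_arg _ (congr_arg ex ?_)
    change (Sec.cech h' c + Sec.act h' F.a c).ev _ _ _ _ = _
    -- The last summands, split off here, are the two surviving terms: the face without `τ j`, and
    -- the twisting cochain on all of `l ++ [τ j]`.
    rw [Sec.ev_add, Sec.ev_cech, Sec.ev_act, Fin.sum_univ_castSucc,
      Fin.sum_univ_castSucc (n := p + 1)]
    congr 1
    · congr 1
      · refine Finset.sum_congr rfl fun k _ => congr_arg _ ?_
        apply Sec.ev_congr
        exact List.eraseIdx_append_of_lt_length (by have : k.1 < p := k.2; simp; omega) _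
      · refine congr_arg _ ?_
        apply Sec.ev_congr
        rw [List.eraseIdx_append_of_length_le (by simp [hl])]
        simp [hl]
    · congr 1
      · refine Finset.sum_congr rfl fun k _ => congr_arg _ ?_
        have : k.1 < p + 1 := k.2
        apply Sec.ev_ev_congr
        · exact List.take_append_of_le_length (by simp; omega)
        · exact List.drop_append_of_le_length (by simp; omega)
      · simp only [Fin.val_last, Nat.sub_self, Nat.cast_zero, mul_zero, Int.negOnePow_zero,
          Units.val_one, one_smul]
        apply Sec.ev_ev_congr
        · exact List.take_of_length_le (by simp [hl])
        · rw [← hl]; exact List.drop_left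
  have e4 : (P.μ j • c : Sec F.obj n') ⟨p, l, x, m, hl, hx, hd⟩ =
      ex (c.ev (m := m) hl hx hd (inter_append_le l (P.τ j))) :=
    (P.extend_move hR j _ _ _ _).symm
  have e5 : F.spread hR P j (c.vertex (P.τ j)) ⟨p, l, x, m, hl, hx, hd⟩ =
      (-1 : ℤ) ^ p • ex (F.a.ev (n := n') (m := m) (length_snoc hl (P.τ j)) (getLast_snoc _ _)
          (head_snoc hx (P.τ j)) (by push_cast; omega) le_rfl
          (c.ev (l := [P.τ j]) (x := P.τ j) (m := n') (p := 0) rfl rfl (by simp)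
            (inter_mono (List.subset_append_right _ _)))) := rfl
  refine Eq.trans (congr_arg₂ (· + ·) (congr_arg₂ (· + ·) (congr_arg₂ (· + ·) e1 e2) e3) e4)
    (Eq.trans ?_ e5.symm)
  change ((∑ k : Fin p, _ • _ • ex _) + (∑ k : Fin (p + 1), _ • _ • ex _)) + _ + _ = _
  simp only [← map_zsmul ex, ← map_sum ex, ← map_add ex]
  refine congr_arg ex ?_
  simp only [smul_add, Finset.smul_sum, smul_smul, ← pow_add]
  -- The sign of the homotopy makes the other sums cancel: `s1` treats the omitted last index, `s2`
  -- the other faces, `s3` the twisting cochain.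
  have s1 : (-1 : ℤ) ^ (p + (p + 1)) = -1 := by
    rw [← add_assoc, pow_succ, Even.neg_one_pow (by simp)]; simp
  have s2 : ∀ k : Fin p, (-1 : ℤ) ^ (k.1 + 1 + (p - 1)) = - (-1) ^ (p + (k.1 + 1)) := by
    intro k
    have := k.2
    rw [show p + (k.1 + 1) = (k.1 + 1 + (p - 1)) + 1 by omega, pow_succ]
    ring
  have s3 : ∀ k : Fin (p + 1), (Int.negOnePow ((1 - k.1) * (p - k.1 : ℕ)) : ℤ) * (-1) ^ (p - k.1) =
      - ((-1 : ℤ) ^ p * (Int.negOnePow ((1 - k.1) * (p + 1 - k.1 : ℕ)) : ℤ)) := by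
    intro k
    have hpow : ∀ j : ℕ, (-1 : ℤ) ^ j = (Int.negOnePow (j : ℤ) : ℤ) := by
      intro j
      simp [Int.negOnePow]
    have := k.2
    rw [hpow, hpow, ← Units.val_mul, ← Units.val_mul, ← Int.negOnePow_add, ← Int.negOnePow_add,
      ← Units.val_neg, ← Int.negOnePow_succ]
    congr 1
    rw [Int.negOnePow_eq_iff]
    refine ⟨- 1, ?_⟩
    push_cast [Nat.cast_sub (show k.1 ≤ p by omega), Nat.cast_sub (show k.1 ≤ p + 1 by omega)]
    ring
  simp only [s1, s2, s3, neg_smul, Finset.sum_neg_distrib, one_smul]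
  abel

end Local

end TwistedDescent

end

noncomputable section

namespace TwistedDescent

/-! ### Compatibilities of iterated restriction -/

section Restriction

variable {X : TopCat.{u}} {R : (Opens X)ᵒᵖ ⥤ RingCat.{u}}
  {U V W : Opens X} {h : V ≤ U} {M : Type u} [AddCommGroup M] [Module (R.obj (op U)) M]
  {N : Type u} [AddCommGroup N] [Module (R.obj (op U)) N]

theorem Res.move_self (x : Res R h M) : Res.move R h le_rfl x = x := by
  induction x using Res.induction with
  | zero => exact map_zero _
  | unit r m => simp [LinearMap.map_smulₛₗ]
  | add x y hx hy => rw [map_add, hx, hy]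

theorem Res.moveHom_self {U' : Opens X} {g : V ≤ U'} {N : Type u} [AddCommGroup N]
    [Module (R.obj (op U')) N] (u : Res R h M →ₗ[R.obj (op V)] Res R g N) :
    Res.moveHom R le_rfl u = u := by
  apply Res.hom_ext
  intro m
  exact (Res.moveHom_unit R le_rfl u m).trans (Res.move_self _)

theorem Res.moveHom_map (h' : W ≤ V) (f : M →ₗ[R.obj (op U)] N) :
    Res.moveHom R h' (Res.map R h f) = Res.map R (h'.trans h) f := by
  apply Res.hom_ext
  intro m
  rw [Res.moveHom_unit, Res.map_unit, Res.map_unit, Res.move_unit]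

theorem Res.map_move (h' : W ≤ V) (f : M →ₗ[R.obj (op U)] N) (x : Res R h M) :
    Res.map R (h'.trans h) f (Res.move R h h' x) = Res.move R h h' (Res.map R h f x) := by
  rw [← Res.moveHom_map h' f, Res.moveHom_move]

end Restriction

/-! ### The Maurer–Cartan equation in Čech degrees one and two -/

section MaurerCartan

variable {X : TopCat.{u}} {R : (Opens X)ᵒᵖ ⥤ RingCat.{u}} {ι : Type u} {U : ι → Opens X}
  {E F G : ∀ i, Cpx R (U i)} {n m d e : ℤ}

theorem Cochain.ev_move (u : Cochain E F d) {p : ℕ} {l : List ι} {x y : ι}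
    (hl : l.length = p + 1) (hx : l.getLast? = some x) (hy : l.head? = some y) (hd : n + d = m + p)
    {V W : Opens X} (hW : W ≤ inter U l) (hV : V ≤ W)
    (z : Res R (le_of_getLast hx hW) ((E x).X n)) :
    u.ev hl hx hy hd (hV.trans hW) (Res.move R _ hV z) =
      Res.move R _ hV (u.ev hl hx hy hd hW z) := by
  rw [ev, ← Res.moveHom_moveHom R hW hV]
  exact Res.moveHom_move R hV _ z

theorem Cochain.ev_ev_congr (u : Cochain F G d) (v : Cochain E F e) {p q p' q' : ℕ}
    {l₁ l₂ l₁' l₂' : List ι} {x y z z' : ι} {μ μ' : ℤ}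
    (h1 : l₁.length = p + 1) (h2 : l₁.getLast? = some z) (h3 : l₁.head? = some y)
    (h4 : μ + d = m + p) (h5 : l₂.length = q + 1) (h6 : l₂.getLast? = some x)
    (h6a : l₂.head? = some z) (h7 : n + e = μ + q)
    (h1' : l₁'.length = p' + 1) (h2' : l₁'.getLast? = some z') (h3' : l₁'.head? = some y)
    (h4' : μ' + d = m + p') (h5' : l₂'.length = q' + 1) (h6' : l₂'.getLast? = some x)
    (h6a' : l₂'.head? = some z')
    (h7' : n + e = μ' + q') {W : Opens X} (hW₁ : W ≤ inter U l₁) (hW₂ : W ≤ inter U l₂)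
    (hW₁' : W ≤ inter U l₁') (hW₂' : W ≤ inter U l₂') (e₁ : l₁ = l₁') (e₂ : l₂ = l₂')
    (a : Res R (le_of_getLast h6 hW₂) ((E x).X n)) :
    u.ev h1 h2 h3 h4 hW₁ (v.ev h5 h6 h6a h7 hW₂ a) =
      u.ev h1' h2' h3' h4' hW₁' (v.ev h5' h6' h6a' h7' hW₂' a) := by
  subst e₁ e₂
  obtain rfl : p = p' := by omega
  obtain rfl : q = q' := by omega
  obtain rfl : μ = μ' := by omega
  obtain rfl : z = z' := Option.some.inj (h2.symm.trans h2')
  rfl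

namespace TwistedComplex

variable (F : TwistedComplex R U)

theorem ev_vertex {i : ι} (h : n + 1 = m) {W : Opens X} (hW : W ≤ inter U [i]) :
    F.a.ev (p := 0) (l := [i]) (x := i) (y := i) (n := n) (m := m) rfl rfl rfl (by simpa using h) hW =
      Res.map R (hW.trans (inter_le (List.mem_singleton_self i))) ((F.obj i).d n m).hom :=
  Eq.trans (congr_arg (Res.moveHom R (h := inter_le (U := U) (List.mem_singleton_self i))
    (g := inter_le (U := U) (List.mem_singleton_self i)) (M := (F.obj i).X n)
    (N := (F.obj i).X m) hW) (F.a_zero i n m h)) (Res.moveHom_map hW _)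

theorem maurerCartan_ev {p : ℕ} {l : List ι} {x y : ι} (hl : l.length = p + 1)
    (hx : l.getLast? = some x) (hy : l.head? = some y) (hd : n + 2 = m + p)
    {W : Opens X} (hW : W ≤ inter U l) (z : Res R (le_of_getLast hx hW) (((F.obj x).X n))) :
    (∑ k : Fin (p - 1), (-1 : ℤ) ^ (k.1 + 1) •
      F.a.ev (n := n) (m := m) (length_face hl (by omega)) (getLast_face hl k.2 hx)
        (head_face hy) (by have := k.2; omega)
        (hW.trans (inter_mono (List.eraseIdx_subset (l := l) (k := k.1 + 1)))) z) +
    ∑ k : Fin (p + 1), (Int.negOnePow ((1 - k.1) * (p - k.1 : ℕ)) : ℤ) •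
    (F.a.ev (n := n + 1 - (p - k.1 : ℕ)) (m := m) (length_front hl k.2)
        (getLast_front (by omega)) (head_front hy)
        (by omega) (hW.trans (inter_mono (List.take_subset (k.1 + 1) l))))
      (F.a.ev (length_back hl k.2)
        (getLast_back (by omega) hx) (head_back (by omega))
        (by omega) (hW.trans (inter_mono (List.drop_subset k.1 l))) z) =
      (0 : Res R (le_of_head hy hW) ((F.obj y).X m)) := by
  refine (congr_arg₂ (· + ·) (Cochain.ev_cech_apply (e := 2) rfl F.a hl hx hy hd hW z).symm
    (Cochain.ev_comp_apply (f := 2) rfl F.a F.a hl hx hy hd hW z).symm).trans ?_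
  have e : (F.a.cech (e := 2) rfl + Cochain.comp (f := 2) rfl F.a F.a).ev hl hx hy hd hW z = 0 := by
    rw [F.maurerCartan]
    exact congr($(Res.moveHom_zero R hW) z)
  exact Eq.trans (congr($(Res.moveHom_add R hW _ _) z)).symm e

/-- In Čech degree one there is no interior index to omit, and the Maurer–Cartan equation says that
`a^{1,0}` is a chain map. -/
theorem ev_edge_d {i j : ι} (h : n + 1 = m) {W : Opens X} (hW : W ≤ inter U [i, j])
    (hi : W ≤ U i) (hj : W ≤ U j) (z : Res R hj ((F.obj j).X n)) :
    F.a.ev (p := 1) (l := [i, j]) (x := j) (y := i) (n := m) (m := m) rfl rfl rfl rfl hW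
        (Res.map R hj ((F.obj j).d n m).hom z) =
      Res.map R hi ((F.obj i).d n m).hom
        (F.a.ev (p := 1) (l := [i, j]) (x := j) (y := i) (n := n) (m := n) rfl rfl rfl rfl hW z) := by
  have key := F.maurerCartan_ev (p := 1) (l := [i, j]) (x := j) (y := i) (n := n) (m := m)
    rfl rfl rfl (by push_cast; omega) hW z
  have hWi : W ≤ inter U [i] := hW.trans (inter_mono (by simp))
  have hWj : W ≤ inter U [j] := hW.trans (inter_mono (by simp))
  rw [← sub_eq_zero]
  refine Eq.trans ?_ key
  rw [← F.ev_vertex h hWi, ← F.ev_vertex h hWj, Fin.sum_univ_castSucc, Fin.sum_univ_castSucc]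
  simp only [Finset.univ_eq_empty, Finset.sum_empty, zero_add]
  rw [sub_eq_neg_add]
  refine (zero_add _).symm.trans (congr_arg₂ (· + ·) (Fin.sum_univ_zero _).symm
    (congr_arg₂ (· + ·) ?_ ?_))
  · refine (neg_one_zsmul _).symm.trans (congr_arg₂ (· • ·) ?_ ?_)
    · rfl
    · apply Cochain.ev_ev_congr <;> rfl
  · refine (one_zsmul _).symm.trans (congr_arg₂ (· • ·) ?_ ?_)
    · rfl
    · apply Cochain.ev_ev_congr <;> rfl

/-- In Čech degree two `a^{2,-1}` is a homotopy between `a_{ij} a_{jk}` and `a_{ik}`; on a cycle one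
of the two homotopy terms disappears. -/
theorem ev_triangle {i j k : ι} (h : n + 1 = m) {W : Opens X} (hW : W ≤ inter U [i, j, k])
    (hij : W ≤ inter U [i, j]) (hjk : W ≤ inter U [j, k]) (hik : W ≤ inter U [i, k])
    (hi : W ≤ U i) (hk : W ≤ U k) (z : Res R hk ((F.obj k).X m))
    (hz : Res.map R hk ((F.obj k).d m (m + 1)).hom z = 0) :
    F.a.ev (p := 1) (l := [i, j]) (x := j) (y := i) (n := m) (m := m) rfl rfl rfl rfl hij
      (F.a.ev (p := 1) (l := [j, k]) (x := k) (y := j) (n := m) (m := m) rfl rfl rfl rfl hjk z) =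
    F.a.ev (p := 1) (l := [i, k]) (x := k) (y := i) (n := m) (m := m) rfl rfl rfl rfl hik z -
      Res.map R hi ((F.obj i).d n m).hom
        (F.a.ev (p := 2) (l := [i, j, k]) (x := k) (y := i) (n := m) (m := n) rfl rfl rfl
          (by push_cast; omega) hW z) := by
  have key := F.maurerCartan_ev (p := 2) (l := [i, j, k]) (x := k) (y := i) (n := m) (m := m)
    rfl rfl rfl (by push_cast; omega) hW z
  have hWi : W ≤ inter U [i] := hW.trans (inter_mono (by simp))
  have hWk : W ≤ inter U [k] := hW.trans (inter_mono (by simp))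
  have hz' : F.a.ev (p := 2) (l := [i, j, k]) (x := k) (y := i) (n := m + 1) (m := m) rfl rfl rfl
          (by push_cast; omega) hW (F.a.ev (p := 0) (l := [k]) (x := k) (y := k) (n := m)
            (m := m + 1) rfl rfl rfl (by simp) hWk z) = 0 := by
    rw [F.ev_vertex rfl hWk, hz, map_zero]
  rw [← sub_eq_zero]
  refine Eq.trans ?_ key
  rw [← F.ev_vertex h hWi, Fin.sum_univ_castSucc, Fin.sum_univ_castSucc, Fin.sum_univ_castSucc,
    Fin.sum_univ_castSucc]
  simp only [Finset.univ_eq_empty, Finset.sum_empty, zero_add]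
  rw [sub_sub_eq_add_sub, add_comm, ← neg_add_eq_sub]
  refine congr_arg₂ (· + ·) ?_ ?_
  · refine (neg_one_zsmul _).symm.trans (congr_arg₂ (· • ·) ?_ ?_)
    · rfl
    · rfl
  rw [← add_zero (_ + _), ← hz']
  refine congr_arg₂ (· + ·) (congr_arg₂ (· + ·) ?_ ?_) ?_
  all_goals
    refine (one_zsmul _).symm.trans (congr_arg₂ (· • ·) ?_ ?_)
    · rfl
    · apply Cochain.ev_ev_congr <;> rfl

end TwistedComplex

end MaurerCartan

end TwistedDescent

end

noncomputable section

namespace TwistedDescent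

/-! ### Cohomology of S(F) over U_i -/

section LocalModel

variable {X : TopCat.{u}} {R : (Opens X)ᵒᵖ ⥤ RingCat.{u}} (hR : IsSoftPresheaf R)
  {ι : Type u} {U : ι → Opens X} (P : FinitePartition R U) (F : TwistedComplex R U) {n n' n'' : ℤ}

theorem TwistedComplex.sheafification_d (h : n + 1 = n') (c : Sec F.obj n) :
    (F.sheafification.d n n').hom c = F.secDiff h c := by
  change (dite _ _ _ : ModuleCat.of _ (Sec F.obj n) ⟶ ModuleCat.of _ (Sec F.obj n')).hom c = _
  rw [dif_pos h]
  rfl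

/-- The projection of the sheafification to the component with index `[i]`. -/
def TwistedComplex.toVertex (i : ι) (n : ℤ) :
    F.sheafification.X n →ₛₗ[rho R (le_top : inter U [i] ≤ ⊤)]
    (resCpx (inter_le (U := U) (List.mem_singleton_self i)) (F.obj i)).X n :=
  Sec.proj F.obj ⟨0, [i], i, n, rfl, rfl, by simp⟩

theorem Sec.exists_vertex_eq {E : ∀ i, Cpx R (U i)} (i : ι)
    (m : Res R (inter_le (U := U) (List.mem_singleton_self i)) ((E i).X n)) :
    ∃ c : Sec E n, c.vertex i = m := by
  classical
  exact ⟨Function.update (0 : ∀ s : SecIndex ι n, Res R (inter_le (U := U) s.mem) ((E s.x).X s.m))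
    ⟨0, [i], i, n, rfl, rfl, by simp⟩ m, Function.update_self _ _ _⟩

/-- A tuple with one entry has no index to omit and a single decomposition, so only `a^{0,1}`
remains of δ + a. -/
theorem TwistedComplex.vertex_secDiff (h : n + 1 = n') (i : ι) (c : Sec F.obj n) :
    (F.secDiff h c).vertex i = Res.map R _ ((F.obj i).d n n').hom (c.vertex i) := by
  refine (congr_arg₂ (· + ·) (Fin.sum_univ_zero _) (Fin.sum_univ_one _)).trans
    ((zero_add _).trans ?_)
  refine ((congr_arg₂ (· • ·) (?_ : _ = (1 : ℤ)) ?_).trans (one_smul _ _)).trans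
    (congr($(F.ev_vertex h (le_refl (inter U [i])))
      (c.ev (l := [i]) (p := 0) (x := i) (m := n) rfl rfl (by simp) le_rfl)).trans ?_)
  · rfl
  · apply Sec.ev_ev_congr <;> rfl
  · exact congr_arg _ (Res.move_self _)

/-- This is the cocycle condition at `[i, j]`: on the overlap `a_{ij}` carries the class of `c_j` to
that of `c_i`, and `c_{ij}` is the primitive. -/
theorem TwistedComplex.move_vertex (h : n + 1 = n') (h' : n' + 1 = n'') (c : Sec F.obj n')
    (hc : F.secDiff h' c = 0) (i j : ι) {W : Opens X} (hW : W ≤ inter U [i, j])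
    (hi : W ≤ inter U [i]) (hj : W ≤ inter U [j]) :
    Res.move R _ hi (c.vertex i) =
      F.a.ev (p := 1) (l := [i, j]) (x := j) (y := i) (n := n') (m := n') rfl rfl rfl rfl hW
        (Res.move R _ hj (c.vertex j)) -
      Res.map R (hi.trans (inter_le (List.mem_singleton_self i))) ((F.obj i).d n n').hom
        (c.ev (p := 1) (l := [i, j]) (x := i) (m := n) rfl rfl h hW) := by
  have key : (Sec.cech h' c + Sec.act h' F.a c).ev (p := 1) (l := [i, j]) (x := i) (m := n')
      rfl rfl h' hW = 0 := by
    change (F.secDiff h' c).ev (p := 1) (l := [i, j]) (x := i) (m := n') rfl rfl h' hW = 0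
    rw [hc]
    exact map_zero _
  have e := (Sec.ev_cech h' c (p := 1) (l := [i, j]) (x := i) (m := n') rfl rfl h' hW)
  have e' := (Sec.ev_act h' F.a c (p := 1) (l := [i, j]) (x := i) (m := n') rfl rfl h' hW)
  rw [← F.ev_vertex h hi]
  refine eq_sub_of_add_eq (neg_add_eq_zero.1 ?_)
  refine Eq.trans ?_ ((congr_arg₂ (· + ·) e e').symm.trans ((Sec.ev_add _ _ _ _ _ _).symm.trans key))
  rw [Fin.sum_univ_castSucc, Fin.sum_univ_castSucc, Fin.sum_univ_castSucc, Fin.sum_univ_zero,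
    Fin.sum_univ_zero, zero_add, zero_add, neg_add, add_assoc]
  refine congr_arg₂ (· + ·) ?_ (congr_arg₂ (· + ·) ?_ ?_)
  · refine (neg_one_zsmul _).symm.trans (congr_arg₂ (· • ·) ?_ ?_)
    · rfl
    · rfl
  · refine (neg_one_zsmul _).symm.trans (congr_arg₂ (· • ·) ?_ ?_)
    · rfl
    · apply Sec.ev_ev_congr <;> rfl
  · refine (one_zsmul _).symm.trans (congr_arg₂ (· • ·) ?_ ?_)
    · rfl
    · exact Sec.ev_ev_congr F.a c (p := 1) (q := 0) (l₁ := [i, j]) (l₂ := [j])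
        rfl rfl rfl rfl rfl rfl (by simp) _ _ _ _ _ _ _ _ _ _ _ rfl rfl

theorem Sec.contract_zero {E : ∀ i, Cpx R (U i)} (h : n + 1 = n') (j : Fin P.r) :
    Sec.contract hR P j h (0 : Sec E n') = 0 := by
  ext s
  change (-1 : ℤ) ^ s.p • P.extend hR j _ _ _ (Res.move R _ _ 0) = 0
  rw [map_zero, map_zero, smul_zero]

theorem TwistedComplex.spread_add (j : Fin P.r)
    (m m' : Res R (inter_le (U := U) (List.mem_singleton_self (P.τ j))) ((F.obj (P.τ j)).X n)) :
    F.spread hR P j (m + m') = F.spread hR P j m + F.spread hR P j m' := by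
  ext s
  rw [Sec.add_apply]
  simp only [spread, map_add, smul_add]

theorem TwistedComplex.smul_spread_eq_zero (j : Fin P.r) {f g : R.obj (op ⊤)}
    (hg : g * (P.μ j * f) = 0)
    (m : Res R (inter_le (U := U) (List.mem_singleton_self (P.τ j))) ((F.obj (P.τ j)).X n)) :
    g • F.spread hR P j (rho R (le_top : inter U [P.τ j] ≤ ⊤) f • m) = 0 := by
  ext s
  rw [Sec.smul_apply]
  simp only [spread, LinearMap.map_smulₛₗ, rho_rho]
  rw [smul_comm]
  refine (congr_arg _ ?_).trans (smul_zero _)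
  exact P.smul_extend_eq_zero hR j _ _ _ hg _

/-- Formal consequence of the homotopy formula: D applied to the formula for `c` agrees with the
formula for D c because D² = 0, and the vertex value of `c` can be prescribed. -/
theorem TwistedComplex.secDiff_spread (h : n + 1 = n') (j : Fin P.r)
    (m : Res R (inter_le (U := U) (List.mem_singleton_self (P.τ j))) ((F.obj (P.τ j)).X n)) :
    F.secDiff h (F.spread hR P j m) =
      F.spread hR P j (Res.map R _ ((F.obj (P.τ j)).d n n').hom m) := by
  obtain ⟨c, rfl⟩ := Sec.exists_vertex_eq (P.τ j) m
  rw [← F.vertex_secDiff h]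
  have e1 := F.secDiff_contract hR P j (sub_add_cancel n 1) h c
  have e2 := F.secDiff_contract hR P j h (n'' := n' + 1) rfl (F.secDiff h c)
  rw [F.secDiff_secDiff, Sec.contract_zero, add_zero] at e2
  rw [← e1, ← e2, map_add, map_add, F.secDiff_secDiff, zero_add, map_smul]

include hR in
/-- A cycle of a restriction of `M` to a smaller open set is the restriction of a cycle. -/
theorem Res.exists_cycle_lift {U V W : Opens X} {h : V ≤ U} (h' : W ≤ V) {M N : Type u}
    [AddCommGroup M] [Module (R.obj (op U)) M] [AddCommGroup N] [Module (R.obj (op U)) N]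
    (g : M →ₗ[R.obj (op U)] N) (t : Res R (h'.trans h) M)
    (ht : Res.map R (h'.trans h) g t = 0) :
    ∃ y : Res R h M, Res.map R h g y = 0 ∧ Res.move R h h' y = t := by
  obtain ⟨q, rfl⟩ := Res.move_surjective hR h h' t
  rw [Res.map_move] at ht
  obtain ⟨f, hf, hfq⟩ := Res.move_eq_zero hR h h' ht
  refine ⟨rho R (le_top : V ≤ ⊤) f • q, by rw [map_smul, hfq], ?_⟩
  rw [LinearMap.map_smulₛₗ, rho_rho, hf, one_smul]

/-- `a_{ii}` is invertible up to homotopy, hence onto on cohomology: `y` is the homotopy inverse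
applied to `z`. The two inclusions for `W` allow `[i]` in place of `[i, i]`, whose open sets are
equal but not by definition. -/
theorem TwistedComplex.exists_loop_eq (h : n + 1 = n') (i : ι) {W : Opens X}
    (hW : W ≤ inter U [i, i])
    (hW' : inter U [i, i] ≤ W) (hi : W ≤ U i)
    (z : Res R hi ((F.obj i).X n')) (hz : Res.map R hi ((F.obj i).d n' (n' + 1)).hom z = 0) :
    ∃ y : Res R hi ((F.obj i).X n'), Res.map R hi ((F.obj i).d n' (n' + 1)).hom y = 0 ∧
      ∃ w, F.a.ev (p := 1) (l := [i, i]) (x := i) (y := i) (n := n') (m := n') rfl rfl rfl rfl hW y =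
        z + Res.map R hi ((F.obj i).d n n').hom w := by
  obtain ⟨e, he⟩ := F.a_one i
  let K := resCpx (V := inter U [i, i]) (inter_le (U := U) (List.mem_cons_self (a := i))) (F.obj i)
  let z' : K.X n' := Res.move R hi hW' z
  have hz' : (K.d n' (n' + 1)).hom z' = 0 :=
    (Res.map_move hW' _ z).trans ((congr_arg _ hz).trans (map_zero _))
  have hy' : (K.d n' (n' + 1)).hom ((e.inv.f n').hom z') = 0 := by
    rw [← hom_d_apply]
    exact (congr_arg _ hz').trans (map_zero _)
  have hom := congr($(e.homotopyInvHomId.comm n').hom z')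
  have e0 : (e.inv ≫ e.hom).f n' = e.inv.f n' ≫ e.hom.f n' := rfl
  rw [dNext_eq _ (show (ComplexShape.up ℤ).Rel n' (n' + 1) from rfl),
    prevD_eq _ (show (ComplexShape.up ℤ).Rel n n' from h)] at hom
  have hom' : (e.hom.f n').hom ((e.inv.f n').hom z') =
      z' + (K.d n n').hom ((e.homotopyInvHomId.hom n' n).hom z') := by
    refine hom.trans ?_
    have : (K.d n' (n' + 1) ≫ e.homotopyInvHomId.hom (n' + 1) n').hom z' = 0 :=
      (congr_arg (e.homotopyInvHomId.hom (n' + 1) n').hom hz').trans (map_zero _)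
    change (K.d n' (n' + 1) ≫ e.homotopyInvHomId.hom (n' + 1) n').hom z' + _ + z' = _
    rw [this, zero_add]
    exact add_comm _ _
  refine ⟨Res.move R _ hW ((e.inv.f n').hom z'), ?_,
    Res.move R _ hW ((e.homotopyInvHomId.hom n' n).hom z'), ?_⟩
  · refine (Res.map_move hW _ _).trans ((congr_arg _ hy').trans (map_zero _))
  · refine (Res.moveHom_move R hW _ _).trans ?_
    refine Eq.trans ?_ (congr_arg (z + ·) (Res.map_move hW ((F.obj i).d n n').hom
      ((e.homotopyInvHomId.hom n' n).hom z')).symm)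
    refine (congr_arg (Res.move R _ hW) (congr($(he n') _).symm.trans hom')).trans ?_
    refine (map_add (Res.move R (inter_le (U := U) (List.mem_cons_self (a := i) (l := [i]))) hW
      (M := (F.obj i).X n')) _ _).trans (congr_arg (· + _) ?_)
    refine (Res.move_move R hi hW' hW z).trans (Res.move_self z)

include hR P in
-- If `c_i` is a boundary, so is `c_{τ j}` on the overlap; hence `c_{τ j} = m + d v` with `m` killed
-- by some f that is 1 on the overlap. By the homotopy formula `μ j • c` is a boundary plus the
-- spread of `m`, and the latter is killed by some g that is 1 on U_i. Summation over j finishes.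
theorem TwistedComplex.exists_smul_eq_secDiff (i : ι) (h : n + 1 = n') (h' : n' + 1 = n'')
    (c : Sec F.obj n') (hc : F.secDiff h' c = 0)
    (w : Res R (inter_le (U := U) (List.mem_singleton_self i)) ((F.obj i).X n))
    (hw : c.vertex i = Res.map R _ ((F.obj i).d n n').hom w) :
    ∃ f : R.obj (op ⊤), rho R (le_top : inter U [i] ≤ ⊤) f = 1 ∧
      ∃ t, f • c = F.secDiff h t := by
  -- Modulo boundaries the claim is membership in the submodule `vanishing`, so each `μ j • c` can
  -- be treated separately.
  let Q := Sec F.obj n' ⧸ LinearMap.range (F.secDiff h)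
  have key : ∀ j, (LinearMap.range (F.secDiff h)).mkQ (P.μ j • c) ∈
      vanishing hR (inter U [i]) le_top Q := by
    intro j
    have hW : inter U [P.τ j, i] ≤ inter U [P.τ j] := inter_mono (by simp)
    have hW' : inter U [P.τ j, i] ≤ inter U [i] := inter_mono (by simp)
    have hτ := inter_le (U := U) (List.mem_singleton_self (P.τ j))
    have hi := inter_le (U := U) (List.mem_singleton_self i)
    have e1 := F.move_vertex h h' c hc (P.τ j) i le_rfl hW hW'
    have e2 : Res.move R hi hW' (Sec.vertex i c) = Res.map R (hW'.trans hi)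
        ((F.obj i).d n n').hom (Res.move R hi hW' w) := by
      rw [Res.map_move]
      exact congr_arg _ hw
    rw [e2, F.ev_edge_d h le_rfl (hW.trans hτ), ← map_sub] at e1
    obtain ⟨v, hv⟩ := Res.move_surjective hR hτ hW
      (F.a.ev (p := 1) (l := [P.τ j, i]) (x := i) (y := P.τ j) (n := n) (m := n) rfl rfl rfl rfl
        le_rfl (Res.move R hi hW' w) -
      Sec.ev c (p := 1) (l := [P.τ j, i]) (x := P.τ j) (m := n) rfl rfl h le_rfl)
    rw [← hv, Res.map_move, ← sub_eq_zero, ← map_sub] at e1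
    obtain ⟨f, hf, hfm⟩ := Res.move_eq_zero hR hτ hW e1
    -- Over U_i, `μ j` is supported in the overlap, where `f` is 1. Purity turns the vanishing of `μ
    -- j * (1 - f)` on U_i into a global annihilator `g`.
    have hμ := P.rho_μ_mul j (V := inter U [P.τ j, i]) (W := inter U [i])
      ((P.inter_inf_le j [i]).trans (inter_mono (by simp))) (1 - f)
      (by rw [map_sub, hf, map_one, sub_self])
    obtain ⟨g, hg, hgμ⟩ := hR.pure _ _ hμ
    refine ⟨g, hg, ?_⟩
    rw [rho_self, ← map_smul, Submodule.mkQ_apply, Submodule.Quotient.mk_eq_zero]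
    set m := Sec.vertex (P.τ j) c - Res.map R hτ ((F.obj (P.τ j)).d n n').hom v with hm
    have hm' : rho R (le_top : inter U [P.τ j] ≤ ⊤) (1 - f) • m = m := by
      rw [map_sub, sub_smul, hfm, map_one, one_smul, sub_zero]
    have hgm : g • F.spread hR P j m = 0 := by
      rw [← hm']
      exact F.smul_spread_eq_zero hR P j hgμ m
    have e3 := F.secDiff_contract hR P j h h' c
    have e4 : Sec.vertex (P.τ j) c = m + Res.map R hτ ((F.obj (P.τ j)).d n n').hom v := by
      rw [hm, sub_add_cancel]
    rw [hc, Sec.contract_zero, add_zero, e4, F.spread_add, ← F.secDiff_spread hR P h] at e3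
    refine ⟨g • (F.spread hR P j v - Sec.contract hR P j h c), ?_⟩
    rw [map_smul, map_sub, eq_sub_of_add_eq' e3, smul_sub, smul_sub, smul_add, hgm]
    abel
  have : (LinearMap.range (F.secDiff h)).mkQ c ∈ vanishing hR (inter U [i]) le_top Q := by
    have : c = ∑ j, P.μ j • c := by
      rw [← Finset.sum_smul, P.sum_μ, one_smul]
    rw [this, map_sum]
    exact Submodule.sum_mem _ fun j _ => key j
  obtain ⟨f, hf, hfc⟩ := this
  rw [rho_self, ← map_smul, Submodule.mkQ_apply, Submodule.Quotient.mk_eq_zero] at hfc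
  obtain ⟨t, ht⟩ := hfc
  exact ⟨f, hf, t, ht.symm⟩

include hR P in
-- Let `a_{ii} y = z + d w`. The spread of a cycle over U_{τ j} that restricts to `a_{τ j, i} y` is
-- a cocycle. Its value at i is `μ j a_{i, τ j} a_{τ j, i} y`, which is `μ j a_{ii} y` up to a
-- boundary; the sum over j represents the class of `z`.
theorem TwistedComplex.exists_vertex_eq_add (i : ι) (h : n + 1 = n')
    (z : Res R (inter_le (U := U) (List.mem_singleton_self i)) ((F.obj i).X n'))
    (hz : Res.map R _ ((F.obj i).d n' (n' + 1)).hom z = 0) :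
    ∃ c : Sec F.obj n', F.secDiff rfl c = 0 ∧
      ∃ w, c.vertex i = z + Res.map R _ ((F.obj i).d n n').hom w := by
  have hi := inter_le (U := U) (List.mem_singleton_self i)
  obtain ⟨y, hy, w, hw⟩ := F.exists_loop_eq h i (W := inter U [i])
    (inter_mono (by simp)) (inter_mono (by simp)) hi z hz
  have key : ∀ j, ∃ c : Sec F.obj n', F.secDiff rfl c = 0 ∧
      ∃ v, c.vertex i = rho R (le_top : inter U [i] ≤ ⊤) (P.μ j) •
        F.a.ev (p := 1) (l := [i, i]) (x := i) (y := i) (n := n') (m := n') rfl rfl rfl rfl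
          (inter_mono (by simp)) y - Res.map R hi ((F.obj i).d n n').hom v := by
    intro j
    have hτ := inter_le (U := U) (List.mem_singleton_self (P.τ j))
    have h1 : inter U [P.τ j, i] ≤ inter U [i] := inter_mono (by simp)
    have h2 : inter U [P.τ j, i] ≤ inter U [P.τ j] := inter_mono (by simp)
    have h3 : inter U ([i] ++ [P.τ j]) ≤ inter U [P.τ j, i] := inter_mono (by simp)
    obtain ⟨x, hx, hxy⟩ := Res.exists_cycle_lift hR (h := hτ) h2 ((F.obj (P.τ j)).d n' (n' + 1)).hom
      (F.a.ev (p := 1) (l := [P.τ j, i]) (x := i) (y := P.τ j) (n := n') (m := n') rfl rfl rfl rfl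
        le_rfl (Res.move R hi h1 y)) (by
          rw [← F.ev_edge_d rfl le_rfl (h2.trans hτ) (h1.trans hi), Res.map_move, hy, map_zero,
            map_zero])
    have e1 := F.ev_triangle (i := i) (j := P.τ j) (k := i) h (W := inter U ([i] ++ [P.τ j]))
      (inter_mono (by simp)) le_rfl h3 (inter_mono (by simp)) ((h3.trans h1).trans hi)
      ((h3.trans h1).trans hi) (Res.move R hi (h3.trans h1) y)
      (by rw [Res.map_move, hy, map_zero])
    refine ⟨F.spread hR P j x, ?_, ?_⟩
    · rw [F.secDiff_spread, hx]
      ext s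
      change (-1 : ℤ) ^ s.p • P.extend hR j _ _ _ (F.a.ev _ _ _ _ _ (Res.move R _ _ 0)) = 0
      rw [map_zero, map_zero, map_zero, smul_zero]
    · have e2 : Res.move R hτ (h3.trans h2) x = F.a.ev (p := 1) (l := [P.τ j, i]) (x := i)
          (y := P.τ j) (n := n') (m := n') rfl rfl rfl rfl h3 (Res.move R hi (h3.trans h1) y) := by
        rw [← Res.move_move R hτ h2 h3, hxy]
        refine (Cochain.ev_move F.a _ _ _ _ _ h3 _).symm.trans ?_
        exact congr_arg _ (Res.move_move R hi h1 h3 y)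
      let hle := inter_append_le (U := U) [i] (P.τ j)
      let hO := P.inter_inf_le j [i]
      have e3 : (F.spread hR P j x).vertex i = P.extend hR j hle hO hi
          (F.a.ev (p := 1) (l := [i] ++ [P.τ j]) (x := P.τ j) (y := i) (n := n') (m := n')
            rfl rfl rfl rfl le_rfl (Res.move R hτ (h3.trans h2) x)) :=
        one_smul ℤ _
      refine ⟨P.extend hR j hle hO hi (F.a.ev (p := 2) (l := [i, P.τ j, i]) (x := i) (y := i)
        (n := n') (m := n) rfl rfl rfl (by push_cast; omega) (inter_mono (by simp))
        (Res.move R hi (h3.trans h1) y)), ?_⟩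
      rw [e3, e2]
      refine (congr_arg (P.extend hR j hle hO hi) e1).trans ((map_sub _ _ _).trans ?_)
      refine congr_arg₂ (· - ·) ?_ ?_
      · refine Eq.trans (congr_arg _ ?_) (P.extend_move hR j hle hO hi _)
        exact Cochain.ev_move F.a _ _ _ _ _ hle y
      · refine Eq.trans (congr_arg _ ?_) (P.extend_moveHom hR j hle hO hi hi
          (Res.map R hi ((F.obj i).d n n').hom) _)
        exact congr($((Res.moveHom_map hle _).symm) _)
  choose c hc v hv using key
  refine ⟨∑ j, c j, by rw [map_sum]; exact Finset.sum_eq_zero fun j _ => hc j, w - ∑ j, v j, ?_⟩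
  have : (∑ j, c j).vertex i = ∑ j, (c j).vertex i := Sec.sum_apply _ _ _
  rw [this, Finset.sum_congr rfl fun j _ => hv j, Finset.sum_sub_distrib, ← Finset.sum_smul,
    ← map_sum, P.sum_μ, map_one, one_smul, hw, map_sub, map_sum]
  abel

include hR P in
theorem TwistedComplex.isLocalModel_toVertex (i : ι) : IsLocalModel (F.toVertex i) where
  comm n c := (congr_arg _ (F.sheafification_d rfl c)).trans (F.vertex_secDiff rfl i c)
  inj n c hc w hw := by
    obtain ⟨f, hf, t, ht⟩ := F.exists_smul_eq_secDiff hR P i rfl rfl c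
      ((F.sheafification_d rfl c).symm.trans hc) w hw
    exact ⟨f, hf, t, ht.trans (F.sheafification_d rfl t).symm⟩
  surj n z hz := by
    obtain ⟨c, hc, w, hw⟩ := F.exists_vertex_eq_add hR P i rfl z hz
    exact ⟨c, (F.sheafification_d rfl c).trans hc, w, hw⟩

end LocalModel

end TwistedDescent

end

noncomputable section

namespace TwistedDescent

/-! ### The dg-category of twisted complexes -/

/-- Reindexing for the Leibniz rule: omitting an interior index and then cutting the tuple amounts
to cutting the full tuple and omitting an interior index of its front or of its back piece. -/
theorem sum_leibniz_interior {M : Type*} [AddCommGroup M] (p : ℕ)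
    (f : ∀ a k, a < p - 1 → k < p → M) :
    ∑ a : Fin (p - 1), ∑ k : Fin (p - 1 + 1), f a.1 k.1 a.2 (by have := a.2; omega) =
      ∑ i : Fin (p + 1), ∑ t : Fin (i.1 - 1), f t.1 (i.1 - 1) (by have := t.2; have := i.2; omega)
        (by have := t.2; have := i.2; omega) +
      ∑ k : Fin (p + 1), ∑ t : Fin (p - k.1 - 1), f (k.1 + t.1) k.1 (by have := t.2; omega)
        (by have := t.2; omega) := by
  let g : ℕ → ℕ → M := fun a k => if h : a < p - 1 ∧ k < p then f a k h.1 h.2 else 0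
  have hg : ∀ k j h1 h2, g k j = f k j h1 h2 := fun k j h1 h2 => dif_pos ⟨h1, h2⟩
  rw [sum_fin_eq (p - 1) (fun a ha => ∑ k : Fin (p - 1 + 1), f a k.1 ha (by omega))
      (fun a => ∑ k ∈ Finset.range p, g a k)
      (fun a ha => by
        have e : p - 1 + 1 = p := by omega
        rw [sum_fin_eq (p - 1 + 1) (fun k hk => f a k ha (by omega)) (g a)
          fun k hk => hg a k ha (by omega), e]),
    sum_fin_eq (p + 1) (fun i hi => ∑ t : Fin (i - 1), f t.1 (i - 1) (by have := t.2; omega)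
        (by have := t.2; omega))
      (fun i => ∑ t ∈ Finset.range (i - 1), g t (i - 1))
      (fun i hi => (sum_fin_eq _ (fun t ht => f t (i - 1) (by omega) (by omega))
        (fun t => g t (i - 1)) fun k hk => hg k (i - 1) (by omega) (by omega)).symm),
    sum_fin_eq (p + 1) (fun k hk => ∑ t : Fin (p - k - 1), f (k + t.1) k (by have := t.2; omega)
        (by have := t.2; omega))
      (fun k => ∑ t ∈ Finset.range (p - k - 1), g (k + t) k)
      (fun k hk => (sum_fin_eq _ (fun t ht => f (k + t) k (by omega) (by omega))
        (fun t => g (k + t) k) fun t ht => hg (k + t) k (by omega) (by omega)).symm),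
    Finset.sum_sigma', Finset.sum_sigma', Finset.sum_sigma',
    ← Finset.sum_filter_add_sum_filter_not _ (fun x : (_ : ℕ) × ℕ => x.1 < x.2)]
  congr 1
  · refine Finset.sum_bij' (fun x _ => ⟨x.2 + 1, x.1⟩) (fun x _ => ⟨x.2, x.1 - 1⟩) ?_ ?_ ?_ ?_ ?_
    all_goals
      rintro ⟨a, b⟩ hab
      simp only [Finset.mem_filter, Finset.mem_sigma, Finset.mem_range] at hab ⊢
    · omega
    · omega
    · simp
    · simp; omega
    · simp
  · refine Finset.sum_bij' (fun x _ => ⟨x.2, x.1 - x.2⟩) (fun x _ => ⟨x.1 + x.2, x.1⟩) ?_ ?_ ?_ ?_ ?_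
    all_goals
      rintro ⟨a, b⟩ hab
      simp only [Finset.mem_filter, Finset.mem_sigma, Finset.mem_range] at hab ⊢
    · omega
    · omega
    · simp; omega
    · simp
    · congr 1; omega

/-! ### Associativity and the Leibniz rule for cochains -/

section Calculus

variable {X : TopCat.{u}} {R : (Opens X)ᵒᵖ ⥤ RingCat.{u}} {ι : Type u} {U : ι → Opens X}
  {E F G H : ∀ i, Cpx R (U i)} {n m d d' e e' f f' : ℤ}

namespace Cochain

theorem ev_congr (u : Cochain E F d) {p p' : ℕ} {l l' : List ι} {x y : ι}
    (hl : l.length = p + 1) (hx : l.getLast? = some x) (hy : l.head? = some y) (hd : n + d = m + p)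
    (hl' : l'.length = p' + 1) (hx' : l'.getLast? = some x) (hy' : l'.head? = some y)
    (hd' : n + d = m + p') {W : Opens X} (hW : W ≤ inter U l) (hW' : W ≤ inter U l') (h : l = l') :
    u.ev hl hx hy hd hW = u.ev hl' hx' hy' hd' hW' := by
  subst h
  obtain rfl : p = p' := by omega
  rfl

theorem ev_ev_ev_congr (u : Cochain G H d) (v : Cochain F G e) (w : Cochain E F f)
    {p q r p' q' r' : ℕ} {l₁ l₂ l₃ l₁' l₂' l₃' : List ι}
    {x y z z' w₁ w₁' : ι} {μ μ' ν ν' : ℤ}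
    (h1 : l₁.length = p + 1) (h2 : l₁.getLast? = some z) (h3 : l₁.head? = some y)
    (h4 : μ + d = m + p)
    (g1 : l₂.length = q + 1) (g2 : l₂.getLast? = some w₁) (g3 : l₂.head? = some z)
    (g4 : ν + e = μ + q) (h5 : l₃.length = r + 1) (h6a : l₃.getLast? = some x)
    (h6 : l₃.head? = some w₁) (h7 : n + f = ν + r)
    (h1' : l₁'.length = p' + 1) (h2' : l₁'.getLast? = some z') (h3' : l₁'.head? = some y)
    (h4' : μ' + d = m + p')
    (g1' : l₂'.length = q' + 1) (g2' : l₂'.getLast? = some w₁') (g3' : l₂'.head? = some z')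
    (g4' : ν' + e = μ' + q') (h5' : l₃'.length = r' + 1) (h6a' : l₃'.getLast? = some x)
    (h6' : l₃'.head? = some w₁')
    (h7' : n + f = ν' + r') {W : Opens X} (hW₁ : W ≤ inter U l₁) (hW₂ : W ≤ inter U l₂)
    (hW₃ : W ≤ inter U l₃) (hW₁' : W ≤ inter U l₁') (hW₂' : W ≤ inter U l₂')
    (hW₃' : W ≤ inter U l₃') (e₁ : l₁ = l₁') (e₂ : l₂ = l₂') (e₃ : l₃ = l₃')
    (a : Res R (le_of_getLast h6a hW₃) ((E x).X n)) :
    u.ev h1 h2 h3 h4 hW₁ (v.ev g1 g2 g3 g4 hW₂ (w.ev h5 h6a h6 h7 hW₃ a)) =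
      u.ev h1' h2' h3' h4' hW₁' (v.ev g1' g2' g3' g4' hW₂' (w.ev h5' h6a' h6' h7' hW₃' a)) := by
  subst e₁ e₂ e₃
  obtain rfl : p = p' := by omega
  obtain rfl : q = q' := by omega
  obtain rfl : r = r' := by omega
  obtain rfl : μ = μ' := by omega
  obtain rfl : ν = ν' := by omega
  obtain rfl : z = z' := Option.some.inj (h2.symm.trans h2')
  obtain rfl : w₁ = w₁' := Option.some.inj (g2.symm.trans g2')
  rfl

/-- Cochains are determined by the values of their components. -/
theorem ext_ev {u v : Cochain E F d} (h : ∀ {p : ℕ} {l : List ι} {x y : ι} {n m : ℤ}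
    (hl : l.length = p + 1) (hx : l.getLast? = some x) (hy : l.head? = some y)
    (hd : n + d = m + p) (z : Res R (le_of_getLast hx (le_refl (inter U l))) ((E x).X n)),
    u.ev hl hx hy hd le_rfl z = v.ev hl hx hy hd le_rfl z) : u = v := by
  ext1 s
  obtain ⟨p, l, x, y, n, m, hl, hx, hy, hd⟩ := s
  refine LinearMap.ext fun z => ?_
  have := h hl hx hy hd z
  rwa [ev, Res.moveHom_self, ev, Res.moveHom_self] at this

theorem ev_add (u v : Cochain E F d) {p : ℕ} {l : List ι} {x y : ι}
    (hl : l.length = p + 1) (hx : l.getLast? = some x) (hy : l.head? = some y) (hd : n + d = m + p)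
    {W : Opens X} (hW : W ≤ inter U l) :
    (u + v).ev hl hx hy hd hW = u.ev hl hx hy hd hW + v.ev hl hx hy hd hW :=
  Res.moveHom_add R hW _ _

theorem ev_zsmul (k : ℤ) (u : Cochain E F d) {p : ℕ} {l : List ι} {x y : ι}
    (hl : l.length = p + 1) (hx : l.getLast? = some x) (hy : l.head? = some y) (hd : n + d = m + p)
    {W : Opens X} (hW : W ≤ inter U l) :
    (k • u).ev hl hx hy hd hW = k • u.ev hl hx hy hd hW :=
  map_zsmul (Res.moveHomAdd R _ _ _ _ hW) k _

theorem comp_add (h : d + e = f) (u : Cochain F G d) (v v' : Cochain E F e) :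
    comp h u (v + v') = comp h u v + comp h u v' := by
  refine ext_ev fun hl hx hy hd z => ?_
  rw [ev_add, LinearMap.add_apply]
  simp only [ev_comp_apply, ev_add, LinearMap.add_apply, map_add, smul_add,
    Finset.sum_add_distrib]

theorem add_comp (h : d + e = f) (u u' : Cochain F G d) (v : Cochain E F e) :
    comp h (u + u') v = comp h u v + comp h u' v := by
  refine ext_ev fun hl hx hy hd z => ?_
  rw [ev_add, LinearMap.add_apply]
  simp only [ev_comp_apply, ev_add, LinearMap.add_apply, smul_add,
    Finset.sum_add_distrib]

theorem cech_add (h : d + 1 = e) (u v : Cochain E F d) :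
    cech h (u + v) = cech h u + cech h v := by
  refine ext_ev fun hl hx hy hd z => ?_
  rw [ev_add, LinearMap.add_apply]
  simp only [ev_cech_apply, ev_add, LinearMap.add_apply, smul_add, Finset.sum_add_distrib]

theorem comp_assoc (h₁ : d + e = d') (h₂ : e + f = f') (h₃ : d' + f = e') (h₄ : d + f' = e')
    (u : Cochain G H d) (v : Cochain F G e) (w : Cochain E F f) :
    comp h₃ (comp h₁ u v) w = comp h₄ u (comp h₂ v w) := by
  refine ext_ev fun {p l x y n m} hl hx hy hd z => ?_
  simp only [ev_comp_apply, map_sum, map_zsmul, Finset.smul_sum, smul_smul]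
  refine ((sum_front_back (M := Res R (le_of_head (U := U) hy le_rfl) ((H y).X m)) p
    (fun k j hk hj =>
    ((Int.negOnePow ((d - k) * (p - k : ℕ)) : ℤ) *
      (Int.negOnePow ((e - j) * (p - k - j : ℕ)) : ℤ)) •
    u.ev (n := n + f' - (p - k : ℕ)) (m := m) (length_front hl hk)
      (getLast_front (by omega)) (head_front hy) (by omega)
      (inter_mono (List.take_subset (k + 1) l))
      (v.ev (n := n + f - (p - k - j : ℕ)) (length_front (length_back hl hk) hj)
        (getLast_front (by rw [length_back hl hk]; exact hj))
        (head_front (head_back (by omega))) (by omega)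
        ((inter_mono (List.drop_subset k l)).trans (inter_mono (List.take_subset (j + 1) _)))
        (w.ev (length_back (length_back hl hk) hj)
          (getLast_back (by rw [length_back hl hk]; exact hj) (getLast_back (by omega) hx))
          (head_back (by rw [length_back hl hk]; exact hj)) (by omega)
          ((inter_mono (List.drop_subset k l)).trans (inter_mono (List.drop_subset j _)))
          z)))).trans ?_).symm
  refine Finset.sum_congr rfl fun i _ => Finset.sum_congr rfl fun k _ => ?_
  congr 1
  · rw [← Units.val_mul, ← Units.val_mul, ← Int.negOnePow_add, ← Int.negOnePow_add]
    congr 2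
    have := i.2
    have := k.2
    rw [← h₁]
    push_cast [Nat.cast_sub (show k.1 ≤ p by omega), Nat.cast_sub (show k.1 ≤ i.1 by omega),
      Nat.cast_sub (show i.1 ≤ p by omega), show p - k.1 - (i.1 - k.1) = p - i.1 by omega]
    ring
  · apply ev_ev_ev_congr
    · rw [List.take_take]; congr 1; omega
    · rw [List.drop_take]; congr 1; omega
    · rw [List.drop_drop]; congr 1; omega

theorem cech_cech (h : d + 1 = d') (h' : d' + 1 = e) (u : Cochain E F d) :
    cech h' (cech h u) = 0 := by
  refine ext_ev fun {p l x y n m} hl hx hy hd z => ?_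
  have e0 : (0 : Cochain E F e).ev hl hx hy hd le_rfl z = 0 :=
    congr($(Res.moveHom_zero R le_rfl) z)
  rw [e0]
  simp only [ev_cech_apply, Finset.smul_sum, smul_smul]
  refine sum_cancel (M := Res R (le_of_head (U := U) hy le_rfl) ((F y).X m)) (p - 1)
    (fun a b ha hb => ((-1 : ℤ) ^ (a + 1) * (-1) ^ (b + 1)) •
    u.ev (n := n) (m := m) (length_face (length_face hl (by omega)) (by omega))
      (getLast_face (length_face hl (by omega)) hb (getLast_face hl ha hx))
      (head_face (head_face hy)) (by omega)
      ((inter_mono (List.eraseIdx_subset (l := l) (k := a + 1))).trans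
        (inter_mono (List.eraseIdx_subset (k := b + 1)))) z) ?_
  intro a b ha hb
  have : (-1 : ℤ) ^ (b + 1) * (-1) ^ (a - 1 + 1) = - ((-1 : ℤ) ^ (a + 1) * (-1) ^ (b + 1)) := by
    rw [show a - 1 + 1 = a by omega, pow_succ _ a]
    ring
  rw [this, neg_smul, add_neg_eq_zero]
  congr 1
  refine congr($(ev_congr u _ _ _ _ _ _ _ _ _ _ ?_) z)
  apply List.ext_getElem?
  intro i
  simp only [List.getElem?_eraseIdx]
  split_ifs <;> first | rfl | omega

theorem cech_comp (h : d + e = f) (hd' : d + 1 = d') (he' : e + 1 = e') (hf' : f + 1 = f')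
    (u : Cochain F G d) (v : Cochain E F e) :
    cech hf' (comp h u v) = comp (by omega) (cech hd' u) v +
      (Int.negOnePow d : ℤ) • comp (by omega) u (cech he' v) := by
  refine ext_ev fun {p l x y n m} hl hx hy hd z => ?_
  rw [ev_add, LinearMap.add_apply, ev_zsmul, LinearMap.smul_apply]
  simp only [ev_comp_apply, ev_cech_apply, map_sum, map_zsmul, Finset.smul_sum, smul_smul]
  refine (sum_leibniz_interior (M := Res R (le_of_head (U := U) hy le_rfl) ((G y).X m)) p
    (fun a k ha hk =>
    ((-1 : ℤ) ^ (a + 1) * (Int.negOnePow ((d - k) * (p - 1 - k : ℕ)) : ℤ)) •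
    u.ev (n := n + e - (p - 1 - k : ℕ)) (m := m) (length_front (length_face hl (by omega)) (by omega))
      (getLast_front (by rw [length_face hl (by omega)]; omega)) (head_front (head_face hy))
      (by omega)
      ((inter_mono (List.eraseIdx_subset (l := l) (k := a + 1))).trans
        (inter_mono (List.take_subset (k + 1) _)))
      (v.ev (length_back (length_face hl (by omega)) (by omega))
        (getLast_back (by rw [length_face hl (by omega)]; omega) (getLast_face hl ha hx))
        (head_back (by rw [length_face hl (by omega)]; omega)) (by omega)
        ((inter_mono (List.eraseIdx_subset (l := l) (k := a + 1))).trans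
          (inter_mono (List.drop_subset k _))) z))).trans ?_
  congr 1
  · refine Finset.sum_congr rfl fun i _ => Finset.sum_congr rfl fun t _ => ?_
    have := i.2
    have := t.2
    congr 1
    · rw [mul_comm]
      congr 3
      rw [← hd']
      push_cast [Nat.cast_sub (show 1 ≤ i.1 by omega), Nat.cast_sub (show i.1 ≤ p by omega),
        show p - 1 - (i.1 - 1) = p - i.1 by omega]
      ring
    · apply ev_ev_congr
      · apply List.ext_getElem?
        intro j
        simp only [List.getElem?_eraseIdx, List.getElem?_take]
        split_ifs <;> first | rfl | omega
      · apply List.ext_getElem?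
        intro j
        simp only [List.getElem?_eraseIdx, List.getElem?_drop]
        split_ifs <;> first | omega | (congr 1; omega)
  · refine Finset.sum_congr rfl fun k _ => Finset.sum_congr rfl fun t _ => ?_
    have := k.2
    have := t.2
    congr 1
    · have hpow : ∀ j : ℕ, (-1 : ℤ) ^ j = (Int.negOnePow (j : ℤ) : ℤ) := by
        intro j
        simp [Int.negOnePow]
      rw [hpow, hpow]
      simp only [← Units.val_mul, ← Int.negOnePow_add]
      congr 1
      rw [Int.negOnePow_eq_iff]
      refine ⟨(k.1 : ℤ) - d, ?_⟩
      push_cast [Nat.cast_sub (show k.1 ≤ p by omega), Nat.cast_sub (show 1 ≤ p by omega),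
        Nat.cast_sub (show k.1 ≤ p - 1 by omega)]
      ring
    · apply ev_ev_congr
      · apply List.ext_getElem?
        intro j
        simp only [List.getElem?_eraseIdx, List.getElem?_take]
        split_ifs <;> first | rfl | omega
      · apply List.ext_getElem?
        intro j
        simp only [List.getElem?_eraseIdx, List.getElem?_drop]
        split_ifs <;> first | omega | congr 1

end Cochain

end Calculus

end TwistedDescent

end

noncomputable section

namespace TwistedDescent

/-! ### The unit for the product of cochains -/

section Identity

variable {X : TopCat.{u}} {R : (Opens X)ᵒᵖ ⥤ RingCat.{u}} {ι : Type u} {U : ι → Opens X}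
  {E F G H : ∀ i, Cpx R (U i)} {n m d d' e e' f f' : ℤ}

namespace Cochain

theorem moveHom_castRes {V W : Opens X} {i j : ι} (hij : i = j) (hnm : n = m)
    (hi : V ≤ U i) (hj : V ≤ U j) (hW : W ≤ V) :
    Res.moveHom R hW (castRes E hij hnm hi hj) =
      castRes E hij hnm (hW.trans hi) (hW.trans hj) := by
  subst hij hnm
  apply Res.hom_ext
  intro a
  exact (Res.moveHom_unit R hW _ a).trans (Res.move_unit R _ hW a)

theorem ev_one_of_eq {p : ℕ} {l : List ι} {x y : ι} (hl : l.length = p + 1)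
    (hx : l.getLast? = some x) (hy : l.head? = some y) (hd : n + 0 = m + p)
    {W : Opens X} (hW : W ≤ inter U l) (hp : p = 0) (hxy : x = y) :
    (one E).ev hl hx hy hd hW = castRes E hxy (by omega) (le_of_getLast hx hW) (le_of_head hy hW) := by
  subst hp
  refine Eq.trans ?_ (moveHom_castRes hxy _ (le_of_getLast hx le_rfl) (le_of_head hy le_rfl) hW)
  exact congr_arg (Res.moveHom R hW) (dif_pos rfl)

theorem ev_one_of_ne {p : ℕ} {l : List ι} {x y : ι} (hl : l.length = p + 1)
    (hx : l.getLast? = some x) (hy : l.head? = some y) (hd : n + 0 = m + p)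
    {W : Opens X} (hW : W ≤ inter U l) (hp : p ≠ 0) :
    (one E).ev hl hx hy hd hW = 0 :=
  (congr_arg (Res.moveHom R hW) (dif_neg hp)).trans (Res.moveHom_zero R hW)

theorem ev_castRes (u : Cochain E F d) {p p' : ℕ} {l l' : List ι} {x x' y : ι} {n' : ℤ}
    (hl : l.length = p + 1) (hx : l.getLast? = some x) (hy : l.head? = some y) (hd : n + d = m + p)
    (hl' : l'.length = p' + 1) (hx' : l'.getLast? = some x') (hy' : l'.head? = some y)
    (hd' : n' + d = m + p')
    {W : Opens X} (hW : W ≤ inter U l) (hW' : W ≤ inter U l') (h : l = l') (hxx : x' = x)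
    (hn : n' = n) (z : Res R (le_of_getLast hx' hW') ((E x').X n')) :
    u.ev hl hx hy hd hW (castRes E hxx hn _ _ z) = u.ev hl' hx' hy' hd' hW' z := by
  subst h hxx hn
  obtain rfl : p = p' := by omega
  rfl

theorem castRes_ev (u : Cochain E F d) {p p' : ℕ} {l l' : List ι} {x y y' : ι} {m' : ℤ}
    (hl : l.length = p + 1) (hx : l.getLast? = some x) (hy : l.head? = some y) (hd : n + d = m + p)
    (hl' : l'.length = p' + 1) (hx' : l'.getLast? = some x) (hy' : l'.head? = some y')
    (hd' : n + d = m' + p')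
    {W : Opens X} (hW : W ≤ inter U l) (hW' : W ≤ inter U l') (h : l = l') (hyy : y = y')
    (hm : m = m') (z : Res R (le_of_getLast hx hW) ((E x).X n)) :
    castRes F hyy hm _ (le_of_head hy' hW') (u.ev hl hx hy hd hW z) = u.ev hl' hx' hy' hd' hW' z := by
  subst h hyy hm
  obtain rfl : p = p' := by omega
  rfl

theorem comp_one (h : d + 0 = d) (u : Cochain E F d) : comp h u (one E) = u := by
  refine ext_ev fun {p l x y n m} hl hx hy hd z => ?_
  rw [ev_comp_apply, Fin.sum_univ_castSucc, Finset.sum_eq_zero, zero_add]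
  · have hx' : l[p]'(by omega) = x := by
      rw [List.getLast?_eq_getElem?, hl, Nat.add_sub_cancel, List.getElem?_eq_getElem (by omega)] at hx
      exact Option.some.inj hx
    rw [ev_one_of_eq _ _ _ _ _ (by simp) hx'.symm]
    have hs : (Int.negOnePow ((d - (Fin.last p).1) * (p - (Fin.last p).1 : ℕ)) : ℤ) = 1 := by simp
    rw [hs, one_smul]
    apply ev_castRes
    simp [← hl]
  · intro k _
    have : p - k.1 ≠ 0 := by have := k.2; omega
    rw [ev_one_of_ne _ _ _ _ _ this, LinearMap.zero_apply, map_zero, smul_zero]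

theorem one_comp (h : 0 + d = d) (u : Cochain E F d) : comp h (one F) u = u := by
  refine ext_ev fun {p l x y n m} hl hx hy hd z => ?_
  rw [ev_comp_apply, Fin.sum_univ_succ, Finset.sum_eq_zero, add_zero]
  · have hy' : l[0]'(by omega) = y := by
      rw [List.head?_eq_getElem?, List.getElem?_eq_getElem (by omega)] at hy
      exact Option.some.inj hy
    have hs : (Int.negOnePow ((0 - (0 : Fin (p + 1)).1) * (p - (0 : Fin (p + 1)).1 : ℕ)) : ℤ) = 1 := by
      simp
    refine (congr_arg₂ (· • ·) hs congr($(ev_one_of_eq (E := F) _ _ _ _ _ rfl hy') _)).trans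
      ((one_smul ℤ _).trans ?_)
    apply castRes_ev
    simp
  · intro k _
    rw [ev_one_of_ne _ _ _ _ _ (by simp), LinearMap.zero_apply, smul_zero]

theorem cech_one (h : (0 : ℤ) + 1 = d) : cech h (one E) = 0 := by
  refine ext_ev fun {p l x y n m} hl hx hy hd z => ?_
  have e0 : (0 : Cochain E E d).ev hl hx hy hd le_rfl z = 0 :=
    congr($(Res.moveHom_zero R le_rfl) z)
  rw [ev_cech_apply, e0]
  refine Finset.sum_eq_zero fun k _ => ?_
  rw [ev_one_of_ne _ _ _ _ _ (by have := k.2; omega), LinearMap.zero_apply, smul_zero]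

end Cochain

end Identity

/-! ### The differential on morphisms -/

section DG

variable {X : TopCat.{u}} {R : (Opens X)ᵒᵖ ⥤ RingCat.{u}} {ι : Type u} {U : ι → Opens X}

namespace Cochain

variable {E F G : ∀ i, Cpx R (U i)} {d e f : ℤ}

/-- The product of cochains as a biadditive map. -/
def compHom (h : d + e = f) : Cochain F G d →+ Cochain E F e →+ Cochain E G f :=
  AddMonoidHom.mk' (fun u => AddMonoidHom.mk' (comp h u) (comp_add h u))
    fun u u' => AddMonoidHom.ext fun v => add_comp h u u' v

theorem comp_neg (h : d + e = f) (u : Cochain F G d) (v : Cochain E F e) :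
    comp h u (-v) = - comp h u v := map_neg (compHom h u) v

theorem comp_sub (h : d + e = f) (u : Cochain F G d) (v v' : Cochain E F e) :
    comp h u (v - v') = comp h u v - comp h u v' := map_sub (compHom h u) v v'

theorem comp_zsmul (h : d + e = f) (u : Cochain F G d) (k : ℤ) (v : Cochain E F e) :
    comp h u (k • v) = k • comp h u v := map_zsmul (compHom h u) k v

theorem comp_zero (h : d + e = f) (u : Cochain F G d) :
    comp h u (0 : Cochain E F e) = 0 := map_zero (compHom h u)

theorem sub_comp (h : d + e = f) (u u' : Cochain F G d) (v : Cochain E F e) :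
    comp h (u - u') v = comp h u v - comp h u' v := congr($(map_sub (compHom h) u u') v)

theorem zsmul_comp (h : d + e = f) (k : ℤ) (u : Cochain F G d) (v : Cochain E F e) :
    comp h (k • u) v = k • comp h u v := congr($(map_zsmul (compHom h) k u) v)

theorem zero_comp (h : d + e = f) (v : Cochain E F e) :
    comp h (0 : Cochain F G d) v = 0 := congr($(map_zero (compHom h)) v)

theorem cech_zsmul (h : d + 1 = e) (k : ℤ) (u : Cochain E F d) :
    cech h (k • u) = k • cech h u :=
  map_zsmul (AddMonoidHom.mk' (cech h) (cech_add h)) k u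

end Cochain

namespace TwistedComplex

open Cochain

variable {E F G : TwistedComplex R U} {d d' e e' f f' : ℤ}

theorem diff_add (h : d + 1 = e) (u v : Hom E F d) : diff h (u + v) = diff h u + diff h v := by
  simp only [diff, cech_add, comp_add, add_comp, smul_add]
  abel

/-- The differential as a homomorphism of groups. -/
def diffHom (h : d + 1 = e) : Hom E F d →+ Hom E F e := AddMonoidHom.mk' (diff h) (diff_add h)

theorem diff_neg (h : d + 1 = e) (u : Hom E F d) : diff h (-u) = - diff h u :=
  map_neg (diffHom h) u

theorem diff_sub (h : d + 1 = e) (u v : Hom E F d) : diff h (u - v) = diff h u - diff h v :=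
  map_sub (diffHom h) u v

theorem diff_zero (h : d + 1 = e) : diff h (0 : Hom E F d) = 0 := map_zero (diffHom h)

theorem diff_one (h : (0 : ℤ) + 1 = e) : diff h (one E.obj) = 0 := by
  obtain rfl : e = 1 := by omega
  simp only [diff, cech_one, comp_one, one_comp, Int.negOnePow_zero, Units.val_one,
    one_smul]
  abel

theorem negOnePow_mul_self (d : ℤ) : (Int.negOnePow d : ℤ) * (Int.negOnePow d : ℤ) = 1 := by
  rw [← Units.val_mul, ← Int.negOnePow_add, ← two_mul, Int.negOnePow_two_mul, Units.val_one]

theorem diff_comp (h : d + e = f) (hd : d + 1 = d') (he : e + 1 = e') (hf : f + 1 = f')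
    (u : Hom F G d) (v : Hom E F e) :
    diff hf (comp h u v) = comp (by omega) (diff hd u) v +
      (Int.negOnePow d : ℤ) • comp (by omega) u (diff he v) := by
  have hs : (Int.negOnePow f : ℤ) = Int.negOnePow d * Int.negOnePow e := by
    rw [← h, Int.negOnePow_add, Units.val_mul]
  simp only [diff, cech_comp h hd he hf, comp_add, comp_sub, add_comp, sub_comp, zsmul_comp,
    comp_zsmul, smul_add, smul_sub, smul_smul, hs]
  rw [comp_assoc (d := d) (e := 1) (f := e) (d' := d') (f' := e') hd (by omega) (by omega) (by omega),
    comp_assoc (d := 1) (e := d) (f := e) (d' := d') (f' := f) (by omega) h (by omega) (by omega),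
    comp_assoc (d := d) (e := e) (f := 1) (d' := f) (f' := e') h (by omega) (by omega) (by omega)]
  abel

/-- The square of the differential is multiplication by `δb + b·b` on the left minus multiplication
by `δa + a·a` on the right, where a, b are the twisting cochains of `E`, `F`; both are zero by the
Maurer–Cartan equation. -/
theorem diff_diff (h : d + 1 = d') (h' : d' + 1 = e) (u : Hom E F d) :
    diff h' (diff h u) = 0 := by
  have hs : (Int.negOnePow d' : ℤ) = - Int.negOnePow d := by
    rw [← h, Int.negOnePow_succ, Units.val_neg]
  have m1 : (comp (f := e) (by omega) (F.a.cech (e := 2) rfl) u : Cochain E.obj F.obj e) +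
      comp (by omega) (comp (f := 2) rfl F.a F.a) u = 0 := by
    rw [← add_comp, F.maurerCartan, zero_comp]
  have m2 : (comp (f := e) (by omega) u (E.a.cech (e := 2) rfl) : Cochain E.obj F.obj e) +
      comp (by omega) u (comp (f := 2) rfl E.a E.a) = 0 := by
    rw [← comp_add, E.maurerCartan, comp_zero]
  have c1 := cech_comp (f := d') (by omega) (d' := 2) rfl h h' F.a u
  have c2 := cech_comp (f := d') (by omega) h (e' := 2) rfl h' u E.a
  have a1 := comp_assoc (e' := e) (d' := 2) (f' := d') rfl (by omega) (by omega) (by omega) F.a F.a u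
  have a2 := comp_assoc (e' := e) (d' := d') (f' := 2) h (by omega) (by omega) (by omega) u E.a E.a
  have a3 := comp_assoc (e' := e) (d' := d') (f' := d') (by omega) (by omega) (by omega) (by omega)
    F.a u E.a
  simp only [diff, cech_add, sub_eq_add_neg, ← neg_smul, cech_zsmul, cech_cech, comp_add, add_comp,
    zsmul_comp, comp_zsmul, smul_add, smul_smul, hs, c1, c2, a3, a2, ← a1, Int.negOnePow_one,
    Units.val_neg, Units.val_one, neg_neg, neg_mul, mul_neg, negOnePow_mul_self]
  rw [eq_neg_of_add_eq_zero_left m1, eq_neg_of_add_eq_zero_left m2]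
  simp only [one_smul, neg_smul, smul_neg]
  abel

end TwistedComplex

end DG

end TwistedDescent

end

noncomputable section

namespace TwistedDescent

/-! ### Complete filtrations -/

section Filtration

variable {A B : Type*} [AddCommGroup A] [AddCommGroup B]

/-- A decreasing, exhaustive, separated and complete filtration of an abelian group. -/
structure IsCompleteFiltration (S : ℕ → AddSubgroup A) : Prop where
  zero : S 0 = ⊤
  anti (p : ℕ) : S (p + 1) ≤ S p
  separated (x : A) (hx : ∀ p, x ∈ S p) : x = 0
  complete (y : ℕ → A) (hy : ∀ p, y (p + 1) - y p ∈ S p) : ∃ z, ∀ p, z - y p ∈ S p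

variable {S : ℕ → AddSubgroup A} {T : ℕ → AddSubgroup B}

theorem IsCompleteFiltration.prod (hS : IsCompleteFiltration S) (hT : IsCompleteFiltration T) :
    IsCompleteFiltration fun p => (S p).prod (T p) where
  zero := by rw [hS.zero, hT.zero, AddSubgroup.top_prod_top]
  anti p := AddSubgroup.prod_mono (hS.anti p) (hT.anti p)
  separated x hx := Prod.ext (hS.separated _ fun p => (hx p).1) (hT.separated _ fun p => (hx p).2)
  complete y hy := by
    obtain ⟨z, hz⟩ := hS.complete (fun p => (y p).1) fun p => (hy p).1
    obtain ⟨w, hw⟩ := hT.complete (fun p => (y p).2) fun p => (hy p).2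
    exact ⟨(z, w), fun p => ⟨hz p, hw p⟩⟩

/-- Iterating `x = M x` pushes `x` into every step of a separated filtration. -/
theorem IsCompleteFiltration.injective_of_mem (hS : IsCompleteFiltration S) (M : A →+ A)
    (hM : ∀ p, ∀ x ∈ S p, M x ∈ S (p + 1)) {x : A} (hx : x = M x) : x = 0 := by
  refine hS.separated x fun p => ?_
  induction p with
  | zero => rw [hS.zero]; trivial
  | succ p ih => rw [hx]; exact hM p x ih

/-- The geometric series `∑ M^i x` converges by completeness. -/
theorem IsCompleteFiltration.exists_sub_eq (hS : IsCompleteFiltration S) (M : A →+ A)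
    (hM : ∀ p, ∀ x ∈ S p, M x ∈ S (p + 1)) (x : A) : ∃ z, z - M z = x := by
  have hpow : ∀ p, M^[p] x ∈ S p := by
    intro p
    induction p with
    | zero => rw [hS.zero]; trivial
    | succ p ih => rw [Function.iterate_succ_apply']; exact hM p _ ih
  have hsum : ∀ p, (∑ i ∈ Finset.range p, M^[i] x) - M (∑ i ∈ Finset.range p, M^[i] x) =
      x - M^[p] x := by
    intro p
    induction p with
    | zero => simp
    | succ p ih =>
      rw [Finset.sum_range_succ, map_add, Function.iterate_succ_apply', add_sub_add_comm, ih]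
      abel
  obtain ⟨z, hz⟩ := hS.complete (fun p => ∑ i ∈ Finset.range p, M^[i] x) fun p => by
    rw [Finset.sum_range_succ, add_sub_cancel_left]
    exact hpow p
  refine ⟨z, sub_eq_zero.1 (hS.separated _ fun p => ?_)⟩
  -- The error is expressed through the tail of the series and the p-th power, both in `S p`.
  have e : z - M z - x = (z - ∑ i ∈ Finset.range p, M^[i] x) -
      M (z - ∑ i ∈ Finset.range p, M^[i] x) - M^[p] x := by
    have := hsum p
    rw [map_sub]
    generalize (∑ i ∈ Finset.range p, M^[i] x) = a at this ⊢
    generalize M^[p] x = b at this ⊢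
    rw [eq_sub_iff_add_eq] at this
    rw [← this]
    abel
  rw [e]
  exact sub_mem (sub_mem (hz p) (hS.anti p (hM p _ (hz p)))) (hpow p)

theorem IsCompleteFiltration.eq_zero_of_add (hS : IsCompleteFiltration S) (N : A →+ A)
    (hN : ∀ p, ∀ x ∈ S p, N (N x) ∈ S (p + 1)) {x : A} (hx : x + N x = 0) : x = 0 := by
  refine hS.injective_of_mem (N.comp N) hN ?_
  have : N x = - x := (neg_eq_of_add_eq_zero_right hx).symm
  rw [AddMonoidHom.comp_apply, this, map_neg, this, neg_neg]

/-- Only the square of `N` raises the filtration. The series is therefore summed for N², and `1 - N²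
= (1 + N)(1 - N)`. -/
theorem IsCompleteFiltration.exists_add_eq (hS : IsCompleteFiltration S) (N : A →+ A)
    (hN : ∀ p, ∀ x ∈ S p, N (N x) ∈ S (p + 1)) (x : A) : ∃ z, z + N z = x := by
  obtain ⟨z, hz⟩ := hS.exists_sub_eq (N.comp N) hN x
  refine ⟨z - N z, ?_⟩
  rw [← hz, map_sub, AddMonoidHom.comp_apply]
  abel

end Filtration

/-! ### The Čech filtration and the correction of approximate homotopy inverses -/

section CochainFiltration

variable {X : TopCat.{u}} {R : (Opens X)ᵒᵖ ⥤ RingCat.{u}} {ι : Type u} {U : ι → Opens X}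

namespace Cochain

variable {E F G : ∀ i, Cpx R (U i)} {d e f : ℤ}

variable (E F d) in
/-- The cochains whose components with index of length less than `p + 1` vanish. -/
def filtration (p : ℕ) : AddSubgroup (Cochain E F d) where
  carrier := {u | ∀ s : HomIndex ι d, s.p < p → u s = 0}
  zero_mem' _ _ := rfl
  add_mem' {u v} hu hv s hs := by
    change u s + v s = 0
    rw [hu s hs, hv s hs, add_zero]
  neg_mem' {u} hu s hs := by
    change - u s = 0
    rw [hu s hs, neg_zero]

theorem isCompleteFiltration : IsCompleteFiltration (filtration E F d) where
  zero := eq_top_iff.2 fun _ _ s hs => absurd hs (Nat.not_lt_zero _)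
  anti p u hu s hs := hu s (hs.trans (Nat.lt_succ_self p))
  separated u hu := Cochain.ext fun s => hu (s.p + 1) s (Nat.lt_succ_self _)
  complete y hy := by
    refine ⟨fun s => y (s.p + 1) s, fun p s hs => ?_⟩
    change y (s.p + 1) s - y p s = 0
    obtain ⟨k, rfl⟩ := Nat.exists_eq_add_of_lt hs
    induction k with
    | zero => exact sub_self _
    | succ k ih =>
      have h1 := hy (s.p + k + 1) s (by omega)
      change y (s.p + k + 1 + 1) s - y (s.p + k + 1) s = 0 at h1
      rw [show s.p + (k + 1) + 1 = s.p + k + 1 + 1 by omega, sub_eq_zero.1 h1]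
      exact ih (by omega)

theorem ev_eq_zero_of_mem {u : Cochain E F d} {q : ℕ} (hu : u ∈ filtration E F d q) {p : ℕ}
    {l : List ι} {x y : ι} {n m : ℤ} (hl : l.length = p + 1) (hx : l.getLast? = some x)
    (hy : l.head? = some y) (hd : n + d = m + p) {W : Opens X} (hW : W ≤ inter U l) (hp : p < q) :
    u.ev hl hx hy hd hW = 0 :=
  (congr_arg (Res.moveHom R hW) (hu ⟨p, l, x, y, n, m, hl, hx, hy, hd⟩ hp)).trans
    (Res.moveHom_zero R hW)

/-- In every summand the Čech degrees of the two factors add up to that of the product, so below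
degree p + q one factor is below its bound. -/
theorem comp_mem_filtration (h : d + e = f) {u : Cochain F G d} {v : Cochain E F e} {p q : ℕ}
    (hu : u ∈ filtration F G d p) (hv : v ∈ filtration E F e q) :
    comp h u v ∈ filtration E G f (p + q) := by
  rintro ⟨r, l, x, y, n, m, hl, hx, hy, hd⟩ hs
  refine LinearMap.ext fun z => ?_
  have key := ev_comp_apply h u v hl hx hy hd le_rfl z
  rw [ev, Res.moveHom_self] at key
  refine key.trans (Finset.sum_eq_zero fun k _ => ?_)
  by_cases hk : k.1 < p
  · rw [ev_eq_zero_of_mem hu _ _ _ _ _ hk, LinearMap.zero_apply, smul_zero]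
  · have hs' : r < p + q := hs
    rw [ev_eq_zero_of_mem hv _ _ _ _ _ (show r - k.1 < q by omega), LinearMap.zero_apply,
      map_zero, smul_zero]

theorem comp_mem_filtration_succ (h : d + e = f) {u : Cochain F G d} {v : Cochain E F e} {p : ℕ}
    (hu : u ∈ filtration F G d 1) (hv : v ∈ filtration E F e p) :
    comp h u v ∈ filtration E G f (p + 1) := by
  rw [add_comm]
  exact comp_mem_filtration h hu hv

theorem comp_mem_filtration_right (h : d + e = f) (u : Cochain F G d) {v : Cochain E F e} {q : ℕ}
    (hv : v ∈ filtration E F e q) : comp h u v ∈ filtration E G f q := by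
  have := comp_mem_filtration h (p := 0) (fun s hs => absurd hs (Nat.not_lt_zero _) : u ∈ _) hv
  rwa [zero_add] at this

theorem comp_mem_filtration_left (h : d + e = f) {u : Cochain F G d} (v : Cochain E F e) {p : ℕ}
    (hu : u ∈ filtration F G d p) : comp h u v ∈ filtration E G f p := by
  have := comp_mem_filtration h (q := 0) hu (fun s hs => absurd hs (Nat.not_lt_zero _) : v ∈ _)
  rwa [add_zero] at this

end Cochain

namespace TwistedComplex

open Cochain

variable {E F : TwistedComplex R U} {j k k' k'' : ℤ} (g : Hom E F 0)

/-- The differential of the complex of morphisms from `F` to the cone of `g : E ⟶ F`. -/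
def coneDiff (h : k + 1 = k') : Hom F E (k + 1) × Hom F F k →+ Hom F E (k' + 1) × Hom F F k' :=
  AddMonoidHom.mk' (fun x => (- diff (by omega) x.1, comp (by omega) g x.1 + diff h x.2))
    fun x y => Prod.ext (by simp only [Prod.fst_add, diff_add]; abel)
      (by simp only [Prod.fst_add, Prod.snd_add, diff_add, comp_add]; abel)

/-- The contraction of the cone of `g` which is defined by a homotopy inverse. -/
def coneContract (g' : Hom F E 0) (η : Hom E E (-1)) (θ : Hom F F (-1)) (h : k + 1 = k') :
    Hom F E (k' + 1) × Hom F F k' →+ Hom F E (k + 1) × Hom F F k :=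
  AddMonoidHom.mk' (fun x => (comp (by omega) η x.1 + comp (by omega) g' x.2,
    - comp (by omega) θ x.2))
    fun x y => Prod.ext (by simp only [Prod.fst_add, Prod.snd_add, comp_add]; abel)
      (by simp only [Prod.snd_add, comp_add]; abel)

variable (hg : diff (e := 1) rfl g = 0)
include hg

theorem coneDiff_coneDiff (h : k + 1 = k') (h' : k' + 1 = k'')
    (x : Hom F E (k + 1) × Hom F F k) : coneDiff g h' (coneDiff g h x) = 0 := by
  refine Prod.ext ?_ ?_
  · change - diff _ (- diff _ x.1) = 0
    rw [diff_neg, diff_diff, neg_zero, neg_zero]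
  · change comp _ g (- diff _ x.1) + diff _ (comp _ g x.1 + diff _ x.2) = 0
    rw [diff_add, diff_diff, comp_neg, diff_comp (e' := k' + 1) _ rfl (by omega) h', hg, zero_comp,
      Int.negOnePow_zero, Units.val_one, one_smul]
    abel

omit hg in
-- This is the matrix of D κ + κ D, where κ is the contraction built from `g'`, `η`, `θ`. For a
-- genuine homotopy inverse it would be unipotent, with `g η - θ g` as its only off-diagonal entry.
theorem cone_homotopy (g' : Hom F E 0) (η : Hom E E (-1)) (θ : Hom F F (-1)) (hj : j + 1 = k)
    (hk : k + 1 = k') (x : Hom F E (k + 1) × Hom F F k) :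
    coneDiff g hj (coneContract g' η θ hj x) + coneContract g' η θ hk (coneDiff g hk x) =
      (comp (by omega) (comp (f := 0) rfl g' g - diff (e := 0) rfl η) x.1 -
          comp (by omega) (diff (e := 1) rfl g') x.2,
        comp (by omega) (comp (f := 0) rfl g g' - diff (e := 0) rfl θ) x.2 +
          comp (by omega) (comp (f := -1) rfl g η - comp (f := -1) rfl θ g) x.1) := by
  obtain ⟨α, ω⟩ := x
  subst hj hk
  refine Prod.ext ?_ ?_
  · change - diff _ (comp _ η α + comp _ g' ω) +
      (comp _ η (- diff _ α) + comp _ g' (comp _ g α + diff _ ω)) = _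
    dsimp only
    rw [diff_add, diff_comp (d' := 0) (e' := j + 1 + 1 + 1) _ rfl (by omega) (by omega),
      diff_comp (d' := 1) _ rfl rfl (by omega), comp_neg, comp_add, sub_comp,
      comp_assoc (d' := 0) (f' := j + 1 + 1) rfl (by omega) (by omega) (by omega) g' g α]
    simp only [Int.negOnePow_zero, Int.negOnePow_neg, Int.negOnePow_one, Units.val_neg,
      Units.val_one, one_smul, neg_smul]
    abel
  · change comp _ g (comp _ η α + comp _ g' ω) + diff _ (- comp _ θ ω) +
      - comp _ θ (comp _ g α + diff _ ω) = _
    dsimp only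
    rw [diff_neg, diff_comp (d' := 0) (e' := j + 1 + 1) _ rfl (by omega) (by omega), comp_add, comp_add,
      sub_comp, sub_comp,
      comp_assoc (d' := 0) (f' := j + 1) rfl (by omega) (by omega) (by omega) g g' ω,
      comp_assoc (d' := -1) (f' := j + 1) (e' := j + 1) rfl (by omega) (by omega) (by omega) g η α,
      comp_assoc (d' := -1) (f' := j + 1 + 1) (e' := j + 1) rfl (by omega) (by omega) (by omega) θ g α]
    simp only [Int.negOnePow_neg, Int.negOnePow_one, Units.val_neg,
      Units.val_one, one_smul, neg_smul]
    abel

omit hg in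
/-- The difference of the contraction from a null-homotopy of the identity of the cone. -/
def coneError (g' : Hom F E 0) (η : Hom E E (-1)) (θ : Hom F F (-1)) (hj : j + 1 = k)
    (hk : k + 1 = k') : Hom F E (k + 1) × Hom F F k →+ Hom F E (k + 1) × Hom F F k :=
  (coneDiff g hj).comp (coneContract g' η θ hj) + (coneContract g' η θ hk).comp (coneDiff g hk) -
    AddMonoidHom.id _

omit hg in
theorem coneError_apply (g' : Hom F E 0) (η : Hom E E (-1)) (θ : Hom F F (-1)) (hj : j + 1 = k)
    (hk : k + 1 = k') (x : Hom F E (k + 1) × Hom F F k) :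
    coneError g g' η θ hj hk x =
      (comp (by omega) (comp (f := 0) rfl g' g - one E.obj - diff (e := 0) rfl η) x.1 -
          comp (by omega) (diff (e := 1) rfl g') x.2,
        comp (by omega) (comp (f := 0) rfl g g' - one F.obj - diff (e := 0) rfl θ) x.2 +
          comp (by omega) (comp (f := -1) rfl g η - comp (f := -1) rfl θ g) x.1) := by
  change coneDiff g hj (coneContract g' η θ hj x) + coneContract g' η θ hk (coneDiff g hk x) - x = _
  rw [cone_homotopy]
  refine Prod.ext ?_ ?_
  · dsimp only [Prod.fst_sub]
    simp only [sub_comp, one_comp]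
    abel
  · dsimp only [Prod.snd_sub]
    simp only [sub_comp, one_comp]
    abel

omit hg in
-- All entries of the error matrix raise the filtration except `g η - θ g`, which maps the first
-- factor to the second. This entry is off-diagonal, so two applications of the error raise the
-- filtration although one need not.
theorem coneError_mem {g' : Hom F E 0} {η : Hom E E (-1)} {θ : Hom F F (-1)}
    (hg' : diff (e := 1) rfl g' ∈ filtration F.obj E.obj 1 1)
    (hη : comp (f := 0) rfl g' g - one E.obj - diff (e := 0) rfl η ∈ filtration E.obj E.obj 0 1)
    (hθ : comp (f := 0) rfl g g' - one F.obj - diff (e := 0) rfl θ ∈ filtration F.obj F.obj 0 1)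
    (hj : j + 1 = k) (hk : k + 1 = k') (p : ℕ) (x : Hom F E (k + 1) × Hom F F k)
    (hx : x ∈ (filtration F.obj E.obj (k + 1) p).prod (filtration F.obj F.obj k p)) :
    coneError g g' η θ hj hk (coneError g g' η θ hj hk x) ∈
      (filtration F.obj E.obj (k + 1) (p + 1)).prod (filtration F.obj F.obj k (p + 1)) := by
  have h1 : ∀ y ∈ (filtration F.obj E.obj (k + 1) p).prod (filtration F.obj F.obj k p),
      coneError g g' η θ hj hk y ∈
        (filtration F.obj E.obj (k + 1) (p + 1)).prod (filtration F.obj F.obj k p) := by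
    rintro ⟨α, ω⟩ ⟨hα, hω⟩
    rw [coneError_apply]
    exact ⟨AddSubgroup.sub_mem _ (comp_mem_filtration_succ _ hη hα)
      (comp_mem_filtration_succ _ hg' hω), AddSubgroup.add_mem _
      (comp_mem_filtration_right _ _ hω) (comp_mem_filtration_right _ _ hα)⟩
  obtain ⟨hα, hω⟩ := h1 x hx
  have h2 := h1 _ ⟨isCompleteFiltration.anti p hα, hω⟩
  refine ⟨h2.1, ?_⟩
  rw [coneError_apply]
  exact AddSubgroup.add_mem _ (comp_mem_filtration_succ _ hθ hω)
    (comp_mem_filtration_right _ _ hα)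

/-- The cone of composition with g, Hom(F, E) → Hom(F, F), is contractible: D κ + κ D is 1 plus an
error whose square raises a complete filtration, hence bijective. So the cocycle (0, 1) is a
boundary D(ψ, ω), which means that ψ is closed and g ψ is homotopic to 1. -/
theorem exists_rightInverse {g' : Hom F E 0} {η : Hom E E (-1)} {θ : Hom F F (-1)}
    (hg' : diff (e := 1) rfl g' ∈ filtration F.obj E.obj 1 1)
    (hη : comp (f := 0) rfl g' g - one E.obj - diff (e := 0) rfl η ∈ filtration E.obj E.obj 0 1)
    (hθ : comp (f := 0) rfl g g' - one F.obj - diff (e := 0) rfl θ ∈ filtration F.obj F.obj 0 1) :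
    ∃ ψ : Hom F E 0, diff (e := 1) rfl ψ = 0 ∧
      ∃ ω : Hom F F (-1), diff (e := 0) rfl ω = one F.obj - comp (f := 0) rfl g ψ := by
  have hL : ∀ {j k k' : ℤ} (hj : j + 1 = k) (hk : k + 1 = k') (x : Hom F E (k + 1) × Hom F F k),
      x + coneError g g' η θ hj hk x = coneDiff g hj (coneContract g' η θ hj x) +
        coneContract g' η θ hk (coneDiff g hk x) := by
    intro j k k' hj hk x
    change x + (_ + _ - x) = _
    rw [add_sub_cancel]
    rfl
  have h0 : (-1 : ℤ) + 1 = 0 := rfl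
  have h1 : (0 : ℤ) + 1 = 1 := rfl
  have h2 : (1 : ℤ) + 1 = 2 := rfl
  obtain ⟨y, hy⟩ := (isCompleteFiltration.prod isCompleteFiltration).exists_add_eq
    (coneError g g' η θ h0 h1) (coneError_mem g hg' hη hθ h0 h1)
    ((0, one F.obj) : Hom F E (0 + 1) × Hom F F 0)
  -- D commutes with D κ + κ D, so this operator sends D y to D(0, 1) = 0, and injectivity gives D y
  -- = 0. Hence κ y is the required primitive.
  have hD : coneDiff g h1 y = 0 := by
    refine (isCompleteFiltration.prod isCompleteFiltration).eq_zero_of_add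
      (coneError g g' η θ h1 h2) (coneError_mem g hg' hη hθ h1 h2) ?_
    rw [hL] at hy ⊢
    have := congr_arg (coneDiff g h1) hy
    rw [map_add, coneDiff_coneDiff g hg, zero_add] at this
    rw [coneDiff_coneDiff g hg, map_zero, add_zero, this]
    refine Prod.ext ?_ ?_
    · change - diff _ 0 = 0
      rw [diff_zero, neg_zero]
    · change comp _ g 0 + diff _ (one F.obj) = 0
      rw [comp_zero, diff_one, add_zero]
  rw [hL, hD, map_zero, add_zero] at hy
  have e1 : - diff _ (coneContract g' η θ h0 y).1 = 0 := congr_arg Prod.fst hy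
  have e2 : comp _ g (coneContract g' η θ h0 y).1 + diff _ (coneContract g' η θ h0 y).2 =
    one F.obj := congr_arg Prod.snd hy
  exact ⟨(coneContract g' η θ h0 y).1, neg_eq_zero.1 e1, (coneContract g' η θ h0 y).2,
    eq_sub_of_add_eq' e2⟩

/-- A closed morphism is a homotopy equivalence if it has a homotopy inverse up to terms of
positive Čech degree. -/
theorem isHomotopyEquivalence_of_filtration {g' : Hom F E 0} {η : Hom E E (-1)} {θ : Hom F F (-1)}
    (hg' : diff (e := 1) rfl g' ∈ filtration F.obj E.obj 1 1)
    (hη : comp (f := 0) rfl g' g - one E.obj - diff (e := 0) rfl η ∈ filtration E.obj E.obj 0 1)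
    (hθ : comp (f := 0) rfl g g' - one F.obj - diff (e := 0) rfl θ ∈ filtration F.obj F.obj 0 1) :
    IsHomotopyEquivalence g := by
  obtain ⟨ψ, hψ, ω, hω⟩ := exists_rightInverse g hg hg' hη hθ
  have hgψ : comp (f := 0) rfl g ψ = one F.obj - diff (e := 0) rfl ω := by
    rw [hω, sub_sub_cancel]
  have hψg : diff (e := 1) rfl (comp (f := 0) rfl ψ g) = 0 := by
    rw [diff_comp (d' := 1) (e' := 1) rfl rfl rfl rfl, hψ, hg, zero_comp, comp_zero, smul_zero,
      add_zero]
  have hgψg : comp (f := 0) rfl g (comp (f := 0) rfl ψ g) =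
      g - comp (f := 0) rfl (diff (e := 0) rfl ω) g := by
    rw [← comp_assoc (d' := 0) rfl rfl rfl rfl, hgψ, sub_comp, one_comp]
  have hωg : diff (e := 0) rfl (comp (f := -1) rfl ω g) =
      comp (f := 0) rfl (diff (e := 0) rfl ω) g := by
    rw [diff_comp (d' := 0) (e' := 1) rfl rfl rfl rfl, hg, comp_zero, smul_zero, add_zero]
  -- To find a right inverse of `ψ`, with `g` as its approximate inverse, `ψ g` must be homotopic to
  -- 1 up to positive Čech degree. This follows from `g (ψ g) ≃ g` on composing with the approximate
  -- left inverse `g'`.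
  have hθ' : comp (f := 0) rfl ψ g - one E.obj - diff (e := 0) rfl
      (η - comp (f := -1) rfl g' (comp (f := -1) rfl ω g) -
        comp (f := -1) rfl η (comp (f := 0) rfl ψ g)) ∈ filtration E.obj E.obj 0 1 := by
    have key : comp (f := 0) rfl ψ g - one E.obj - diff (e := 0) rfl
        (η - comp (f := -1) rfl g' (comp (f := -1) rfl ω g) -
          comp (f := -1) rfl η (comp (f := 0) rfl ψ g)) =
        (comp (f := 0) rfl g' g - one E.obj - diff (e := 0) rfl η) -
        comp (f := 0) rfl (comp (f := 0) rfl g' g - one E.obj - diff (e := 0) rfl η)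
          (comp (f := 0) rfl ψ g) +
        comp (f := 0) rfl (diff (e := 1) rfl g') (comp (f := -1) rfl ω g) := by
      rw [diff_sub, diff_sub, diff_comp (d' := 1) (e' := 0) rfl rfl rfl rfl g',
        diff_comp (d' := 0) (e' := 1) rfl rfl rfl rfl η, hψg, hωg, comp_zero, smul_zero, sub_comp,
        sub_comp, comp_assoc (f' := 0) rfl rfl rfl rfl g' g, hgψg, comp_sub, one_comp,
        Int.negOnePow_zero, Units.val_one, one_smul]
      simp only [sub_eq_add_neg, neg_add_rev, neg_neg]
      abel
    rw [key]
    exact AddSubgroup.add_mem _ (AddSubgroup.sub_mem _ hη (comp_mem_filtration_left _ _ hη))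
      (comp_mem_filtration_left _ _ hg')
  -- With `g ψ ≃ 1` and `ψ ψ₂ ≃ 1`, evaluating `ψ g ψ ψ₂` in two ways gives `ψ g ≃ 1`; the homotopy
  -- below records this computation.
  obtain ⟨ψ₂, hψ₂, ω₂, hω₂⟩ := exists_rightInverse ψ hψ (g' := g) (η := -ω) (by
      rw [hg]; exact AddSubgroup.zero_mem _) (by
      rw [diff_neg, hgψ, sub_sub_cancel_left, sub_neg_eq_add, neg_add_cancel]
      exact AddSubgroup.zero_mem _) hθ'
  have hψψ₂ : comp (f := 0) rfl ψ ψ₂ = one E.obj - diff (e := 0) rfl ω₂ := by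
    rw [hω₂, sub_sub_cancel]
  refine ⟨hg, ψ, hψ, ⟨- ω₂ - comp (f := -1) rfl ψ (comp (f := -1) rfl ω ψ₂) +
    comp (f := -1) rfl (comp (f := 0) rfl ψ g) ω₂, ?_⟩, - ω, ?_⟩
  · have e : comp (f := 0) rfl (comp (f := 0) rfl ψ g) (comp (f := 0) rfl ψ ψ₂) =
        comp (f := 0) rfl ψ ψ₂ -
          comp (f := 0) rfl ψ (comp (f := 0) rfl (diff (e := 0) rfl ω) ψ₂) := by
      rw [comp_assoc (f' := 0) rfl rfl rfl rfl, ← comp_assoc (d' := 0) rfl rfl rfl rfl g ψ, hgψ,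
        sub_comp, one_comp, comp_sub]
    have e' := e
    rw [hψψ₂, comp_sub, comp_one] at e'
    have hA : diff (e := 0) rfl (comp (f := -1) rfl ω ψ₂) =
        comp (f := 0) rfl (diff (e := 0) rfl ω) ψ₂ := by
      rw [diff_comp (d' := 0) (e' := 1) rfl rfl rfl rfl, hψ₂, Cochain.comp_zero, smul_zero, add_zero]
    have hB : diff (e := 0) rfl (comp (f := -1) rfl ψ (comp (f := -1) rfl ω ψ₂)) =
        comp (f := 0) rfl ψ (comp (f := 0) rfl (diff (e := 0) rfl ω) ψ₂) := by
      rw [diff_comp (d' := 1) (e' := 0) rfl rfl rfl rfl, hψ, Cochain.zero_comp, hA, zero_add,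
        Int.negOnePow_zero, Units.val_one, one_smul]
    have hC : diff (e := 0) rfl (comp (f := -1) rfl (comp (f := 0) rfl ψ g) ω₂) =
        comp (f := 0) rfl (comp (f := 0) rfl ψ g) (diff (e := 0) rfl ω₂) := by
      rw [diff_comp (d' := 1) (e' := 0) rfl rfl rfl rfl, hψg, Cochain.zero_comp, zero_add,
        Int.negOnePow_zero, Units.val_one, one_smul]
    rw [diff_add, diff_sub, diff_neg, hB, hC]
    refine eq_sub_of_add_eq (Eq.trans ?_ (eq_add_of_sub_eq e').symm)
    abel
  · rw [diff_neg, hω, neg_sub]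

end TwistedComplex

end CochainFiltration

end TwistedDescent

end

noncomputable section

namespace TwistedDescent

/-! ### Vertex components of morphisms of twisted complexes -/

section Vertex

variable {X : TopCat.{u}} {R : (Opens X)ᵒᵖ ⥤ RingCat.{u}} {ι : Type u} {U : ι → Opens X}

/-- The restriction of `E_i` to `U_{[i]} = U_i`. -/
abbrev vertexCpx (E : ∀ i, Cpx R (U i)) (i : ι) : Cpx R (inter U [i]) :=
  resCpx (inter_le (U := U) (List.mem_singleton_self i)) (E i)

namespace Cochain

variable {E F G : ∀ i, Cpx R (U i)} {d e f : ℤ} {n m k : ℤ}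

/-- The component `u_i : E_i^n → F_i^m` of a cochain. -/
def atVertex (u : Cochain E F d) (i : ι) (h : n + d = m) :
    (vertexCpx E i).X n →ₗ[R.obj (op (inter U [i]))] (vertexCpx F i).X m :=
  u ⟨0, [i], i, i, n, m, rfl, rfl, rfl, by simpa using h⟩

theorem mem_filtration_one {u : Cochain E F d}
    (hu : ∀ (i : ι) (n m : ℤ) (h : n + d = m), u.atVertex i h = 0) :
    u ∈ filtration E F d 1 := by
  rintro ⟨p, l, x, y, n, m, hl, hx, hy, hd⟩ hs
  obtain rfl : p = 0 := Nat.lt_one_iff.1 hs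
  obtain ⟨i, rfl⟩ := List.length_eq_one_iff.1 hl
  obtain rfl : i = x := Option.some.inj hx
  obtain rfl : i = y := Option.some.inj hy
  exact hu i n m (by simpa using hd)

theorem exists_atVertex_eq (t : ∀ (i : ι) (n m : ℤ), n + d = m →
    ((vertexCpx E i).X n →ₗ[R.obj (op (inter U [i]))] (vertexCpx F i).X m)) :
    ∃ u : Cochain E F d, ∀ (i : ι) (n m : ℤ) (h : n + d = m), u.atVertex i h = t i n m h := by
  -- Components off the vertices are zero. Heterogeneous equality compares the prescribed value at a
  -- vertex without transport along the fields of the index.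
  have key : ∀ s : HomIndex ι d, ∃ a : Res R (inter_le (U := U) s.src_mem) ((E s.src).X s.n)
      →ₗ[R.obj (op (inter U s.l))] Res R (inter_le (U := U) s.tgt_mem) ((F s.tgt).X s.m),
      ∀ (i : ι) (n m : ℤ) (h : n + d = m),
        s = ⟨0, [i], i, i, n, m, rfl, rfl, rfl, by simpa using h⟩ → HEq a (t i n m h) := by
    intro s
    by_cases hs : ∃ (i : ι) (n m : ℤ) (h : n + d = m),
        s = ⟨0, [i], i, i, n, m, rfl, rfl, rfl, by simpa using h⟩
    · obtain ⟨i, n, m, h, rfl⟩ := hs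
      refine ⟨t i n m h, fun i' n' m' h' e => ?_⟩
      obtain rfl : i = i' := congr_arg HomIndex.src e
      obtain rfl : n = n' := congr_arg HomIndex.n e
      obtain rfl : m = m' := congr_arg HomIndex.m e
      rfl
    · exact ⟨0, fun i n m h e => absurd ⟨i, n, m, h, e⟩ hs⟩
  choose u hu using key
  exact ⟨u, fun i n m h => eq_of_heq (hu _ i n m h rfl)⟩

theorem ev_eq_atVertex (u : Cochain E F d) (i : ι) (h : n + d = m) :
    u.ev (p := 0) (l := [i]) (x := i) (y := i) (n := n) (m := m)
      rfl rfl rfl (by simpa using h) le_rfl = u.atVertex i h :=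
  Res.moveHom_self _

theorem atVertex_comp (h : d + e = f) (u : Cochain F G d) (v : Cochain E F e) (i : ι)
    (hf : n + f = m) (hn : n + e = k) (hk : k + d = m) (z : (vertexCpx E i).X n) :
    (comp h u v).atVertex i hf z = u.atVertex i hk (v.atVertex i hn z) := by
  have key := ev_comp_apply h u v (p := 0) (l := [i]) (x := i) (y := i) (n := n) (m := m)
    rfl rfl rfl (by simpa using hf) le_rfl z
  refine (congr($(ev_eq_atVertex (comp h u v) i hf) z).symm.trans key).trans ?_
  rw [Fin.sum_univ_one]
  refine Eq.trans ?_ (congr($(ev_eq_atVertex u i hk) (v.atVertex i hn z)))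
  refine Eq.trans ?_ (congr_arg _ congr($(ev_eq_atVertex v i hn) z))
  refine ((congr_arg₂ (· • ·) (?_ : _ = (1 : ℤ)) ?_).trans (one_smul ℤ _))
  · simp
  · apply ev_ev_congr <;> rfl

theorem atVertex_one (i : ι) (h : n + 0 = n) (z : (vertexCpx E i).X n) :
    (one E).atVertex i h z = z := by
  rfl

theorem atVertex_add (u v : Cochain E F d) (i : ι) (h : n + d = m) (z : (vertexCpx E i).X n) :
    (u + v).atVertex i h z = u.atVertex i h z + v.atVertex i h z := rfl

theorem atVertex_sub (u v : Cochain E F d) (i : ι) (h : n + d = m) (z : (vertexCpx E i).X n) :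
    (u - v).atVertex i h z = u.atVertex i h z - v.atVertex i h z := rfl

theorem atVertex_zsmul (c : ℤ) (u : Cochain E F d) (i : ι) (h : n + d = m)
    (z : (vertexCpx E i).X n) : (c • u).atVertex i h z = c • u.atVertex i h z := rfl

theorem atVertex_cech (h : d + 1 = e) (u : Cochain E F d) (i : ι) (hm : n + e = m)
    (z : (vertexCpx E i).X n) : (cech h u).atVertex i hm z = 0 := by
  have key := ev_cech_apply h u (p := 0) (l := [i]) (x := i) (y := i) (n := n) (m := m)
    rfl rfl rfl (by simpa using hm) le_rfl z
  exact (congr($(ev_eq_atVertex (cech h u) i hm) z).symm.trans key).trans (Fin.sum_univ_zero _)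

end Cochain

namespace TwistedComplex

open Cochain

variable {E F : TwistedComplex R U} {d e n m k k' : ℤ}

theorem atVertex_a (i : ι) (h : n + 1 = m) :
    E.a.atVertex i h = ((vertexCpx E.obj i).d n m).hom := E.a_zero i n m h

theorem atVertex_diff (h : d + 1 = e) (φ : Hom E F d) (i : ι) (hm : n + e = m) (hk : n + d = k)
    (hk' : n + 1 = k') (z : (vertexCpx E.obj i).X n) :
    (diff h φ).atVertex i hm z =
      ((vertexCpx F.obj i).d k m).hom (φ.atVertex i hk z) -
        (Int.negOnePow d : ℤ) • φ.atVertex i (by omega) (((vertexCpx E.obj i).d n k').hom z) := by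
  have e1 := atVertex_comp (by omega) F.a φ i hm hk (by omega) z
  have e2 := atVertex_comp h φ E.a i hm hk' (by omega) z
  rw [atVertex_a] at e1 e2
  rw [← e1, ← e2, diff, atVertex_sub, atVertex_add, atVertex_zsmul, atVertex_cech, zero_add]

/-- The morphism of complexes `g_i` defined by a closed morphism `g` of degree zero. -/
def vertexHom (g : Hom E F 0) (hg : diff (e := 1) rfl g = 0) (i : ι) :
    vertexCpx E.obj i ⟶ vertexCpx F.obj i where
  f n := ModuleCat.ofHom (g.atVertex i (add_zero n))
  comm' n m h := by
    have h : n + 1 = m := h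
    ext z
    have := atVertex_diff rfl g i h (add_zero n) h z
    rw [hg, Int.negOnePow_zero, Units.val_one, one_smul] at this
    exact sub_eq_zero.1 this.symm

end TwistedComplex

theorem IsStrictlyPerfect.isKProjective {W : Opens X} {K : Cpx R W} (hK : IsStrictlyPerfect K) :
    CochainComplex.IsKProjective K := by
  obtain ⟨⟨a, b, hab⟩, hp⟩ := hK
  have h1 : CochainComplex.IsStrictlyLE K b := by
    rw [CochainComplex.isStrictlyLE_iff]
    intro i hi
    have := hab i (Or.inr hi)
    exact ModuleCat.isZero_of_subsingleton _
  have h2 : ∀ n, Projective (K.X n) := fun n => by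
    have := (hp n).2
    exact (IsProjective.iff_projective _).1 this
  exact CochainComplex.isKProjective_of_projective K b

/-- Bounded complexes of projectives are K-projective, and a quasi-isomorphism between K-projective
complexes is a homotopy equivalence. -/
theorem IsStrictlyPerfect.exists_homotopyEquiv {W : Opens X} {K L : Cpx R W}
    (hK : IsStrictlyPerfect K) (hL : IsStrictlyPerfect L) (φ : K ⟶ L) (hφ : IsQuasiIso φ) :
    ∃ w : HomotopyEquiv K L, w.hom = φ := by
  have := hK.isKProjective
  have := hL.isKProjective
  exact (CochainComplex.IsKProjective.quasiIso_iff φ).1 hφ.quasiIso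

namespace TwistedComplex

open Cochain

variable {E F : TwistedComplex R U}

/-- Homotopy inverses and homotopies at the vertices are extended to cochains in any way whatever.
Their defects vanish in Čech degree zero, which is all that the filtration argument needs. -/
theorem isHomotopyEquivalence_of_isQuasiIso (hR : IsSoftPresheaf R)
    (hE : ∀ i, IsStrictlyPerfect (E.obj i)) (hF : ∀ i, IsStrictlyPerfect (F.obj i))
    (g : Hom E F 0) (hg : diff (e := 1) rfl g = 0)
    (h : ∀ i, IsQuasiIso (vertexHom g hg i)) : IsHomotopyEquivalence g := by
  choose w hw using fun i => ((hE i).resCpx hR (inter_le (U := U) (List.mem_singleton_self i)))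
    |>.exists_homotopyEquiv ((hF i).resCpx hR (inter_le (U := U) (List.mem_singleton_self i)))
      (vertexHom g hg i) (h i)
  obtain ⟨g', hg'⟩ := exists_atVertex_eq (E := F.obj) (F := E.obj) (d := 0) fun i n m h =>
    ((w i).inv.f n ≫ ((vertexCpx E.obj i).XIsoOfEq (by omega : n = m)).hom).hom
  obtain ⟨η, hη⟩ := exists_atVertex_eq (E := E.obj) (F := E.obj) (d := -1) fun i n m h =>
    ((w i).homotopyHomInvId.hom n m).hom
  obtain ⟨θ, hθ⟩ := exists_atVertex_eq (E := F.obj) (F := F.obj) (d := -1) fun i n m h =>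
    ((w i).homotopyInvHomId.hom n m).hom
  have hg0 : ∀ i n (z : (vertexCpx F.obj i).X n), g'.atVertex i (add_zero n) z =
      ((w i).inv.f n).hom z := by
    intro i n z
    rw [hg']
    rfl
  have hw0 : ∀ i n (z : (vertexCpx E.obj i).X n), g.atVertex i (add_zero n) z =
      ((w i).hom.f n).hom z := by
    intro i n z
    rw [hw]
    rfl
  refine isHomotopyEquivalence_of_filtration g hg (g' := g') (η := η) (θ := θ) ?_ ?_ ?_
  · refine mem_filtration_one fun i n m h => LinearMap.ext fun z => ?_
    rw [atVertex_diff rfl g' i h (add_zero n) h, hg0, Int.negOnePow_zero, Units.val_one, one_smul]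
    subst h
    refine Eq.trans (congr_arg₂ (· - ·) rfl (hg0 i _ _)) ?_
    rw [hom_d_apply, sub_self]
    rfl
  · refine mem_filtration_one fun i n m h => LinearMap.ext fun z => ?_
    obtain rfl : m = n := by omega
    rw [atVertex_sub, atVertex_sub, atVertex_one,
      atVertex_comp rfl g' g i h (add_zero m) (add_zero m), hg0, hw0,
      atVertex_diff (k := m - 1) rfl η i h rfl rfl, hη, hη]
    have hom := congr($((w i).homotopyHomInvId.comm m).hom z)
    rw [dNext_eq _ (show (ComplexShape.up ℤ).Rel m (m + 1) from rfl),
      prevD_eq _ (show (ComplexShape.up ℤ).Rel (m - 1) m from sub_add_cancel m 1)] at hom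
    have hom' : ((w i).inv.f m).hom (((w i).hom.f m).hom z) =
        ((w i).homotopyHomInvId.hom (m + 1) m).hom (((vertexCpx E.obj i).d m (m + 1)).hom z) +
        ((vertexCpx E.obj i).d (m - 1) m).hom (((w i).homotopyHomInvId.hom m (m - 1)).hom z) + z := hom
    rw [hom', Int.negOnePow_neg, Int.negOnePow_one, Units.val_neg, Units.val_one, neg_smul, one_smul,
      LinearMap.zero_apply]
    abel
  · refine mem_filtration_one fun i n m h => LinearMap.ext fun z => ?_
    obtain rfl : m = n := by omega
    rw [atVertex_sub, atVertex_sub, atVertex_one,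
      atVertex_comp rfl g g' i h (add_zero m) (add_zero m), hg0, hw0,
      atVertex_diff (k := m - 1) rfl θ i h rfl rfl, hθ, hθ]
    have hom := congr($((w i).homotopyInvHomId.comm m).hom z)
    rw [dNext_eq _ (show (ComplexShape.up ℤ).Rel m (m + 1) from rfl),
      prevD_eq _ (show (ComplexShape.up ℤ).Rel (m - 1) m from sub_add_cancel m 1)] at hom
    have hom' : ((w i).hom.f m).hom (((w i).inv.f m).hom z) =
        ((w i).homotopyInvHomId.hom (m + 1) m).hom (((vertexCpx F.obj i).d m (m + 1)).hom z) +
        ((vertexCpx F.obj i).d (m - 1) m).hom (((w i).homotopyInvHomId.hom m (m - 1)).hom z) + z := hom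
    rw [hom', Int.negOnePow_neg, Int.negOnePow_one, Units.val_neg, Units.val_one, neg_smul, one_smul,
      LinearMap.zero_apply]
    abel

end TwistedComplex

end Vertex

end TwistedDescent

end

noncomputable section

namespace TwistedDescent

/-! ### The morphism adjoint to a chain map -/

section Adjoint

variable {X : TopCat.{u}} {R : (Opens X)ᵒᵖ ⥤ RingCat.{u}} {ι : Type u} {U : ι → Opens X}
  (F : TwistedComplex R U) {n m : ℤ}

theorem TwistedComplex.counit_ev {p : ℕ} {l : List ι} {x y : ι}
    (hl : l.length = p + 1) (hx : l.getLast? = some x) (hy : l.head? = some y)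
    (hd : n + 0 = m + p) {W : Opens X} (hW : W ≤ inter U l) (c : Sec F.obj n) :
    F.counit.ev hl hx hy hd hW (Res.unit R (le_of_getLast hx hW)
      (Res.unit R (le_top : U x ≤ ⊤) (M := F.sheafification.X n) c)) =
      c.ev hl hy (by omega) hW := by
  refine (Res.moveHom_unit R hW _ _).trans (congr_arg (Res.move R _ hW) ?_)
  refine (congr_arg (Res.lift R _ _) ((Res.lift_unit R _ _ _).trans (Res.move_unit R _ _ _))).trans ?_
  exact Res.lift_unit R _ _ _

variable {F} {E : Cpx R ⊤} (φ : E ⟶ F.sheafification)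

/-- The morphism `T(E) → F` adjoint to a chain map `φ : E → S(F)`. -/
def adjoint : TwistedComplex.Hom (twisting U E) F 0 :=
  Cochain.comp (f := 0) rfl F.counit (twistingHom U φ)

/-- Since T(φ) lives in bidegree (0, 0), only the cut at the last index contributes, and the adjoint
reads off the components of φ e. -/
theorem adjoint_ev {p : ℕ} {l : List ι} {x y : ι}
    (hl : l.length = p + 1) (hx : l.getLast? = some x) (hy : l.head? = some y)
    (hd : n + 0 = m + p) {W : Opens X} (hW : W ≤ inter U l) (e : E.X n) :
    (adjoint φ).ev hl hx hy hd hW (Res.unit R (le_of_getLast hx hW)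
      (Res.unit R (le_top : U x ≤ ⊤) e)) =
      Sec.ev ((φ.f n).hom e : Sec F.obj n) hl hy (by omega) hW := by
  -- The degree and the tuple in the product formula equal `n` and `l` only propositionally; with
  -- both generalised, the equalities can be substituted.
  have key : ∀ {p' : ℕ} {l' : List ι} {x' : ι} {ν : ℤ} (hν : n = ν) (hp : l' = l)
      (hl' : l'.length = p' + 1) (hx' : l'.getLast? = some x') (hy' : l'.head? = some y)
      (hd' : ν + 0 = m + p') (hW' : W ≤ inter U l'),
      F.counit.ev hl' hx' hy' hd' hW' (Res.unit R (le_of_getLast hx' hW')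
        (Res.unit R (le_top : U x' ≤ ⊤)
          ((φ.f n ≫ (F.sheafification.XIsoOfEq hν).hom).hom e))) =
      Sec.ev ((φ.f n).hom e : Sec F.obj n) hl hy (by omega) hW := by
    intro p' l' x' ν hν hp hl' hx' hy' hd' hW'
    subst hν hp
    obtain rfl : p = p' := by omega
    exact F.counit_ev _ _ _ _ _ _
  refine (Cochain.ev_comp_apply rfl F.counit (twistingHom U φ) hl hx hy hd hW _).trans ?_
  have hT : ∀ k : Fin (p + 1), _ := fun k => constCochain_ev U (twistingHomMap φ)
    (n := n) (m := n + 0 - (p - k.1 : ℕ)) (length_back hl k.2)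
        (getLast_back (by omega) hx) (head_back (by omega))
        (by omega) (hW.trans (inter_mono (List.drop_subset k.1 l)))
  rw [Fin.sum_univ_castSucc, Finset.sum_eq_zero, zero_add]
  · refine (congr_arg₂ (· • ·) (?_ : _ = (1 : ℤ)) ?_).trans (one_smul ℤ _)
    · simp
    · refine (congr_arg _ (congr($(hT (Fin.last p)) _).trans (Res.map₂_unit R _ _ _ _ _ e))).trans ?_
      refine Eq.trans ?_ (key (ν := n + 0 - (p - p : ℕ)) (l' := l.take (p + 1)) (by omega)
        (List.take_of_length_le (by omega)) (length_front hl (by omega))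
        (getLast_front (by omega)) (head_front hy) (by omega)
        (hW.trans (inter_mono (List.take_subset _ _))))
      exact congr_arg (fun f : E.X n ⟶ F.sheafification.X (n + 0 - (p - p : ℕ)) =>
        F.counit.ev _ _ _ _ _ (Res.unit R _ (Res.unit R _ (f.hom e))))
        (dif_pos (show p - p = 0 by omega))
  · intro k _
    refine (congr_arg _ (congr_arg _ (congr($(hT k.castSucc) _).trans
      (Res.map₂_unit R _ _ _ _ _ e)))).trans ?_
    refine (congr_arg (fun f : E.X n ⟶ F.sheafification.X (n + 0 - (p - k.1 : ℕ)) =>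
      _ • F.counit.ev _ _ _ _ _ (Res.unit R _ (Res.unit R _ (f.hom e))))
        (dif_neg (show ¬ (p - k.1 = 0) by omega))).trans ?_
    refine (congr_arg _ (congr_arg _ ?_)).trans ((congr_arg _ (map_zero _)).trans (smul_zero _))
    exact (congr_arg _ (map_zero _)).trans (map_zero _)

theorem comp_adjoint_ev {p : ℕ} {l : List ι} {x y : ι} {d : ℤ}
    (u : Cochain F.obj F.obj d)
    (hl : l.length = p + 1) (hx : l.getLast? = some x) (hy : l.head? = some y)
    (hd : n + d = m + p) {W : Opens X} (hW : W ≤ inter U l) (e : E.X n) :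
    (Cochain.comp (f := d) (add_zero d) u (adjoint φ)).ev hl hx hy hd hW
        (Res.unit R (le_of_getLast hx hW) (Res.unit R (le_top : U x ≤ ⊤) e)) =
      Sec.ev (Sec.act (n' := n + d) rfl u ((φ.f n).hom e : Sec F.obj n)) hl hy (by omega) hW := by
  refine (Cochain.ev_comp_apply (add_zero d) u (adjoint φ) hl hx hy hd hW _).trans
    (Eq.trans ?_ (Sec.ev_act rfl u _ hl hy _ hW).symm)
  refine Finset.sum_congr rfl fun k _ => congr_arg _ ?_
  refine (congr_arg _ (adjoint_ev φ _ _ _ _ _ e)).trans ?_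
  exact Sec.ev_ev_congr _ _ _ _ _ _ _ _ _ _ _ _ _ _ _ _ _ _ _ _ rfl rfl

set_option maxHeartbeats 1000000 in
-- The twisting cochain of T(E) has two nonzero components. Its differential contributes φ(d e) =
-- D(φ e); its identities on edges contribute the value of φ e on the tuple without its last index.
theorem adjoint_comp_twisting_ev {p : ℕ} {l : List ι} {x y : ι}
    (hl : l.length = p + 1) (hx : l.getLast? = some x) (hy : l.head? = some y)
    (hd : n + 1 = m + p) {W : Opens X} (hW : W ≤ inter U l) (e : E.X n) :
    (Cochain.comp (f := 1) rfl (adjoint φ) (twisting U E).a).ev hl hx hy hd hW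
        (Res.unit R (le_of_getLast hx hW) (Res.unit R (le_top : U x ≤ ⊤) e)) =
      Sec.ev (F.secDiff rfl ((φ.f n).hom e : Sec F.obj n)) hl hy hd.symm hW +
        if h : 1 ≤ p then (-1 : ℤ) ^ (p - 1) • Sec.ev (m := m) ((φ.f n).hom e : Sec F.obj n)
          (length_front hl (show p - 1 < p + 1 by omega)) (head_front hy) (by omega)
          (hW.trans (inter_mono (List.take_subset _ l))) else 0 := by
  have hT : ∀ k : ℕ, ∀ hk : k < p + 1, ((twisting U E).a.ev (m := n + 1 - (p - k : ℕ))
        (length_back hl hk)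
        (getLast_back (by omega) hx) (head_back (by omega))
        (by omega) (hW.trans (inter_mono (List.drop_subset k l)))
        (Res.unit R (le_of_getLast (getLast_back (by omega) hx)
          (hW.trans (inter_mono (List.drop_subset k l)))) (Res.unit R (le_top : U x ≤ ⊤) e))) =
        Res.unit R _ (Res.unit R le_top ((twistingMap E ⟨p - k, l.drop k, x, _, n,
          n + 1 - (p - k : ℕ), length_back hl hk, getLast_back (by omega) hx, head_back (by omega),
          by omega⟩).hom e)) := fun k hk => congr($(constCochain_ev U (twistingMap E) (n := n)
        (m := n + 1 - (p - k : ℕ))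
        (length_back hl hk)
        (getLast_back (by omega) hx) (head_back (by omega))
        (by omega) (hW.trans (inter_mono (List.drop_subset k l)))) _).trans
        (Res.map₂_unit R _ _ _ _ _ e)
  have hlast : ∀ {ν : ℤ} {l' : List ι} {x' : ι} (hν : n + 1 = ν) (hp : l' = l)
      (hl' : l'.length = p + 1) (hx' : l'.getLast? = some x') (hy' : l'.head? = some y)
      (hd' : ν + 0 = m + p) (hW' : W ≤ inter U l'),
      (adjoint φ).ev hl' hx' hy' hd' hW' (Res.unit R (le_of_getLast hx' hW')
        (Res.unit R (le_top : U x' ≤ ⊤) ((E.d n ν).hom e))) =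
      Sec.ev (F.secDiff rfl ((φ.f n).hom e : Sec F.obj n)) hl hy hd.symm hW := by
    intro ν l' x' hν hp hl' hx' hy' hd' hW'
    subst hν hp
    refine (adjoint_ev φ _ _ _ _ _ _).trans ?_
    exact congr_arg (fun c : Sec F.obj (n + 1) => c.ev hl hy hd.symm hW)
      ((hom_d_apply φ n (n + 1) e).trans (F.sheafification_d rfl _))
  have hpred : ∀ {ν : ℤ} {x' : ι} (hν : n = ν) (h : 1 ≤ p)
      (hl' : (l.take (p - 1 + 1)).length = p - 1 + 1)
      (hx' : (l.take (p - 1 + 1)).getLast? = some x')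
      (hy' : (l.take (p - 1 + 1)).head? = some y)
      (hd' : ν + 0 = m + (p - 1 : ℕ)) (hW' : W ≤ inter U (l.take (p - 1 + 1))),
      (adjoint φ).ev hl' hx' hy' hd' hW' (Res.unit R (le_of_getLast hx' hW')
        (Res.unit R (le_top : U x' ≤ ⊤) ((E.XIsoOfEq hν).hom.hom e))) =
      Sec.ev ((φ.f n).hom e : Sec F.obj n) hl' hy' (by omega) hW' := by
    intro ν x' hν h hl' hx' hy' hd' hW'
    subst hν
    exact adjoint_ev φ _ _ _ _ _ e
  -- The three facts `t₁`, `t₂`, `t₃` treat back pieces with one, two and more entries, on which the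
  -- twisting cochain is `a^{0,1}`, `a^{1,0}` and zero.
  have t₁ : (adjoint φ).ev (m := m) (n := n + 1 - (p - p : ℕ))
        (length_front hl (show p < p + 1 by omega))
        (getLast_front (by omega)) (head_front hy)
        (by omega) (hW.trans (inter_mono (List.take_subset (p + 1) l)))
        ((twisting U E).a.ev (m := n + 1 - (p - p : ℕ)) (length_back hl (show p < p + 1 by omega))
        (getLast_back (by omega) hx) (head_back (by omega))
        (by omega) (hW.trans (inter_mono (List.drop_subset p l)))
        (Res.unit R (le_of_getLast (getLast_back (by omega) hx)
          (hW.trans (inter_mono (List.drop_subset p l)))) (Res.unit R (le_top : U x ≤ ⊤) e))) =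
      Sec.ev (F.secDiff rfl ((φ.f n).hom e : Sec F.obj n)) hl hy hd.symm hW := by
    refine (congr_arg _ (hT p (by omega))).trans ?_
    refine (congr_arg (fun f : E.X n ⟶ E.X (n + 1 - (p - p : ℕ)) =>
        (adjoint φ).ev _ _ _ _ _ (Res.unit R _ (Res.unit R _ (f.hom e))))
        (twistingMap_zero E _ (show p - p = 0 by omega))).trans ?_
    exact hlast (by omega) (List.take_of_length_le (by omega)) _ _ _ _ _
  have t₂ : ∀ h : 1 ≤ p, (adjoint φ).ev (m := m) (n := n + 1 - (p - (p - 1) : ℕ))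
        (length_front hl (show p - 1 < p + 1 by omega))
        (getLast_front (by omega)) (head_front hy)
        (by omega) (hW.trans (inter_mono (List.take_subset (p - 1 + 1) l)))
        ((twisting U E).a.ev (m := n + 1 - (p - (p - 1) : ℕ))
        (length_back hl (show p - 1 < p + 1 by omega))
        (getLast_back (by omega) hx) (head_back (by omega))
        (by omega) (hW.trans (inter_mono (List.drop_subset (p - 1) l)))
        (Res.unit R (le_of_getLast (getLast_back (by omega) hx)
          (hW.trans (inter_mono (List.drop_subset (p - 1) l)))) (Res.unit R (le_top : U x ≤ ⊤) e))) =
      Sec.ev (m := m) ((φ.f n).hom e : Sec F.obj n)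
          (length_front hl (show p - 1 < p + 1 by omega)) (head_front hy) (by omega)
          (hW.trans (inter_mono (List.take_subset _ l))) := by
    intro h
    refine (congr_arg _ (hT (p - 1) (by omega))).trans ?_
    refine (congr_arg (fun f : E.X n ⟶ E.X (n + 1 - (p - (p - 1) : ℕ)) =>
        (adjoint φ).ev _ _ _ _ _ (Res.unit R _ (Res.unit R _ (f.hom e))))
        (twistingMap_one E _ (show p - (p - 1) = 1 by omega))).trans ?_
    exact hpred (by omega) h _ _ _ _ _
  have t₃ : ∀ k, ∀ h : k + 2 ≤ p, (adjoint φ).ev (m := m) (n := n + 1 - (p - k : ℕ))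
        (length_front hl (show k < p + 1 by omega))
        (getLast_front (by omega)) (head_front hy)
        (by omega) (hW.trans (inter_mono (List.take_subset (k + 1) l)))
        ((twisting U E).a.ev (m := n + 1 - (p - k : ℕ)) (length_back hl (show k < p + 1 by omega))
        (getLast_back (by omega) hx) (head_back (by omega))
        (by omega) (hW.trans (inter_mono (List.drop_subset k l)))
        (Res.unit R (le_of_getLast (getLast_back (by omega) hx)
          (hW.trans (inter_mono (List.drop_subset k l)))) (Res.unit R (le_top : U x ≤ ⊤) e))) =
      0 := by
    intro k h
    refine (congr_arg _ (hT k (by omega))).trans ?_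
    refine (congr_arg (fun f : E.X n ⟶ E.X (n + 1 - (p - k : ℕ)) =>
        (adjoint φ).ev _ _ _ _ _ (Res.unit R _ (Res.unit R _ (f.hom e))))
        (twistingMap_two E _ (show 2 ≤ p - k by omega))).trans ?_
    refine (congr_arg _ ?_).trans (map_zero _)
    exact (congr_arg _ (map_zero _)).trans (map_zero _)
  refine (Cochain.ev_comp_apply rfl (adjoint φ) (twisting U E).a hl hx hy hd hW _).trans ?_
  rw [Fin.sum_univ_castSucc, add_comm]
  refine congr_arg₂ (· + ·) ?_ ?_
  · refine (congr_arg₂ (· • ·) (?_ : _ = (1 : ℤ)) t₁).trans (one_smul ℤ _)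
    simp
  · clear t₁ hlast hpred hT
    match p, hl, hd, t₂, t₃ with
    | 0, hl, hd, t₂, t₃ => exact Fin.sum_univ_zero _
    | p + 1, hl, hd, t₂, t₃ =>
      rw [Fin.sum_univ_castSucc, Finset.sum_eq_zero, zero_add, dif_pos (by omega)]
      · refine congr_arg₂ (· • ·) ?_ (t₂ (by omega))
        change ((Int.negOnePow ((0 - (p : ℤ)) * ((p + 1 - p : ℕ) : ℤ)) : ℤˣ) : ℤ) = (-1) ^ p
        rw [Nat.add_sub_cancel_left, Nat.cast_one, mul_one, zero_sub, Int.negOnePow_neg]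
        simp [Int.negOnePow]
      · intro k _
        exact (congr_arg _ (t₃ k.1 (by omega))).trans (smul_zero _)

/-- The Čech differential of sections also omits the last index, that of morphisms only interior
ones. The extra face is exactly what the identities `a^{1,0}` of T(E) contribute, so all terms
cancel. -/
theorem diff_adjoint : TwistedComplex.diff (e := 1) rfl (adjoint φ) = 0 := by
  refine Cochain.ext_ev fun {p l x y n m} hl hx hy hd z => ?_
  revert z
  refine fun z => congr($(Res.hom_ext₂ R (le_top : U x ≤ ⊤) _ (M := E.X n)
    (a := (TwistedComplex.diff (e := 1) rfl (adjoint φ)).ev hl hx hy hd le_rfl)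
    (b := (0 : Cochain (twisting U E).obj F.obj 1).ev hl hx hy hd le_rfl) fun e => ?_) z)
  have e₀ := Cochain.ev_cech_apply (e := 1) rfl (adjoint φ) hl hx hy hd le_rfl
    (Res.unit R (le_of_getLast hx le_rfl) (Res.unit R (le_top : U x ≤ ⊤) e))
  replace e₀ := e₀.trans (Finset.sum_congr rfl fun k _ => congr_arg _ (adjoint_ev φ _ _ _ _ _ e))
  have e₁ := comp_adjoint_ev φ F.a hl hx hy hd le_rfl e
  have e₂ := adjoint_comp_twisting_ev φ hl hx hy hd le_rfl e
  have e₃ : Sec.ev (F.secDiff rfl ((φ.f n).hom e : Sec F.obj n)) hl hy hd.symm le_rfl =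
     Sec.ev (Sec.cech rfl ((φ.f n).hom e : Sec F.obj n)) hl hy hd.symm le_rfl +
     Sec.ev (Sec.act rfl F.a ((φ.f n).hom e : Sec F.obj n)) hl hy hd.symm le_rfl :=
    map_add (Res.move R _ _) _ _
  have e₄ := Sec.ev_cech (n' := n + 1) rfl ((φ.f n).hom e : Sec F.obj n) hl hy hd.symm
    (le_refl (inter U l))
  refine Eq.trans ?_ congr($(Res.moveHom_zero R _) _).symm
  rw [TwistedComplex.diff, Int.negOnePow_zero, Units.val_one, one_smul, sub_eq_add_neg, ← neg_one_zsmul,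
    Cochain.ev_add, Cochain.ev_add, Cochain.ev_zsmul]
  refine (congr_arg₂ (· + ·) (congr_arg₂ (· + ·) e₀ e₁)
    (congr_arg ((-1 : ℤ) • ·) (e₂.trans (congr_arg (· + _)
      (e₃.trans (congr_arg (· + _) e₄)))))).trans ?_
  -- Here `a` is δ of the adjoint, `b` is δ of the section φ e, `c` is the action of the twisting
  -- cochain of `F`, and `t` is the last-index term; only `b = a - t` remains to be checked.
  suffices H : ∀ {M : Type u} [AddCommGroup M] {a b c t : M}, b = a - t →
      a + c + (-1 : ℤ) • (b + c + t) = 0 by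
    refine H ?_
    clear e₀ e₁ e₂ e₃ e₄
    match p, hl, hd with
    | 0, hl, hd =>
      rw [dif_neg (by omega), sub_zero]
    | p + 1, hl, hd =>
      rw [Fin.sum_univ_castSucc, dif_pos (by omega), sub_eq_add_neg]
      refine congr_arg₂ (· + ·) rfl ?_
      rw [← neg_smul]
      refine congr_arg₂ (· • ·) ?_ ?_
      · simp [pow_succ]
      · refine Sec.ev_congr _ _ _ _ _ _ _ _ _ ?_
        have : l.length = p + 1 + 1 := hl
        simp [List.eraseIdx_eq_take_drop_succ, this]
  intro M _ a b c t h
  rw [h, neg_one_zsmul]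
  abel

end Adjoint

end TwistedDescent

end

noncomputable section

namespace TwistedDescent

/-! ### The adjoint of a quasi-isomorphism -/

section AdjointEquivalence

variable {X : TopCat.{u}} {R : (Opens X)ᵒᵖ ⥤ RingCat.{u}} {ι : Type u} {U : ι → Opens X}

/-- Cohomology classes over V lift to classes over X, and a relation over V holds over X after a
cutoff that is 1 on V and so disappears on restriction. -/
theorem IsLocalModel.isQuasiIso {V : Opens X} {Q S : Cpx R ⊤} {Q' P : Cpx R V}
    {η : ∀ n, Q.X n →ₛₗ[rho R (le_top : V ≤ ⊤)] Q'.X n}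
    {π : ∀ n, S.X n →ₛₗ[rho R (le_top : V ≤ ⊤)] P.X n} {α : Q ⟶ S} {β : Q' ⟶ P}
    (hη : IsLocalModel η) (hπ : IsLocalModel π)
    (hβ : ∀ n x, (β.f n).hom (η n x) = π n ((α.f n).hom x)) (hα : IsQuasiIso α) :
    IsQuasiIso β := by
  refine fun n => ⟨fun y hy => ?_, fun x hx => ?_⟩
  · obtain ⟨c, hc, w, hw⟩ := hπ.surj n y hy
    obtain ⟨x, hx, t, rfl⟩ := (hα n).1 c hc
    refine ⟨η _ x, by rw [← hη.comm, hx, map_zero], π _ t - w, ?_⟩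
    rw [map_add, hπ.comm] at hw
    rw [hβ, map_sub, ← add_sub_assoc, hw, add_sub_cancel_right]
  · rintro ⟨t, ht⟩
    obtain ⟨e, he, w, hw⟩ := hη.surj n x hx
    obtain ⟨f, hf, s, hs⟩ := hπ.inj n ((α.f _).hom e) (by rw [← hom_d_apply, he, map_zero])
      (t + (β.f _).hom w) (by rw [← hβ, hw, map_add, map_add, ht, hom_d_apply])
    obtain ⟨t', ht'⟩ := (hα n).2 (f • e) (by rw [map_smul, he, smul_zero])
      ⟨s, by rw [map_smul, hs]⟩
    refine ⟨η _ t' - w, ?_⟩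
    rw [map_sub, ← hη.comm, ← ht', map_smulₛₗ, hf, one_smul, hw, add_sub_cancel_right]

theorem Res.unit_eq_zero_of_unit_unit {V W : Opens X} {h : V ≤ ⊤} {h' : W ≤ V} {M : Type u}
    [AddCommGroup M] [Module (R.obj (op ⊤)) M] {m : M}
    (hm : Res.unit R h' (Res.unit R h m) = 0) : Res.unit R (h'.trans h) m = 0 := by
  have := congr(Res.collapse R h h' $hm)
  rwa [map_zero, Res.collapse, Res.lift_unit, Res.move_unit] at this

/-- A vertex of T(E) is a restriction of a restriction. The collapse of (M|_V)|_W to M|_W reduces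
the argument to that for a single restriction. -/
theorem isLocalModel_unit_unit (hR : IsSoftPresheaf R) (Q : Cpx R ⊤) {V W : Opens X} (h : W ≤ V) :
    IsLocalModel (P := resCpx h (resCpx (le_top : V ≤ ⊤) Q))
      (fun n => (Res.unit R h).comp (Res.unit R (le_top : V ≤ ⊤) (M := Q.X n))) where
  comm n x := ((resCpx_d_unit _ _ _ _ _).trans (congr_arg _ (resCpx_d_unit _ _ _ _ _))).symm
  surj n z hz := by
    obtain ⟨q, rfl⟩ := Res.unit_surjective hR h z
    obtain ⟨q, rfl⟩ := Res.unit_surjective hR (le_top : V ≤ ⊤) q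
    obtain ⟨f, hf, hfq⟩ := (Res.unit_eq_zero_iff hR (le_top : W ≤ ⊤) _).1
      (Res.unit_eq_zero_of_unit_unit (((resCpx_d_unit _ _ _ _ _).trans
        (congr_arg _ (resCpx_d_unit _ _ _ _ q))).symm.trans hz))
    rw [rho_self] at hfq
    have e : Res.unit R h (Res.unit R (le_top : V ≤ ⊤) (f • q)) =
        Res.unit R h (Res.unit R (le_top : V ≤ ⊤) q) := by
      rw [LinearMap.map_smulₛₗ, LinearMap.map_smulₛₗ, rho_rho, hf, one_smul]
    refine ⟨f • q, by rw [map_smul, hfq], 0, e.trans ?_⟩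
    rw [map_zero]
    exact (add_zero _).symm
  inj n c hc w hw := by
    obtain ⟨q, rfl⟩ := Res.unit_surjective hR h w
    obtain ⟨q, rfl⟩ := Res.unit_surjective hR (le_top : V ≤ ⊤) q
    have key := hw.trans ((resCpx_d_unit _ _ _ _ _).trans
        (congr_arg _ (resCpx_d_unit _ _ _ _ q)))
    obtain ⟨f, hf, hfq⟩ := (Res.unit_eq_zero_iff hR (le_top : W ≤ ⊤) _).1
      (Res.unit_eq_zero_of_unit_unit (h := (le_top : V ≤ ⊤)) (h' := h)
        (m := c - (Q.d n (n + 1)).hom q) (by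
          rw [map_sub, map_sub]
          exact sub_eq_zero.2 key))
    rw [rho_self, smul_sub, sub_eq_zero, ← map_smul] at hfq
    exact ⟨f, hf, _, hfq⟩

variable {F : TwistedComplex R U} {E : Cpx R ⊤} {φ : E ⟶ F.sheafification}

/-- At a vertex the adjoint is the map induced by φ between local models of E and of S(F), hence a
quasi-isomorphism of strictly perfect complexes. -/
theorem isHomotopyEquivalence_adjoint (hR : IsSoftPresheaf R) (P : FinitePartition R U)
    (hE : IsStrictlyPerfect E) (hF : ∀ i, IsStrictlyPerfect (F.obj i)) (hφ : IsQuasiIso φ) :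
    TwistedComplex.IsHomotopyEquivalence (adjoint φ) := by
  refine TwistedComplex.isHomotopyEquivalence_of_isQuasiIso hR (fun i => hE.resCpx hR le_top) hF
    (adjoint φ) (diff_adjoint φ) fun i => ?_
  refine (isLocalModel_unit_unit hR E (inter_le (List.mem_singleton_self i))).isQuasiIso
    (F.isLocalModel_toVertex hR P i) (fun n e => ?_) hφ
  refine (congr($(Cochain.ev_eq_atVertex (adjoint φ) i (add_zero n)) _)).symm.trans ?_
  refine (adjoint_ev φ (p := 0) (l := [i]) rfl rfl rfl (by simp) le_rfl e).trans ?_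
  exact Res.move_self _

theorem le_inter_singleton (i : ι) : U i ≤ inter U [i] := fun x hx =>
  Set.mem_iInter₂.2 fun j hj => by rwa [List.mem_singleton.1 hj]

/-- The components of F at the finitely many `τ j` are strictly perfect local models of S(F);
finiteness gives them common degree bounds. -/
theorem exists_isQuasiIso_sheafification (hR : IsSoftPresheaf R) (P : FinitePartition R U)
    (F : TwistedComplex R U) (hF : ∀ i, IsStrictlyPerfect (F.obj i)) :
    ∃ (E : Cpx R ⊤) (φ : E ⟶ F.sheafification), IsStrictlyPerfect E ∧ IsQuasiIso φ := by
  have hM : ∀ j, IsStrictlyPerfect (vertexCpx F.obj (P.τ j)) := fun j => (hF _).resCpx hR _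
  have hπ : ∀ j, IsLocalModel (F.toVertex (P.τ j)) := fun j => F.isLocalModel_toVertex hR P _
  choose a b hab using fun j => (hM j).1
  obtain ⟨a₀, ha₀⟩ := (Set.finite_range a).bddBelow
  obtain ⟨b₀, hb₀⟩ := (Set.finite_range b).bddAbove
  -- The shift to `a₀ - 1` arises because cohomology with index m sits in degree m + 1, and the
  -- lower bound is stated as a + 1.
  refine exists_isStrictlyPerfect_of_local hR P (fun j => le_inter_singleton (P.τ j)) hM hπ
    (a₀ - 1) (fun j n hn => hab j n (Or.inl ?_)) (b₀ - a₀).toNat fun m hm => ?_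
  · have := ha₀ ⟨j, rfl⟩
    omega
  · refine isExactAt_of_local hR P (fun j => le_inter_singleton (P.τ j)) hπ m fun j z _ => ?_
    have := hb₀ ⟨j, rfl⟩
    have := hab j (m + 1) (Or.inr (by omega))
    exact ⟨0, Subsingleton.elim _ _⟩

end AdjointEquivalence

end TwistedDescent

end

theorem proposition4p2 {X : TopCat.{u}} [T2Space X] [ParacompactSpace X]
    (A : TopCat.Sheaf RingCat.{u} X) (hA : IsSoft A)
    (hX : ∀ (κ : Type u) (W : κ → Opens X), IsLocallyFiniteCover W → HasFiniteGoodRefinement W)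
    {ι : Type u} (U : ι → Opens X) (hU : IsLocallyFiniteCover U)
    (F : TwistedComplex (closureSections A.obj) U) (hF : ∀ i, IsStrictlyPerfect (F.obj i)) :
    ∃ (E : Cpx (closureSections A.obj) ⊤) (φ : E ⟶ F.sheafification),
      IsStrictlyPerfect E ∧ QuasiIso φ ∧
        TwistedComplex.IsHomotopyEquivalence
          (Cochain.comp (f := 0) rfl F.counit (twistingHom U φ)) := by
  have hR := isSoftPresheaf_closureSections hA
  obtain ⟨P⟩ := exists_finitePartition hA (hX ι U hU)
  obtain ⟨E, φ, hE, hφ⟩ := exists_isQuasiIso_sheafification hR P F hF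
  exact ⟨E, φ, hE, hφ.quasiIso, isHomotopyEquivalence_adjoint hR P hE hF hφ⟩
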